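/- Let $d\ge 1$. Let $W$ be a Lévy measure on $\mathbb R$ ($W(\{0\})=0$, $\int\min(1,x^2)\,W(dx)<\infty$), $b\ge 0$, $\tau(x)=x$ for $|x|\le 1$ and $\tau(x)=\operatorname{sign}(x)$ for $|x|>1$, and $$\mathcal K(s)=-\tfrac b2 s^2+\int_{\mathbb R}\big(e^{isx}-1-is\tau(x)\big)W(dx).$$ Let $\pi$ be a probability measure on $(0,\infty)$. Let $\mathcal S'$ be a ring of Borel subsets of $(0,\infty)\times\mathbb R^d$ of finite $\pi\times\mathrm{Leb}$ measure, closed under countable intersections and containing an increasing sequence of sets with union $(0,\infty)\times\mathbb R^d$. Let $\Lambda$ be an independently scattered infinitely divisible random measure on $\mathcal S'$ with $\log E e^{is\Lambda(A)}=[\pi\times \mathrm{Leb}](A)\,\mathcal K(s)$ for $A\in\mathcal S'$. Let $$X(\mathbf t)=-\int_0^\infty\!\int_{\mathbb R^d}\frac1{2\lambda}e^{-\lambda\|\mathbf t-\mathbf u\|}\,\Lambda(d\mathbf u,d\lambda),\qquad \mathbf t\in\mathbb R^d,$$ be the supCAR field, the integral being the Rajput–Rosinski integral (limit in probability of integrals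 of simple functions over sets of $\mathcal S'$ that converge to the integrand a.e. and whose integrals over every set of $\sigma(\mathcal S')$ converge in probability). Assume that either (i) $b>0$, $\int_0^\infty\frac{|\ln\lambda|^d}{\lambda^{d+2}}\pi(d\lambda)<\infty$ and $\int_{|x|\ge1}|x|(\ln|x|)^{d-1}W(dx)<\infty$; or (ii) $b=0$, $\int_0^\infty\frac{|\ln\lambda|^{d-1}}{\lambda^{d+1}}\pi(d\lambda)<\infty$, $\int_{|x|\ge1}|x|(\ln|x|)^{d-1}W(dx)<\infty$, $\int_0^{1/2}\frac{|\ln\lambda|^{d-1}}{\lambda^{d+2}}\int_{-2\lambda}^{2\lambda}x^2\,W(dx)\,\pi(d\lambda)<\infty$ and $\int_0^{1/2}\frac{|\ln\lambda|^{d}}{\lambda^{d+2-k}}\int_{2\lambda\le|x|\le1}|x|^{2-k}\,W(dx)\,\pi(d\lambda)<\infty$ for $k=1,2$. Assume further that $X(\mathbf t)$ has finite second moment and $EX(\mathbf t)=0$ for all $\mathbf t$, and that $\pi$ has density $p(\lambda)=l(1/\lambda)\lambda^{\alpha-1}$, $\lambda>0$, where $\alpha>d+2$ and $l$ is a measurable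 function on $(0,\infty)$ that is slowly varying at infinity, strictly positive, and bounded on each compact subset of $(0,\infty)$. Let $K_\nu$ be the modified Bessel function of the second kind and let $$c_1=\begin{cases}-2^{d/2-1}\Gamma(\frac{d+1}2)/\sqrt\pi,& d\text{ odd},\\ -2^{-d/2}\Gamma(d)/\Gamma(\frac d2),& d\text{ even},\end{cases}\qquad c_2=\frac{c_1^2}{\Gamma(d+1)}\Big(\frac\pi2\Big)^{d/2},$$ $$c_3=-c_2\,\mathcal K''(0)\int_0^\infty\lambda^{\alpha-\frac d2-2}K_{\frac d2+1}(\lambda)\,d\lambda,\qquad c_4=-c_1^2\,\mathcal K''(0)\int_0^\infty\frac{\lambda^{\alpha-1}}{(1+\lambda^2)^{d+1}}\,d\lambda$$ (in the formulas for $c_1$ and $c_2$, $\pi=3.14\ldots$). Then $\mathcal K$ is twice continuously differentiable with $\mathcal K''(0)\in\mathbb R$, the covariance $r(\mathbf t)=\operatorname{Cov}(X(\mathbf s),X(\mathbf s+\mathbf t))$ does not depend on $\mathbf s$, and $$r(\mathbf t)\sim c_3\,\frac{l(\|\mathbf t\|)}{\|\mathbf t\|^{\alpha-d-2}},\qquad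 \|\mathbf t\|\to\infty .$$ If moreover $\alpha\in(d+2,2d+2)$, then $X$ has a spectral density that is continuous on $\mathbb R^d\setminus\{\mathbf 0\}$, that is, a nonnegative integrable $f$ with $\operatorname{Cov}(X(\mathbf s),X(\mathbf t))=\int_{\mathbb R^d}e^{i\langle\boldsymbol\omega,\mathbf t-\mathbf s\rangle}f(\boldsymbol\omega)\,d\boldsymbol\omega$ for all $\mathbf s,\mathbf t$; every such $f$ satisfies $$f(\boldsymbol\omega)\sim c_4\,\frac{l(1/\|\boldsymbol\omega\|)}{\|\boldsymbol\omega\|^{2d+2-\alpha}},\qquad \boldsymbol\omega\to\mathbf 0,$$ and, if $b>0$ or $W\ne0$, it is singular at the origin: $f(\boldsymbol\omega)\to\infty$ as $\boldsymbol\omega\to\mathbf 0$. (For $b=0$, $W=0$ both asymptotic relations are understood as: both sides vanish for $\|\mathbf t\|$ large, respectively for $\boldsymbol\omega\neq \mathbf 0$ near $\mathbf 0$.) -/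

import Mathlib

open MeasureTheory ProbabilityTheory Filter Topology Asymptotics

noncomputable section

namespace SupCAR

/-! ### Lévy-Khinchine data -/

/-- The truncation function: `τ x = x` for `|x| ≤ 1` and `τ x = sign x` otherwise. -/
def tau (x : ℝ) : ℝ := if |x| ≤ 1 then x else Real.sign x

/-- Lévy measures on `ℝ`. -/
structure IsLevyMeasure (W : Measure ℝ) : Prop where
  zero_singleton : W {0} = 0
  lintegral_lt_top : ∫⁻ x, ENNReal.ofReal (min 1 (x ^ 2)) ∂W < ⊤

/-- The cumulant function `-b s² / 2 + ∫ (e^{isx} - 1 - i s τ(x)) W(dx)` of the infinitely divisible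
law with Gaussian variance `b`, Lévy measure `W` and zero drift. -/
def cumulant (b : ℝ) (W : Measure ℝ) (s : ℝ) : ℂ :=
  -((b : ℂ) / 2) * (s : ℂ) ^ 2 +
    ∫ x : ℝ, (Complex.exp (Complex.I * s * x) - 1 - Complex.I * s * (tau x : ℂ)) ∂W

/-! ### Independently scattered random measures and the Rajput-Rosinski integral -/

section RandomMeasure

variable {T Ω : Type*}

/-- A ring of sets closed under countable intersections, which contains an increasing sequence
of sets exhausting the space. -/
structure IsExhaustingRing (S : Set (Set T)) : Prop where
  isSetRing : IsSetRing S
  iInter_mem : ∀ A : ℕ → Set T, (∀ n, A n ∈ S) → (⋂ n, A n) ∈ S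
  exhausting : ∃ U : ℕ → Set T, Monotone U ∧ (∀ n, U n ∈ S) ∧ (⋃ n, U n) = Set.univ

/-- `Λ` is an independently scattered infinitely divisible random measure on the ring `S`, whose
cumulant function factorises as `log E exp (i s Λ(A)) = μ(A) K(s)`. The series
in the additivity property converges almost surely as a limit of partial sums. -/
structure IsScatteredMeasure [MeasurableSpace T] [MeasurableSpace Ω] (P : Measure Ω)
    (S : Set (Set T)) (μ : Measure T) (K : ℝ → ℂ) (Λ : Set T → Ω → ℝ) : Prop where
  ring : IsExhaustingRing S
  measurableSet : ∀ A ∈ S, MeasurableSet A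
  finite : ∀ A ∈ S, μ A < ⊤
  measurable : ∀ A ∈ S, Measurable (Λ A)
  indep : ∀ A : ℕ → Set T, (∀ n, A n ∈ S) → Pairwise (Function.onFun Disjoint A) →
    iIndepFun (fun n => Λ (A n)) P
  additive : ∀ A : ℕ → Set T, (∀ n, A n ∈ S) → Pairwise (Function.onFun Disjoint A) →
    (⋃ n, A n) ∈ S →
    ∀ᵐ ω ∂P, Tendsto (fun N => ∑ n ∈ Finset.range N, Λ (A n) ω) atTop (𝓝 (Λ (⋃ n, A n) ω))
  charFun_eq : ∀ A ∈ S, ∀ s : ℝ,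
    ∫ ω, Complex.exp (Complex.I * s * (Λ A ω : ℂ)) ∂P = Complex.exp (((μ A).toReal : ℂ) * K s)

/-- Simple functions `∑ aᵢ 1_{Aᵢ}` over disjoint sets `Aᵢ ∈ S`. -/
structure RingSimple (S : Set (Set T)) where
  card : ℕ
  coef : Fin card → ℝ
  carrier : Fin card → Set T
  mem : ∀ i, carrier i ∈ S
  disjoint : Pairwise (Function.onFun Disjoint carrier)

/-- The function `∑ aᵢ 1_{Aᵢ}`. -/
def RingSimple.eval {S : Set (Set T)} (φ : RingSimple S) (x : T) : ℝ :=
  ∑ i, (φ.carrier i).indicator (fun _ => φ.coef i) x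

/-- The integral `∑ aᵢ Λ(Aᵢ ∩ B)` of a simple function over `B`. -/
def RingSimple.integral {S : Set (Set T)} (φ : RingSimple S) (Λ : Set T → Ω → ℝ) (B : Set T)
    (ω : Ω) : ℝ :=
  ∑ i, φ.coef i * Λ (φ.carrier i ∩ B) ω

/-- `f` is `Λ`-integrable in the sense of Rajput and Rosinski and `Y` is its integral over the whole
space: for some simple functions converging to `f` almost everywhere, the integrals over every
set of `σ(S)` converge in probability, and those over the whole space converge to `Y`. -/
def IsRRIntegral [MeasurableSpace T] [MeasurableSpace Ω] (P : Measure Ω) (S : Set (Set T))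
    (μ : Measure T) (Λ : Set T → Ω → ℝ) (f : T → ℝ) (Y : Ω → ℝ) : Prop :=
  ∃ φ : ℕ → RingSimple S,
    (∀ᵐ x ∂μ, Tendsto (fun n => (φ n).eval x) atTop (𝓝 (f x))) ∧
    (∀ B : Set T, MeasurableSet[MeasurableSpace.generateFrom S] B →
      ∃ Z : Ω → ℝ, TendstoInMeasure P (fun n => (φ n).integral Λ B) atTop Z) ∧
    TendstoInMeasure P (fun n => (φ n).integral Λ Set.univ) atTop Y

end RandomMeasure

/-! ### supCAR fields -/

/-- The space `(0,∞) × ℝ^d`. -/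
abbrev Param (d : ℕ) : Type := Set.Ioi (0 : ℝ) × EuclideanSpace ℝ (Fin d)

/-- The CAR(1) kernel `-(1/(2λ)) e^{-λ ‖t-u‖}`. -/
def kernel {d : ℕ} (t : EuclideanSpace ℝ (Fin d)) (p : Param d) : ℝ :=
  -(1 / (2 * (p.1 : ℝ))) * Real.exp (-(p.1 : ℝ) * ‖t - p.2‖)

/-- `X` is the supCAR field driven by the random measure `Λ` on the ring `S`, with characteristic
quadruple `(0, b, W, π)`. -/
structure IsSupCARField {Ω : Type*} [MeasurableSpace Ω] (P : Measure Ω) {d : ℕ}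
    (S : Set (Set (Param d))) (Λ : Set (Param d) → Ω → ℝ)
    (b : ℝ) (W : Measure ℝ) (π : Measure (Set.Ioi (0 : ℝ)))
    (X : EuclideanSpace ℝ (Fin d) → Ω → ℝ) : Prop where
  scattered : IsScatteredMeasure P S (π.prod volume) (cumulant b W) Λ
  integral : ∀ t, IsRRIntegral P S (π.prod volume) Λ (kernel t) (X t)

/-- The conditions on `(b, W, π)` under which the supCAR field is well-defined: case (i) `b > 0`,
case (ii) `b = 0`. -/
def WellDefinedConditions (d : ℕ) (b : ℝ) (W : Measure ℝ) (π : Measure (Set.Ioi (0 : ℝ))) : Prop :=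
  (0 < b ∧
    ∫⁻ v, ENNReal.ofReal (|Real.log (v : ℝ)| ^ d / (v : ℝ) ^ (d + 2)) ∂π < ⊤ ∧
    ∫⁻ x in {x : ℝ | 1 ≤ |x|}, ENNReal.ofReal (|x| * Real.log |x| ^ (d - 1)) ∂W < ⊤) ∨
  (b = 0 ∧
    ∫⁻ v, ENNReal.ofReal (|Real.log (v : ℝ)| ^ (d - 1) / (v : ℝ) ^ (d + 1)) ∂π < ⊤ ∧
    ∫⁻ x in {x : ℝ | 1 ≤ |x|}, ENNReal.ofReal (|x| * Real.log |x| ^ (d - 1)) ∂W < ⊤ ∧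
    ∫⁻ v in {v : Set.Ioi (0 : ℝ) | (v : ℝ) ≤ 1 / 2},
      ENNReal.ofReal (|Real.log (v : ℝ)| ^ (d - 1) / (v : ℝ) ^ (d + 2)) *
        ∫⁻ x in {x : ℝ | |x| ≤ 2 * v}, ENNReal.ofReal (x ^ 2) ∂W ∂π < ⊤ ∧
    ∀ k ∈ ({1, 2} : Set ℕ),
      ∫⁻ v in {v : Set.Ioi (0 : ℝ) | (v : ℝ) ≤ 1 / 2},
        ENNReal.ofReal (|Real.log (v : ℝ)| ^ d / (v : ℝ) ^ (d + 2 - k)) *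
          ∫⁻ x in {x : ℝ | 2 * v ≤ |x| ∧ |x| ≤ 1}, ENNReal.ofReal (|x| ^ (2 - k)) ∂W ∂π < ⊤)

/-- Slowly varying functions at infinity (defined and measurable on `(0,∞)`). -/
structure IsSlowlyVarying (l : ℝ → ℝ) : Prop where
  measurable : Measurable (fun x : Set.Ioi (0 : ℝ) => l (x : ℝ))
  tendsto : ∀ c : ℝ, 0 < c → Tendsto (fun x => l (c * x) / l x) atTop (𝓝 1)

/-- The covariance function `r(t) = Cov(X(0), X(t))`. -/
def covFun {Ω : Type*} [MeasurableSpace Ω] (P : Measure Ω) {d : ℕ}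
    (X : EuclideanSpace ℝ (Fin d) → Ω → ℝ) (t : EuclideanSpace ℝ (Fin d)) : ℝ :=
  covariance (X 0) (X t) P

/-- `f` is a spectral density of `X`: it is nonnegative, integrable, and
`Cov(X(s), X(t)) = ∫ e^{i⟨ω, t-s⟩} f(ω) dω`. -/
structure IsSpectralDensity {Ω : Type*} [MeasurableSpace Ω] (P : Measure Ω) {d : ℕ}
    (X : EuclideanSpace ℝ (Fin d) → Ω → ℝ) (f : EuclideanSpace ℝ (Fin d) → ℝ) : Prop where
  nonneg : ∀ w, 0 ≤ f w
  integrable : Integrable f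
  cov_eq : ∀ s t, ((covariance (X s) (X t) P : ℝ) : ℂ) =
    ∫ w, Complex.exp (Complex.I * ((inner ℝ w (t - s) : ℝ) : ℂ)) * (f w : ℂ)

/-! ### Constants -/

/-- The modified Bessel function of the second kind,
`K_ν(x) = ∫_0^∞ e^{-x cosh s} cosh(ν s) ds` for `x > 0`. -/
def besselK (ν x : ℝ) : ℝ :=
  ∫ s in Set.Ioi (0 : ℝ), Real.exp (-x * Real.cosh s) * Real.cosh (ν * s)

/-- The constant `c₁`. -/
def c1 (d : ℕ) : ℝ :=
  if Odd d then -(2 : ℝ) ^ ((d : ℝ) / 2 - 1) * Real.Gamma (((d : ℝ) + 1) / 2) / √Real.pi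
  else -(2 : ℝ) ^ (-((d : ℝ) / 2)) * Real.Gamma d / Real.Gamma ((d : ℝ) / 2)

/-- The constant `c₂`. -/
def c2 (d : ℕ) : ℝ :=
  c1 d ^ 2 / Real.Gamma ((d : ℝ) + 1) * (Real.pi / 2) ^ ((d : ℝ) / 2)

/-- The constant `c₃`, where `κ` stands for the second derivative at `0` of the cumulant function. -/
def c3 (d : ℕ) (α κ : ℝ) : ℝ :=
  -c2 d * κ *
    ∫ v in Set.Ioi (0 : ℝ), v ^ (α - (d : ℝ) / 2 - 2) * besselK ((d : ℝ) / 2 + 1) v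

/-- The constant `c₄`, where `κ` stands for the second derivative at `0` of the cumulant function. -/
def c4 (d : ℕ) (α κ : ℝ) : ℝ :=
  -c1 d ^ 2 * κ * ∫ v in Set.Ioi (0 : ℝ), v ^ (α - 1) / (1 + v ^ 2) ^ (d + 1)

end SupCAR

end

noncomputable section

namespace SupCAR

open scoped ENNReal

/-! ### The real part of the cumulant function -/

/-! The proof computes all covariances by an isometry for the stochastic integral, turns the
resulting kernel integral into a Gaussian mixture, and reads off both asymptotic relations from one
Abelian theorem.

Isometry. For a simple `g`, independence over disjoint sets gives a characteristic function of
modulus `exp (-∫ rho (s g))`, where `rho = -Re K` contains neither drift nor truncation. Since `rho`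
satisfies a quasi-triangle inequality (`rho_add_le`), the functionals `∫ rho (s g)` behave like
squared norms: a Cauchy sequence of integrals is Cauchy in this sense, and the formula passes to the
limit (`norm_charFun_limit`). Dividing by `s²` and letting `s → 0` gives `E Z² = levyVar * ∫ G²` in
`[0, ∞]` (`ofReal_second_moment`). Applied to `X 0`, this forces `levyVar = b + ∫ x² dW` to be
finite, so `K` is `C²` with `K''(0) = -levyVar`. Applied to `X s + X t`, it yields the covariance by
polarisation.

Explicit form. Subordination writes `exp (-v r)` as a mixture of Gaussians. Convolving two mixtures
leaves a beta integral, and the rate-`v` covariance becomes a constant times `∫ A^(d/2) exp (-v² A -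
‖s-t‖²/(4A)) dA`. This is a Bessel function `K_(d/2+1)`, and it is also the Fourier transform of a
multiple of `(v² + ‖w‖²)^(-(d+1))`. The latter, averaged over `π`, gives the spectral density.

Asymptotics. After scaling, both quantities are explicit powers times `∫ h (v R) π(dv)`, with `R =
‖t‖` or `R = 1/‖w‖`. The uniform convergence theorem and Potter's bounds show that this is
asymptotic to `L R * R^(-α) * ∫ v^(α-1) h` whenever `h` is dominated by powers on both sides of
`v^(-α)` (`tendsto_mellin_convolution`). The condition `α > d + 2` is what the Bessel profile needs
at the origin, and `α < 2d + 2` is what the spectral profile needs at infinity. Injectivity of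
characteristic functions transfers the second relation to every spectral density continuous off the
origin. -/

/-- Minus the real part of the cumulant function. -/
def rho (b : ℝ) (W : Measure ℝ) (x : ℝ) : ℝ := -(cumulant b W x).re

theorem measurable_tau : Measurable tau := by
  unfold tau
  refine Measurable.ite (measurableSet_le (by fun_prop) (by fun_prop)) measurable_id ?_
  unfold Real.sign
  exact Measurable.ite (measurableSet_lt measurable_id measurable_const) measurable_const
    (Measurable.ite (measurableSet_lt measurable_const measurable_id) measurable_const
      measurable_const)

theorem abs_tau_le (x : ℝ) : |tau x| ≤ 1 := by
  unfold tau
  split_ifs with h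
  · exact h
  · rcases lt_trichotomy x 0 with h | h | h
    · simp [Real.sign_of_neg h]
    · simp [h]
    · simp [Real.sign_of_pos h]

theorem IsLevyMeasure.integrable_min {W : Measure ℝ} (hW : IsLevyMeasure W) :
    Integrable (fun x : ℝ => min 1 (x ^ 2)) W := by
  refine ⟨by fun_prop, ?_⟩
  rw [hasFiniteIntegral_iff_ofReal (ae_of_all _ fun x => by positivity)]
  exact hW.lintegral_lt_top

theorem norm_exp_I_sub_one_sub_le (y : ℝ) :
    ‖Complex.exp (Complex.I * y) - 1 - Complex.I * y‖ ≤ 3 * y ^ 2 := by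
  have hn : ‖Complex.I * (y : ℂ)‖ = |y| := by simp
  rcases le_or_gt |y| 1 with h | h
  · have := Complex.norm_exp_sub_one_sub_id_le (x := Complex.I * y) (by rw [hn]; exact h)
    rw [hn, sq_abs] at this
    nlinarith [sq_nonneg y]
  · have h1 : ‖Complex.exp (Complex.I * y)‖ = 1 := by
      rw [mul_comm]; exact Complex.norm_exp_ofReal_mul_I y
    calc _ ≤ ‖Complex.exp (Complex.I * y)‖ + ‖(1 : ℂ)‖ + ‖Complex.I * (y : ℂ)‖ :=
          (norm_sub_le _ _).trans (by gcongr; exact norm_sub_le _ _)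
      _ ≤ 3 * y ^ 2 := by
          rw [h1, hn, norm_one, ← sq_abs]; nlinarith

/-- For `|x| ≤ 1` the truncation is the identity and this is a second order Taylor remainder; for
`|x| > 1` every term is bounded. -/
theorem norm_cumulant_integrand_le (s x : ℝ) :
    ‖Complex.exp (Complex.I * s * x) - 1 - Complex.I * s * (tau x : ℂ)‖
      ≤ (2 + |s| + 3 * s ^ 2) * min 1 (x ^ 2) := by
  rcases le_or_gt |x| 1 with h | h
  · have h2 : min 1 (x ^ 2) = x ^ 2 := min_eq_right (by rw [← sq_abs]; nlinarith [abs_nonneg x])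
    have := norm_exp_I_sub_one_sub_le (s * x)
    rw [h2, tau, if_pos h]
    push_cast at this
    rw [← mul_assoc] at this
    refine this.trans ?_
    nlinarith [mul_nonneg (abs_nonneg s) (sq_nonneg x), sq_nonneg x]
  · have h2 : min 1 (x ^ 2) = 1 := min_eq_left (by rw [← sq_abs]; nlinarith [abs_nonneg x])
    have h1 : ‖Complex.exp (Complex.I * s * x)‖ = 1 := by
      have := Complex.norm_exp_ofReal_mul_I (s * x)
      rw [← this]; congr 2; push_cast; ring
    calc _ ≤ ‖Complex.exp (Complex.I * s * x)‖ + ‖(1 : ℂ)‖ + ‖Complex.I * s * (tau x : ℂ)‖ :=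
          (norm_sub_le _ _).trans (by gcongr; exact norm_sub_le _ _)
      _ ≤ _ := by
          rw [h1, h2, norm_one]
          have := mul_le_mul_of_nonneg_left (abs_tau_le x) (abs_nonneg s)
          simp only [norm_mul, Complex.norm_I, Complex.norm_real, Real.norm_eq_abs]
          nlinarith [sq_nonneg s]

theorem measurable_cumulant_integrand (s : ℝ) : Measurable fun x : ℝ =>
    Complex.exp (Complex.I * s * x) - 1 - Complex.I * s * (tau x : ℂ) := by
  have := measurable_tau
  fun_prop

theorem integrable_cumulant_integrand {W : Measure ℝ} (hW : IsLevyMeasure W) (s : ℝ) :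
    Integrable (fun x : ℝ =>
      Complex.exp (Complex.I * s * x) - 1 - Complex.I * s * (tau x : ℂ)) W :=
  (hW.integrable_min.const_mul (2 + |s| + 3 * s ^ 2)).mono'
    (measurable_cumulant_integrand s).aestronglyMeasurable
    (ae_of_all _ fun x => norm_cumulant_integrand_le s x)

/-- The compensator `i s τ(x)` is purely imaginary, so the truncation disappears from the real part.
-/
theorem rho_eq {W : Measure ℝ} (hW : IsLevyMeasure W) (b s : ℝ) :
    rho b W s = b / 2 * s ^ 2 + ∫ x, (1 - Real.cos (s * x)) ∂W := by
  have h := integral_re (𝕜 := ℂ) (integrable_cumulant_integrand hW s)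
  simp only [RCLike.re_eq_complex_re] at h
  have h1 : (-((b : ℂ) / 2) * (s : ℂ) ^ 2).re = -(b / 2 * s ^ 2) := by
    rw [show -((b : ℂ) / 2) * (s : ℂ) ^ 2 = ((-(b / 2 * s ^ 2) : ℝ) : ℂ) by push_cast; ring]
    exact Complex.ofReal_re _
  rw [rho, cumulant, Complex.add_re, h1, ← h, neg_add, neg_neg, ← integral_neg]
  congr 1
  refine integral_congr_ae (ae_of_all _ fun x => ?_)
  have : (Complex.exp (Complex.I * s * x)).re = Real.cos (s * x) := by
    rw [← Complex.exp_ofReal_mul_I_re]; congr 2; push_cast; ring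
  simp [this, Complex.mul_re, Complex.mul_im]

theorem one_sub_cos_nonneg (y : ℝ) : 0 ≤ 1 - Real.cos y := by linarith [Real.cos_le_one y]

theorem one_sub_cos_le (y : ℝ) : 1 - Real.cos y ≤ y ^ 2 / 2 := by
  linarith [Real.one_sub_sq_div_two_le_cos (x := y)]

theorem one_sub_cos_mul_le (s x : ℝ) :
    1 - Real.cos (s * x) ≤ (2 + s ^ 2) * min 1 (x ^ 2) := by
  rcases le_total 1 (x ^ 2) with h | h
  · rw [min_eq_left h]; nlinarith [Real.neg_one_le_cos (s * x), sq_nonneg s]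
  · rw [min_eq_right h]
    have := one_sub_cos_le (s * x)
    nlinarith [sq_nonneg (s * x), sq_nonneg x]

theorem integrable_one_sub_cos {W : Measure ℝ} (hW : IsLevyMeasure W) (s : ℝ) :
    Integrable (fun x : ℝ => 1 - Real.cos (s * x)) W :=
  (hW.integrable_min.const_mul (2 + s ^ 2)).mono' (by fun_prop)
    (ae_of_all _ fun x => by
      rw [Real.norm_of_nonneg (one_sub_cos_nonneg _)]; exact one_sub_cos_mul_le s x)

theorem rho_nonneg {W : Measure ℝ} (hW : IsLevyMeasure W) {b : ℝ} (hb : 0 ≤ b) (s : ℝ) :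
    0 ≤ rho b W s := by
  rw [rho_eq hW]
  have : 0 ≤ ∫ x, (1 - Real.cos (s * x)) ∂W := integral_nonneg fun x => one_sub_cos_nonneg (s * x)
  positivity

theorem rho_zero {W : Measure ℝ} (hW : IsLevyMeasure W) (b : ℝ) : rho b W 0 = 0 := by
  rw [rho_eq hW]; simp

theorem ofReal_rho {W : Measure ℝ} (hW : IsLevyMeasure W) {b : ℝ} (hb : 0 ≤ b) (s : ℝ) :
    ENNReal.ofReal (rho b W s) =
      ENNReal.ofReal (b / 2 * s ^ 2) + ∫⁻ x, ENNReal.ofReal (1 - Real.cos (s * x)) ∂W := by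
  rw [rho_eq hW, ENNReal.ofReal_add (by positivity)
    (integral_nonneg fun x => one_sub_cos_nonneg (s * x)),
    ofReal_integral_eq_lintegral_ofReal (integrable_one_sub_cos hW s)
      (ae_of_all _ fun x => one_sub_cos_nonneg (s * x))]

theorem continuous_rho {W : Measure ℝ} (hW : IsLevyMeasure W) (b : ℝ) :
    Continuous (rho b W) := by
  have : rho b W = fun s => b / 2 * s ^ 2 + ∫ x, (1 - Real.cos (s * x)) ∂W :=
    funext fun s => rho_eq hW b s
  rw [this]
  refine Continuous.add (by fun_prop) (continuous_iff_continuousAt.2 fun s₀ => ?_)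
  refine continuousAt_of_dominated (bound := fun x => (2 + (|s₀| + 1) ^ 2) * min 1 (x ^ 2))
    (Eventually.of_forall fun s => by fun_prop) ?_ (hW.integrable_min.const_mul _)
    (ae_of_all _ fun x => by fun_prop)
  filter_upwards [Metric.ball_mem_nhds s₀ one_pos] with s hs
  refine ae_of_all _ fun x => ?_
  rw [Real.norm_of_nonneg (one_sub_cos_nonneg _)]
  refine (one_sub_cos_mul_le s x).trans ?_
  have h1 : |s| ≤ |s₀| + 1 := by
    have h2 : |s - s₀| < 1 := hs
    have h3 := abs_add_le (s - s₀) s₀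
    rw [sub_add_cancel] at h3
    linarith
  have : s ^ 2 ≤ (|s₀| + 1) ^ 2 := by rw [← sq_abs s]; gcongr
  gcongr

/-- Weighted AM-GM for the two products in the addition formula. The weight `ε` stays free so that
the factor of the first term can later be sent to `1`. -/
theorem sin_sq_add_le (x y : ℝ) {ε : ℝ} (hε : 0 < ε) :
    Real.sin (x + y) ^ 2 ≤ (1 + ε) * Real.sin x ^ 2 + (1 + ε⁻¹) * Real.sin y ^ 2 := by
  rw [Real.sin_add]
  set p := Real.sin x * Real.cos y
  set q := Real.cos x * Real.sin y
  have hp : p ^ 2 ≤ Real.sin x ^ 2 := by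
    simp only [p, mul_pow]; nlinarith [Real.cos_sq_le_one y, sq_nonneg (Real.sin x)]
  have hq : q ^ 2 ≤ Real.sin y ^ 2 := by
    simp only [q, mul_pow]; nlinarith [Real.cos_sq_le_one x, sq_nonneg (Real.sin y)]
  have h : (p + q) ^ 2 ≤ (1 + ε) * p ^ 2 + (1 + ε⁻¹) * q ^ 2 := by
    have h1 : 0 ≤ ε⁻¹ * (ε * p - q) ^ 2 := by positivity
    have h2 : ε⁻¹ * (ε * p - q) ^ 2 = ε * p ^ 2 - 2 * p * q + ε⁻¹ * q ^ 2 := by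
      field_simp; ring
    nlinarith
  have hi : 0 < ε⁻¹ := inv_pos.2 hε
  nlinarith

theorem one_sub_cos_add_le (x y : ℝ) {ε : ℝ} (hε : 0 < ε) :
    1 - Real.cos (x + y) ≤ (1 + ε) * (1 - Real.cos x) + (1 + ε⁻¹) * (1 - Real.cos y) := by
  have key : ∀ z : ℝ, 1 - Real.cos z = 2 * Real.sin (z / 2) ^ 2 := fun z => by
    rw [Real.sin_sq_eq_half_sub, mul_div_cancel₀ z two_ne_zero]; ring
  rw [key, key, key, add_div]
  linarith [sin_sq_add_le (x / 2) (y / 2) hε]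

/-- This makes `rho` behave like the square of a seminorm: it holds for `x²` and for each `1 - cos
(· z)`, and survives integration over `W`. -/
theorem rho_add_le {W : Measure ℝ} (hW : IsLevyMeasure W) {b : ℝ} (hb : 0 ≤ b) (x y : ℝ)
    {ε : ℝ} (hε : 0 < ε) :
    rho b W (x + y) ≤ (1 + ε) * rho b W x + (1 + ε⁻¹) * rho b W y := by
  rw [rho_eq hW, rho_eq hW, rho_eq hW]
  have h1 : ∫ z, (1 - Real.cos ((x + y) * z)) ∂W ≤
      (1 + ε) * ∫ z, (1 - Real.cos (x * z)) ∂W + (1 + ε⁻¹) * ∫ z, (1 - Real.cos (y * z)) ∂W := by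
    rw [← integral_const_mul, ← integral_const_mul,
      ← integral_add ((integrable_one_sub_cos hW x).const_mul _)
        ((integrable_one_sub_cos hW y).const_mul _)]
    refine integral_mono (integrable_one_sub_cos hW _)
      (((integrable_one_sub_cos hW x).const_mul _).add
        ((integrable_one_sub_cos hW y).const_mul _)) fun z => ?_
    rw [add_mul]
    exact one_sub_cos_add_le _ _ hε
  have h2 : b / 2 * (x + y) ^ 2 ≤ (1 + ε) * (b / 2 * x ^ 2) + (1 + ε⁻¹) * (b / 2 * y ^ 2) := by
    have h3 : 0 ≤ b / 2 * (ε⁻¹ * (ε * x - y) ^ 2) := by positivity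
    have h4 : b / 2 * (ε⁻¹ * (ε * x - y) ^ 2) =
        b / 2 * (ε * x ^ 2 - 2 * x * y + ε⁻¹ * y ^ 2) := by
      field_simp; ring
    nlinarith
  linarith

theorem rho_neg {W : Measure ℝ} (hW : IsLevyMeasure W) (b s : ℝ) :
    rho b W (-s) = rho b W s := by
  rw [rho_eq hW, rho_eq hW]; simp

theorem norm_exp_mul_cumulant {W : Measure ℝ} (b m s : ℝ) :
    ‖Complex.exp ((m : ℂ) * cumulant b W s)‖ = Real.exp (-(m * rho b W s)) := by
  rw [Complex.norm_exp, rho, Complex.re_ofReal_mul]; ring_nf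

/-! ### Integrals of simple functions -/

section Simple

variable {T Ω : Type*}

/-- `Y` is the integral with respect to `Λ` of the simple function `g`. -/
def IsSimplePair (S : Set (Set T)) (Λ : Set T → Ω → ℝ) (Y : Ω → ℝ) (g : T → ℝ) : Prop :=
  ∃ (ι : Type) (_ : Fintype ι) (D : ι → Set T) (a : ι → ℝ), (∀ i, D i ∈ S) ∧
    (Y = fun ω => ∑ i, a i * Λ (D i) ω) ∧
    g = fun x => ∑ i, (D i).indicator (fun _ => a i) x

variable {S : Set (Set T)} {Λ : Set T → Ω → ℝ} {Y Y' : Ω → ℝ} {g g' : T → ℝ}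

theorem isSimplePair_ringSimple (φ : RingSimple S) :
    IsSimplePair S Λ (φ.integral Λ Set.univ) φ.eval :=
  ⟨Fin φ.card, inferInstance, φ.carrier, φ.coef, φ.mem,
    by funext ω; simp [RingSimple.integral], rfl⟩

/-- The sets of a representation may overlap, so adding is just concatenating families. Disjointness
is recovered by `IsSimplePair.exists_disjoint`. -/
theorem IsSimplePair.add (h : IsSimplePair S Λ Y g) (h' : IsSimplePair S Λ Y' g') :
    IsSimplePair S Λ (fun ω => Y ω + Y' ω) (fun x => g x + g' x) := by
  obtain ⟨ι, _, D, a, hD, rfl, rfl⟩ := h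
  obtain ⟨κ, _, D', a', hD', rfl, rfl⟩ := h'
  exact ⟨ι ⊕ κ, inferInstance, Sum.elim D D', Sum.elim a a', by rintro (i | i) <;> simp [hD, hD'],
    by simp, by simp⟩

theorem IsSimplePair.neg (h : IsSimplePair S Λ Y g) :
    IsSimplePair S Λ (fun ω => -Y ω) (fun x => -g x) := by
  obtain ⟨ι, _, D, a, hD, rfl, rfl⟩ := h
  refine ⟨ι, inferInstance, D, fun i => -a i, hD, by simp, ?_⟩
  funext x
  rw [← Finset.sum_neg_distrib]
  refine Finset.sum_congr rfl fun i _ => ?_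
  by_cases hx : x ∈ D i <;> simp [hx]

theorem IsSimplePair.sub (h : IsSimplePair S Λ Y g) (h' : IsSimplePair S Λ Y' g') :
    IsSimplePair S Λ (fun ω => Y ω - Y' ω) (fun x => g x - g' x) := by
  simpa only [sub_eq_add_neg] using h.add h'.neg

/-- A finite disjoint family in `S`, extended by the empty set to a sequence. -/
theorem exists_seq_extension {ι : Type*} [Fintype ι] (hS : IsSetRing S) (D : ι → Set T)
    (hD : ∀ i, D i ∈ S) (hdisj : Pairwise (Function.onFun Disjoint D)) :
    ∃ A : ℕ → Set T, (∀ n, A n ∈ S) ∧ Pairwise (Function.onFun Disjoint A) ∧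
      (∀ i, A (Fintype.equivFin ι i) = D i) ∧ (∀ n, Fintype.card ι ≤ n → A n = ∅) := by
  refine ⟨fun n => if h : n < Fintype.card ι then D ((Fintype.equivFin ι).symm ⟨n, h⟩) else ∅,
    fun n => ?_, fun n m hnm => ?_, fun i => ?_, fun n hn => ?_⟩
  · dsimp only
    split_ifs
    exacts [hD _, hS.empty_mem]
  · simp only [Function.onFun]
    split_ifs with h1 h2
    · refine hdisj fun h => hnm ?_
      simpa using h
    all_goals simp
  · simp
  · simp [hn]

/-- The atom, indexed by `J`, of the partition of `⋃ i, D i` generated by the sets `D i`. -/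
def atom {ι : Type*} (D : ι → Set T) (J : Finset ι) : Set T :=
  {x | (∃ i, x ∈ D i) ∧ ∀ i, x ∈ D i ↔ i ∈ J}

/-- Starting from the union, each index intersects with or subtracts one `D i`. The clause `∃ i, x ∈
D i` in `atom` is essential: without it the atom of `J = ∅` would be a complement, which a ring need
not contain. -/
theorem atom_mem {ι : Type*} [Fintype ι] (hS : IsSetRing S) (D : ι → Set T)
    (hD : ∀ i, D i ∈ S) (J : Finset ι) : atom D J ∈ S := by
  classical
  have hU : (⋃ i, D i) ∈ S := by
    have := hS.biUnion_mem (s := D) Finset.univ (fun i _ => hD i)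
    simpa using this
  have : ∀ F : Finset ι, {x | (∃ i, x ∈ D i) ∧ ∀ i ∈ F, (x ∈ D i ↔ i ∈ J)} ∈ S := by
    intro F
    induction F using Finset.induction_on with
    | empty =>
      convert hU using 1
      ext x; simp
    | insert i F hi ih =>
      by_cases hiJ : i ∈ J
      · have := hS.inter_mem ih (hD i)
        convert this using 1
        ext x; simp [hiJ]; tauto
      · have := hS.sdiff_mem ih (hD i)
        convert this using 1
        ext x; simp [hiJ]; tauto
  simpa [atom] using this Finset.univ

theorem atom_disjoint {ι : Type*} (D : ι → Set T) :
    Pairwise (Function.onFun Disjoint (atom D)) := by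
  intro J J' hJ
  rw [Function.onFun, Set.disjoint_left]
  intro x hx hx'
  exact hJ (Finset.ext fun i => (hx.2 i).symm.trans (hx'.2 i))

theorem iUnion_atom {ι : Type*} [Fintype ι] (D : ι → Set T) (i : ι) :
    ⋃ J : {J : Finset ι // i ∈ J}, atom D J = D i := by
  classical
  ext x
  simp only [Set.mem_iUnion, atom, Set.mem_ofPred_eq]
  constructor
  · rintro ⟨⟨J, hJ⟩, -, h⟩
    exact (h i).2 hJ
  · intro hx
    exact ⟨⟨Finset.univ.filter (fun j => x ∈ D j), by simp [hx]⟩, ⟨i, hx⟩, by simp⟩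

theorem indicator_eq_sum_atom {ι : Type*} [Fintype ι] [DecidableEq ι] (D : ι → Set T) (i : ι)
    (c : ℝ) (x : T) :
    (D i).indicator (fun _ => c) x =
      ∑ J : Finset ι, if i ∈ J then (atom D J).indicator (fun _ => c) x else 0 := by
  classical
  by_cases hx : x ∈ D i
  · rw [Set.indicator_of_mem hx,
      Finset.sum_eq_single (Finset.univ.filter (fun j => x ∈ D j))]
    · rw [if_pos (by simp [hx]), Set.indicator_of_mem]
      exact ⟨⟨i, hx⟩, by simp⟩
    · intro J _ hJ
      split_ifs
      · refine Set.indicator_of_notMem (fun h => hJ ?_) _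
        ext j; simp [h.2 j]
      · rfl
    · simp
  · rw [Set.indicator_of_notMem hx]
    refine (Finset.sum_eq_zero fun J _ => ?_).symm
    split_ifs with hJ
    · exact Set.indicator_of_notMem (fun h => hx ((h.2 i).2 hJ)) _
    · rfl

variable [MeasurableSpace T] [MeasurableSpace Ω] {P : Measure Ω} {μ : Measure T} {K : ℝ → ℂ}

/-- The partial sums `N * Λ ∅` converge almost surely, so their constant increments `Λ ∅` vanish. -/
theorem IsScatteredMeasure.empty_ae (hΛ : IsScatteredMeasure P S μ K Λ) :
    ∀ᵐ ω ∂P, Λ ∅ ω = 0 := by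
  have h0 : ∅ ∈ S := hΛ.ring.isSetRing.empty_mem
  have h := hΛ.additive (fun _ => ∅) (fun _ => h0) (fun i j _ => by simp [Function.onFun])
    (by simpa using h0)
  filter_upwards [h] with ω hω
  simp only [Finset.sum_const, Finset.card_range, nsmul_eq_mul, Set.iUnion_empty] at hω
  have h1 := (tendsto_add_atTop_iff_nat 1).2 hω
  have h2 := h1.sub hω
  simp only [Nat.cast_add, Nat.cast_one, add_mul, one_mul, add_sub_cancel_left, sub_self] at h2
  exact tendsto_nhds_unique tendsto_const_nhds h2

/-- Padding the family with empty sets makes the partial sums in σ-additivity eventually constant.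
-/
theorem IsScatteredMeasure.additive_fintype (hΛ : IsScatteredMeasure P S μ K Λ) {ι : Type*}
    [Fintype ι] (D : ι → Set T) (hD : ∀ i, D i ∈ S)
    (hdisj : Pairwise (Function.onFun Disjoint D)) (hU : (⋃ i, D i) ∈ S) :
    ∀ᵐ ω ∂P, Λ (⋃ i, D i) ω = ∑ i, Λ (D i) ω := by
  obtain ⟨A, hA, hAd, hAD, hA0⟩ := exists_seq_extension hΛ.ring.isSetRing D hD hdisj
  have hunion : ⋃ n, A n = ⋃ i, D i := by
    ext x
    simp only [Set.mem_iUnion]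
    constructor
    · rintro ⟨n, hn⟩
      by_cases h : n < Fintype.card ι
      · refine ⟨(Fintype.equivFin ι).symm ⟨n, h⟩, ?_⟩
        rw [← hAD]; simpa using hn
      · rw [hA0 n (not_lt.1 h)] at hn; exact hn.elim
    · rintro ⟨i, hi⟩
      exact ⟨_, by rw [hAD]; exact hi⟩
  filter_upwards [hΛ.additive A hA hAd (hunion ▸ hU), hΛ.empty_ae] with ω hω h0
  rw [hunion] at hω
  refine tendsto_nhds_unique hω (tendsto_const_nhds.congr' ?_)
  filter_upwards [eventually_ge_atTop (Fintype.card ι)] with N hN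
  rw [← Finset.sum_subset (Finset.range_subset_range.2 hN)
    (fun n _ hn => by rw [hA0 n (by simpa using hn), h0]), ← Fin.sum_univ_eq_sum_range
      (fun n => Λ (A n) ω)]
  rw [← (Fintype.equivFin ι).sum_comp]
  exact Finset.sum_congr rfl fun i _ => by rw [hAD]

theorem IsScatteredMeasure.iIndepFun_fintype (hΛ : IsScatteredMeasure P S μ K Λ) {ι : Type*}
    [Fintype ι] (D : ι → Set T) (hD : ∀ i, D i ∈ S)
    (hdisj : Pairwise (Function.onFun Disjoint D)) : iIndepFun (fun i => Λ (D i)) P := by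
  obtain ⟨A, hA, hAd, hAD, -⟩ := exists_seq_extension hΛ.ring.isSetRing D hD hdisj
  have := (hΛ.indep A hA hAd).precomp (g := fun i : ι => (Fintype.equivFin ι i : ℕ))
    (Fin.val_injective.comp (Fintype.equivFin ι).injective)
  simpa only [hAD] using this

/-- Every integral of a simple function has a representation over disjoint sets. -/
theorem IsSimplePair.exists_disjoint (hΛ : IsScatteredMeasure P S μ K Λ)
    (h : IsSimplePair S Λ Y g) :
    ∃ (ι : Type) (_ : Fintype ι) (D : ι → Set T) (a : ι → ℝ), (∀ i, D i ∈ S) ∧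
      Pairwise (Function.onFun Disjoint D) ∧
      (Y =ᵐ[P] fun ω => ∑ i, a i * Λ (D i) ω) ∧
      g = fun x => ∑ i, (D i).indicator (fun _ => a i) x := by
  classical
  obtain ⟨ι, _, D, a, hD, rfl, rfl⟩ := h
  have hS := hΛ.ring.isSetRing
  refine ⟨Finset ι, inferInstance, atom D, fun J => ∑ i ∈ J, a i, atom_mem hS D hD,
    atom_disjoint D, ?_, ?_⟩
  · have h1 : ∀ i, ∀ᵐ ω ∂P, Λ (D i) ω = ∑ J : {J : Finset ι // i ∈ J}, Λ (atom D J) ω := by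
      intro i
      have := hΛ.additive_fintype (fun J : {J : Finset ι // i ∈ J} => atom D J)
        (fun J => atom_mem hS D hD J)
        (fun J J' hJ => atom_disjoint D (fun h => hJ (Subtype.ext h)))
        (by rw [iUnion_atom]; exact hD i)
      rwa [iUnion_atom] at this
    filter_upwards [ae_all_iff.2 h1] with ω hω
    have h2 : ∀ i, a i * Λ (D i) ω =
        ∑ J : Finset ι, if i ∈ J then a i * Λ (atom D J) ω else 0 := by
      intro i
      rw [hω i, Finset.mul_sum, ← Finset.sum_filter]
      exact (Finset.sum_subtype (Finset.univ.filter (fun J : Finset ι => i ∈ J)) (by simp)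
        (fun J => a i * Λ (atom D J) ω)).symm
    -- Exchanging the sums over sets and atoms, the atom of `J` collects exactly the coefficients `a
    -- i` with `i ∈ J`.
    rw [Finset.sum_congr rfl fun i _ => h2 i, Finset.sum_comm]
    refine Finset.sum_congr rfl fun J _ => ?_
    rw [Finset.sum_mul]
    simp
  · funext x
    rw [Finset.sum_congr rfl fun i _ => indicator_eq_sum_atom D i (a i) x, Finset.sum_comm]
    refine Finset.sum_congr rfl fun J _ => ?_
    by_cases hx : x ∈ atom D J <;> simp [hx]

/-- By disjointness at most one summand is nonzero at each point, so `r` passes through the sum; `r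
0 = 0` handles the points outside all sets. -/
theorem lintegral_comp_disjoint_simple {ι : Type*} [Fintype ι] (D : ι → Set T)
    (a : ι → ℝ) (hD : ∀ i, MeasurableSet (D i)) (hdisj : Pairwise (Function.onFun Disjoint D))
    (r : ℝ → ℝ≥0∞) (hr : r 0 = 0) :
    ∫⁻ x, r (∑ i, (D i).indicator (fun _ => a i) x) ∂μ = ∑ i, r (a i) * μ (D i) := by
  have h : ∀ x, r (∑ i, (D i).indicator (fun _ => a i) x) =
      ∑ i, (D i).indicator (fun _ => r (a i)) x := by
    intro x
    by_cases hx : ∃ i, x ∈ D i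
    · obtain ⟨i, hi⟩ := hx
      have hne : ∀ j, j ≠ i → x ∉ D j := fun j hj hxj =>
        Set.disjoint_left.1 (hdisj hj) hxj hi
      rw [Finset.sum_eq_single i (fun j _ hj => Set.indicator_of_notMem (hne j hj) _) (by simp),
        Finset.sum_eq_single i (fun j _ hj => Set.indicator_of_notMem (hne j hj) _) (by simp),
        Set.indicator_of_mem hi, Set.indicator_of_mem hi]
    · push Not at hx
      rw [Finset.sum_eq_zero fun i _ => Set.indicator_of_notMem (hx i) _,
        Finset.sum_eq_zero fun i _ => Set.indicator_of_notMem (hx i) _, hr]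
  simp_rw [h]
  rw [lintegral_finsetSum _ fun i _ => measurable_const.indicator (hD i)]
  exact Finset.sum_congr rfl fun i _ => by rw [lintegral_indicator_const (hD i)]

theorem IsSimplePair.measurable (hΛ : IsScatteredMeasure P S μ K Λ)
    (h : IsSimplePair S Λ Y g) : Measurable Y := by
  obtain ⟨ι, _, D, a, hD, rfl, rfl⟩ := h
  exact Finset.measurable_sum _ fun i _ => (hΛ.measurable _ (hD i)).const_mul _

theorem IsSimplePair.measurable_right (hΛ : IsScatteredMeasure P S μ K Λ)
    (h : IsSimplePair S Λ Y g) : Measurable g := by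
  obtain ⟨ι, _, D, a, hD, rfl, rfl⟩ := h
  exact Finset.measurable_sum _ fun i _ => measurable_const.indicator (hΛ.measurableSet _ (hD i))

variable {b : ℝ} {W : Measure ℝ}

theorem IsSimplePair.lintegral_rho_lt_top (hW : IsLevyMeasure W)
    (hΛ : IsScatteredMeasure P S μ (cumulant b W) Λ) (h : IsSimplePair S Λ Y g) (s : ℝ) :
    ∫⁻ x, ENNReal.ofReal (rho b W (s * g x)) ∂μ < ∞ := by
  obtain ⟨ι, _, D, a, hD, hdisj, -, rfl⟩ := h.exists_disjoint hΛ
  rw [lintegral_comp_disjoint_simple D a (fun i => hΛ.measurableSet _ (hD i)) hdisj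
    (fun x => ENNReal.ofReal (rho b W (s * x))) (by simp [rho_zero hW])]
  exact ENNReal.sum_lt_top.2 fun i _ => ENNReal.mul_lt_top ENNReal.ofReal_lt_top
    (hΛ.finite _ (hD i))

/-- Over a disjoint representation the characteristic function factorises by independence, and
taking the modulus of each factor keeps only `rho`. -/
theorem IsSimplePair.norm_charFun (hW : IsLevyMeasure W) (hb : 0 ≤ b)
    (hΛ : IsScatteredMeasure P S μ (cumulant b W) Λ) (h : IsSimplePair S Λ Y g) (s : ℝ) :
    ‖∫ ω, Complex.exp (Complex.I * s * (Y ω : ℂ)) ∂P‖ =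
      Real.exp (-(∫⁻ x, ENNReal.ofReal (rho b W (s * g x)) ∂μ).toReal) := by
  obtain ⟨ι, _, D, a, hD, hdisj, hY, rfl⟩ := h.exists_disjoint hΛ
  rw [lintegral_comp_disjoint_simple D a (fun i => hΛ.measurableSet _ (hD i)) hdisj
    (fun x => ENNReal.ofReal (rho b W (s * x))) (by simp [rho_zero hW])]
  have h1 : ∫ ω, Complex.exp (Complex.I * s * (Y ω : ℂ)) ∂P =
      ∫ ω, ∏ i, Complex.exp (Complex.I * (s * a i : ℝ) * (Λ (D i) ω : ℂ)) ∂P := by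
    refine integral_congr_ae ?_
    filter_upwards [hY] with ω hω
    rw [hω, ← Complex.exp_sum]
    congr 1
    push_cast
    rw [Finset.mul_sum]
    exact Finset.sum_congr rfl fun i _ => by ring
  have hind : iIndepFun (fun i ω => Complex.exp (Complex.I * (s * a i : ℝ) * (Λ (D i) ω : ℂ))) P :=
    (hΛ.iIndepFun_fintype D hD hdisj).comp
      (fun i y => Complex.exp (Complex.I * (s * a i : ℝ) * (y : ℂ))) (fun i => by fun_prop)
  rw [h1, hind.integral_fun_prod_eq_prod_integral (fun i => by
    have := hΛ.measurable _ (hD i)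
    exact Measurable.aestronglyMeasurable (by fun_prop)), norm_prod]
  rw [ENNReal.toReal_sum (fun i _ => (ENNReal.mul_lt_top ENNReal.ofReal_lt_top
    (hΛ.finite _ (hD i))).ne), ← Finset.sum_neg_distrib, Real.exp_sum]
  refine Finset.prod_congr rfl fun i _ => ?_
  rw [hΛ.charFun_eq _ (hD i), norm_exp_mul_cumulant, ENNReal.toReal_mul,
    ENNReal.toReal_ofReal (rho_nonneg hW hb _), mul_comm]

end Simple

/-! ### Characteristic functions of limits -/

section Limit

variable {T Ω : Type*} [MeasurableSpace T] [MeasurableSpace Ω] {P : Measure Ω} {μ : Measure T}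
  {b : ℝ} {W : Measure ℝ}

theorem lintegral_rho_add_le (hW : IsLevyMeasure W) (hb : 0 ≤ b) {f g : T → ℝ}
    (hf : AEMeasurable f μ) (hg : AEMeasurable g μ) {ε : ℝ} (hε : 0 < ε) :
    ∫⁻ x, ENNReal.ofReal (rho b W (f x + g x)) ∂μ ≤
      ENNReal.ofReal (1 + ε) * ∫⁻ x, ENNReal.ofReal (rho b W (f x)) ∂μ +
      ENNReal.ofReal (1 + ε⁻¹) * ∫⁻ x, ENNReal.ofReal (rho b W (g x)) ∂μ := by
  have hr := (continuous_rho hW b).measurable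
  have hi : 0 < ε⁻¹ := inv_pos.2 hε
  have hf' : AEMeasurable (fun x => ENNReal.ofReal (rho b W (f x))) μ :=
    (hr.comp_aemeasurable hf).ennreal_ofReal
  have hg' : AEMeasurable (fun x => ENNReal.ofReal (rho b W (g x))) μ :=
    (hr.comp_aemeasurable hg).ennreal_ofReal
  rw [← lintegral_const_mul'' _ hf', ← lintegral_const_mul'' _ hg',
    ← lintegral_add_left' (hf'.const_mul _)]
  refine lintegral_mono fun x => ?_
  rw [← ENNReal.ofReal_mul (by positivity), ← ENNReal.ofReal_mul (by positivity),
    ← ENNReal.ofReal_add (mul_nonneg (by positivity) (rho_nonneg hW hb _))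
      (mul_nonneg (by positivity) (rho_nonneg hW hb _))]
  exact ENNReal.ofReal_le_ofReal (rho_add_le hW hb _ _ hε)

theorem lintegral_rho_le_liminf (hW : IsLevyMeasure W) {F : ℕ → T → ℝ} {G : T → ℝ}
    (hF : ∀ n, Measurable (F n)) (hG : ∀ᵐ x ∂μ, Tendsto (fun n => F n x) atTop (𝓝 (G x))) :
    ∫⁻ x, ENNReal.ofReal (rho b W (G x)) ∂μ ≤
      liminf (fun n => ∫⁻ x, ENNReal.ofReal (rho b W (F n x)) ∂μ) atTop := by
  have hr := continuous_rho hW b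
  refine le_trans (lintegral_mono_ae ?_)
    (lintegral_liminf_le fun n => (hr.measurable.comp (hF n)).ennreal_ofReal)
  filter_upwards [hG] with x hx
  exact (((ENNReal.continuous_ofReal.comp hr).tendsto _).comp hx).liminf_eq.ge

/-- The argument is that of completeness of `L²`. Fatou in the second index of the Cauchy condition
gives `∫ rho (F n - G) → 0`. The quasi-triangle inequality then yields finiteness of the limit and
the upper bound, while Fatou yields the lower bound. -/
theorem tendsto_lintegral_rho (hW : IsLevyMeasure W) (hb : 0 ≤ b) {F : ℕ → T → ℝ} {G : T → ℝ}
    (hF : ∀ n, Measurable (F n)) (hG : ∀ᵐ x ∂μ, Tendsto (fun n => F n x) atTop (𝓝 (G x)))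
    (hfin : ∀ n, ∫⁻ x, ENNReal.ofReal (rho b W (F n x)) ∂μ < ∞)
    (hC : Tendsto (fun p : ℕ × ℕ => ∫⁻ x, ENNReal.ofReal (rho b W (F p.1 x - F p.2 x)) ∂μ)
      (atTop ×ˢ atTop) (𝓝 0)) :
    ∫⁻ x, ENNReal.ofReal (rho b W (G x)) ∂μ < ∞ ∧
    Tendsto (fun n => ∫⁻ x, ENNReal.ofReal (rho b W (F n x)) ∂μ) atTop
      (𝓝 (∫⁻ x, ENNReal.ofReal (rho b W (G x)) ∂μ)) := by
  have hGm : AEMeasurable G μ := aemeasurable_of_tendsto_metrizable_ae' (fun n =>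
    (hF n).aemeasurable) hG
  have hD : Tendsto (fun n => ∫⁻ x, ENNReal.ofReal (rho b W (F n x - G x)) ∂μ) atTop (𝓝 0) := by
    rw [ENNReal.tendsto_nhds_zero]
    intro η hη
    rw [ENNReal.tendsto_nhds_zero] at hC
    have hC' := hC η hη
    rw [prod_atTop_atTop_eq] at hC'
    obtain ⟨n₀, hn₀⟩ := eventually_atTop_prod_self.1 hC'
    filter_upwards [eventually_ge_atTop n₀] with n hn
    refine (lintegral_rho_le_liminf hW (F := fun m x => F n x - F m x)
      (fun m => (hF n).sub (hF m)) ?_).trans ?_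
    · filter_upwards [hG] with x hx
      exact tendsto_const_nhds.sub hx
    · refine liminf_le_of_frequently_le' (Eventually.frequently ?_)
      filter_upwards [eventually_ge_atTop n₀] with m hm
      exact hn₀ n m hn hm
  have hGfin : ∫⁻ x, ENNReal.ofReal (rho b W (G x)) ∂μ < ∞ := by
    obtain ⟨n, hn⟩ := (hD.eventually (gt_mem_nhds one_pos)).exists
    have := lintegral_rho_add_le hW hb (hF n).aemeasurable (hGm.sub (hF n).aemeasurable)
      (μ := μ) one_pos
    simp only [add_sub_cancel, Pi.sub_apply] at this
    refine this.trans_lt (ENNReal.add_lt_top.2 ⟨ENNReal.mul_lt_top ENNReal.ofReal_lt_top (hfin n),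
      ENNReal.mul_lt_top ENNReal.ofReal_lt_top ?_⟩)
    refine lt_of_eq_of_lt ?_ (hn.trans ENNReal.one_lt_top)
    refine lintegral_congr fun x => ?_
    rw [← rho_neg hW, neg_sub]
  refine ⟨hGfin, tendsto_of_le_liminf_of_limsup_le (lintegral_rho_le_liminf hW hF hG) ?_⟩
  have hε : ∀ ε : ℝ, 0 < ε → limsup (fun n => ∫⁻ x, ENNReal.ofReal (rho b W (F n x)) ∂μ) atTop ≤
      ENNReal.ofReal (1 + ε) * ∫⁻ x, ENNReal.ofReal (rho b W (G x)) ∂μ := by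
    intro ε hε
    have h1 : ∀ n, ∫⁻ x, ENNReal.ofReal (rho b W (F n x)) ∂μ ≤
        ENNReal.ofReal (1 + ε) * ∫⁻ x, ENNReal.ofReal (rho b W (G x)) ∂μ +
        ENNReal.ofReal (1 + ε⁻¹) * ∫⁻ x, ENNReal.ofReal (rho b W (F n x - G x)) ∂μ := by
      intro n
      have := lintegral_rho_add_le hW hb hGm ((hF n).aemeasurable.sub hGm) (μ := μ) hε
      simpa only [add_sub_cancel, Pi.sub_apply] using this
    have h2 := (ENNReal.Tendsto.const_mul hD (Or.inr (ENNReal.ofReal_ne_top (r := 1 + ε⁻¹)))).const_add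
      (ENNReal.ofReal (1 + ε) * ∫⁻ x, ENNReal.ofReal (rho b W (G x)) ∂μ)
    rw [mul_zero, add_zero] at h2
    rw [← h2.limsup_eq]
    exact limsup_le_limsup (Eventually.of_forall h1)
  -- Letting `ε → 0` removes the factor `1 + ε`, which is legitimate because the integral is finite.
  have h3 : Tendsto (fun ε : ℝ => ENNReal.ofReal (1 + ε) *
      ∫⁻ x, ENNReal.ofReal (rho b W (G x)) ∂μ) (𝓝[>] 0)
      (𝓝 (ENNReal.ofReal (1 + 0) * ∫⁻ x, ENNReal.ofReal (rho b W (G x)) ∂μ)) := by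
    refine ENNReal.Tendsto.mul_const ?_ (Or.inr hGfin.ne)
    refine Tendsto.mono_left ?_ nhdsWithin_le_nhds
    exact (ENNReal.continuous_ofReal.comp (continuous_const.add continuous_id)).tendsto 0
  simp only [add_zero, ENNReal.ofReal_one, one_mul] at h3
  exact ge_of_tendsto h3 (eventually_mem_nhdsWithin.mono fun ε h => hε ε h)

theorem norm_exp_I_mul (s y : ℝ) : ‖Complex.exp (Complex.I * s * (y : ℂ))‖ = 1 := by
  rw [← Complex.norm_exp_ofReal_mul_I (s * y)]; congr 2; push_cast; ring

theorem tendsto_integral_exp [IsProbabilityMeasure P] {ι : Type*} {L : Filter ι}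
    [L.IsCountablyGenerated] {Y : ι → Ω → ℝ} {Z : Ω → ℝ} (hY : ∀ i, Measurable (Y i))
    (hZ : ∀ᵐ ω ∂P, Tendsto (fun i => Y i ω) L (𝓝 (Z ω))) (s : ℝ) :
    Tendsto (fun i => ∫ ω, Complex.exp (Complex.I * s * (Y i ω : ℂ)) ∂P) L
      (𝓝 (∫ ω, Complex.exp (Complex.I * s * (Z ω : ℂ)) ∂P)) := by
  refine tendsto_integral_filter_of_dominated_convergence (fun _ => 1)
    (Eventually.of_forall fun i => ?_)
    (Eventually.of_forall fun i => ae_of_all _ fun ω => (norm_exp_I_mul s _).le)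
    (integrable_const _) ?_
  · have := hY i
    exact Measurable.aestronglyMeasurable (by fun_prop)
  · filter_upwards [hZ] with ω hω
    exact ((by fun_prop : Continuous fun y : ℝ =>
      Complex.exp (Complex.I * s * (y : ℂ))).tendsto _).comp hω

/-- The modulus of the characteristic function of a limit of integrals of simple functions. -/
theorem norm_charFun_limit [IsProbabilityMeasure P] {S : Set (Set T)} {Λ : Set T → Ω → ℝ}
    (hW : IsLevyMeasure W) (hb : 0 ≤ b)
    (hΛ : IsScatteredMeasure P S μ (cumulant b W) Λ) {Y : ℕ → Ω → ℝ} {g : ℕ → T → ℝ}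
    (h : ∀ n, IsSimplePair S Λ (Y n) (g n)) {Z : Ω → ℝ} {G : T → ℝ}
    (hZ : ∀ᵐ ω ∂P, Tendsto (fun n => Y n ω) atTop (𝓝 (Z ω)))
    (hG : ∀ᵐ x ∂μ, Tendsto (fun n => g n x) atTop (𝓝 (G x))) (s : ℝ) :
    ∫⁻ x, ENNReal.ofReal (rho b W (s * G x)) ∂μ < ∞ ∧
    ‖∫ ω, Complex.exp (Complex.I * s * (Z ω : ℂ)) ∂P‖ =
      Real.exp (-(∫⁻ x, ENNReal.ofReal (rho b W (s * G x)) ∂μ).toReal) := by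
  have hYm := fun n => (h n).measurable hΛ
  have hC : Tendsto (fun p : ℕ × ℕ =>
      ∫⁻ x, ENNReal.ofReal (rho b W (s * g p.1 x - s * g p.2 x)) ∂μ) (atTop ×ˢ atTop) (𝓝 0) := by
    -- Differences of the integrals tend to `0`, so the moduli of their characteristic functions
    -- tend to `1`. Taking logarithms shows that the approximants are Cauchy for `∫ rho (s ·)`.
    have h1 := tendsto_integral_exp (P := P) (L := atTop ×ˢ atTop)
      (Y := fun p : ℕ × ℕ => fun ω => Y p.1 ω - Y p.2 ω) (Z := fun _ => 0)
      (fun p => (hYm p.1).sub (hYm p.2)) (by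
        filter_upwards [hZ] with ω hω
        have := (hω.comp tendsto_fst).sub (hω.comp (tendsto_snd (f := (atTop : Filter ℕ))))
        simpa using this) s
    have h2 := h1.norm
    simp only [Complex.ofReal_zero, mul_zero, Complex.exp_zero, integral_const, probReal_univ,
      one_smul, norm_one] at h2
    have h3 := fun p : ℕ × ℕ => ((h p.1).sub (h p.2)).norm_charFun hW hb hΛ s
    simp only [Complex.ofReal_sub] at h3 h2
    simp only [h3] at h2
    have h4 := ((Real.continuousAt_log one_ne_zero).tendsto.comp h2).neg
    simp only [Function.comp_def, Real.log_exp, neg_neg, Real.log_one, neg_zero] at h4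
    have h5 := ENNReal.tendsto_ofReal h4
    rw [ENNReal.ofReal_zero] at h5
    refine h5.congr fun p => ?_
    rw [ENNReal.ofReal_toReal (((h p.1).sub (h p.2)).lintegral_rho_lt_top hW hΛ s).ne]
    simp only [mul_sub]
  obtain ⟨hfin, hlim⟩ := tendsto_lintegral_rho hW hb (μ := μ) (F := fun n x => s * g n x)
    (G := fun x => s * G x) (fun n => ((h n).measurable_right hΛ).const_mul s)
    (by filter_upwards [hG] with x hx using hx.const_mul s)
    (fun n => (h n).lintegral_rho_lt_top hW hΛ s) hC
  refine ⟨hfin, ?_⟩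
  have h1 := (tendsto_integral_exp hYm hZ s).norm
  simp only [fun n => (h n).norm_charFun hW hb hΛ s] at h1
  refine tendsto_nhds_unique h1 ?_
  exact (Real.continuous_exp.tendsto _).comp
    ((ENNReal.tendsto_toReal hfin.ne).comp hlim).neg

/-! ### Second moments -/

theorem tendsto_one_sub_cos_div (y : ℝ) {s : ℕ → ℝ} (hs : Tendsto s atTop (𝓝 0))
    (hs0 : ∀ n, s n ≠ 0) :
    Tendsto (fun n => (1 - Real.cos (s n * y)) / s n ^ 2) atTop (𝓝 (y ^ 2 / 2)) := by
  have h1 : ∀ n, (1 - Real.cos (s n * y)) / s n ^ 2 =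
      y ^ 2 / 2 * Real.sinc (s n * y / 2) ^ 2 := by
    intro n
    have h2 : 1 - Real.cos (s n * y) = 2 * Real.sin (s n * y / 2) ^ 2 := by
      rw [Real.sin_sq_eq_half_sub, mul_div_cancel₀ _ two_ne_zero]; ring
    rw [h2]
    by_cases hy : y = 0
    · simp [hy]
    · have := hs0 n
      rw [Real.sinc_of_ne_zero (by positivity)]
      field_simp
  simp_rw [h1]
  have h3 : Tendsto (fun n => Real.sinc (s n * y / 2)) atTop (𝓝 (Real.sinc (0 * y / 2))) :=
    (Real.continuous_sinc.tendsto _).comp ((hs.mul_const y).div_const 2)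
  simp only [zero_mul, zero_div, Real.sinc_zero] at h3
  simpa using (h3.pow 2).const_mul (y ^ 2 / 2)

theorem tendsto_sin_div (y : ℝ) {s : ℕ → ℝ} (hs : Tendsto s atTop (𝓝 0))
    (hs0 : ∀ n, s n ≠ 0) :
    Tendsto (fun n => Real.sin (s n * y) / s n) atTop (𝓝 y) := by
  have h1 : ∀ n, Real.sin (s n * y) / s n = y * Real.sinc (s n * y) := by
    intro n
    by_cases hy : y = 0
    · simp [hy]
    · have := hs0 n
      rw [Real.sinc_of_ne_zero (by positivity)]
      field_simp
  simp_rw [h1]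
  have h3 : Tendsto (fun n => Real.sinc (s n * y)) atTop (𝓝 (Real.sinc (0 * y))) :=
    (Real.continuous_sinc.tendsto _).comp (hs.mul_const y)
  simp only [zero_mul, Real.sinc_zero] at h3
  simpa using h3.const_mul y

/-- A centred square integrable variable whose characteristic function has modulus `exp (-M)`
satisfies `2 M(s) / s² → E Z²` as `s → 0`. -/
theorem tendsto_of_norm_charFun [IsProbabilityMeasure P] {Z : Ω → ℝ} (hZ : MemLp Z 2 P)
    (hZ0 : ∫ ω, Z ω ∂P = 0) {M : ℝ → ℝ}
    (hM : ∀ s : ℝ, ‖∫ ω, Complex.exp (Complex.I * s * (Z ω : ℂ)) ∂P‖ = Real.exp (-M s))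
    {s : ℕ → ℝ} (hs : Tendsto s atTop (𝓝 0)) (hs0 : ∀ n, s n ≠ 0) :
    Tendsto (fun n => 2 * M (s n) / s n ^ 2) atTop (𝓝 (∫ ω, Z ω ^ 2 ∂P)) := by
  have hZm := hZ.aestronglyMeasurable.aemeasurable
  have hZi : Integrable Z P := hZ.integrable (by norm_num)
  have hZ2 : Integrable (fun ω => Z ω ^ 2) P := hZ.integrable_sq
  have hcm : ∀ t : ℝ, AEStronglyMeasurable (fun ω => Real.cos (t * Z ω)) P := fun t =>
    (Real.measurable_cos.comp_aemeasurable (hZm.const_mul t)).aestronglyMeasurable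
  have hsm : ∀ t : ℝ, AEStronglyMeasurable (fun ω => Real.sin (t * Z ω)) P := fun t =>
    (Real.measurable_sin.comp_aemeasurable (hZm.const_mul t)).aestronglyMeasurable
  have hci : ∀ t : ℝ, Integrable (fun ω => Real.cos (t * Z ω)) P := fun t =>
    (integrable_const (1 : ℝ)).mono' (hcm t) (ae_of_all _ fun ω => Real.abs_cos_le_one _)
  have hsi : ∀ t : ℝ, Integrable (fun ω => Real.sin (t * Z ω)) P := fun t =>
    (integrable_const (1 : ℝ)).mono' (hsm t) (ae_of_all _ fun ω => Real.abs_sin_le_one _)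
  set c : ℝ → ℝ := fun t => ∫ ω, Real.cos (t * Z ω) ∂P with hc
  set q : ℝ → ℝ := fun t => ∫ ω, Real.sin (t * Z ω) ∂P with hq
  have hcq : ∀ t, Real.exp (-(2 * M t)) = c t ^ 2 + q t ^ 2 := by
    intro t
    have h1 : ∫ ω, Complex.exp (Complex.I * t * (Z ω : ℂ)) ∂P = (c t : ℂ) + (q t : ℂ) * Complex.I := by
      rw [hc, hq]
      dsimp only
      rw [← integral_complex_ofReal, ← integral_complex_ofReal, ← integral_mul_const,
        ← integral_add (hci t).ofReal ((hsi t).ofReal.mul_const _)]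
      refine integral_congr_ae (ae_of_all _ fun ω => ?_)
      dsimp only
      rw [show Complex.I * t * (Z ω : ℂ) = ((t * Z ω : ℝ) : ℂ) * Complex.I by push_cast; ring,
        Complex.exp_mul_I, Complex.ofReal_cos, Complex.ofReal_sin]
    have h2 := hM t
    rw [h1] at h2
    have h3 : Real.exp (-(2 * M t)) = Real.exp (-M t) ^ 2 := by
      rw [← Real.exp_nat_mul]; congr 1; push_cast; ring
    rw [h3, ← h2, Complex.sq_norm, Complex.normSq_add_mul_I]
  -- The real part contributes half the second moment, by dominated convergence with bound `Z² / 2`.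
  have hlc : Tendsto (fun n => (1 - c (s n)) / s n ^ 2) atTop (𝓝 ((∫ ω, Z ω ^ 2 ∂P) / 2)) := by
    have h1 : ∀ n, (1 - c (s n)) / s n ^ 2 = ∫ ω, (1 - Real.cos (s n * Z ω)) / s n ^ 2 ∂P := by
      intro n
      rw [integral_div, integral_sub (integrable_const _) (hci _)]
      simp [hc]
    simp_rw [h1]
    rw [← integral_div]
    refine tendsto_integral_of_dominated_convergence (fun ω => Z ω ^ 2 / 2)
      (fun n => (((integrable_const _).sub (hci _)).div_const _).aestronglyMeasurable) (hZ2.div_const 2)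
      (fun n => ae_of_all _ fun ω => ?_) (ae_of_all _ fun ω => tendsto_one_sub_cos_div _ hs hs0)
    rw [Real.norm_of_nonneg (div_nonneg (one_sub_cos_nonneg _) (sq_nonneg _)),
      div_le_iff₀ (by have := hs0 n; positivity)]
    refine (one_sub_cos_le _).trans (le_of_eq (by ring))
  -- The imaginary part is of first order with coefficient `E Z`; centring makes this coefficient
  -- zero.
  have hlq : Tendsto (fun n => q (s n) / s n) atTop (𝓝 0) := by
    have h1 : ∀ n, q (s n) / s n = ∫ ω, Real.sin (s n * Z ω) / s n ∂P := by
      intro n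
      rw [integral_div]
    simp_rw [h1]
    rw [← hZ0]
    refine tendsto_integral_of_dominated_convergence (fun ω => |Z ω|)
      (fun n => ((hsi _).div_const _).aestronglyMeasurable) hZi.abs
      (fun n => ae_of_all _ fun ω => ?_) (ae_of_all _ fun ω => tendsto_sin_div _ hs hs0)
    rw [norm_div, div_le_iff₀ (norm_pos_iff.2 (hs0 n)), mul_comm, Real.norm_eq_abs,
      Real.norm_eq_abs, ← abs_mul]
    exact Real.abs_sin_le_abs
  have hs2 : Tendsto (fun n => s n ^ 2) atTop (𝓝 0) := by simpa using hs.pow 2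
  set z : ℕ → ℝ := fun n => 1 - Real.exp (-(2 * M (s n))) with hz
  have hlz : Tendsto (fun n => z n / s n ^ 2) atTop (𝓝 (∫ ω, Z ω ^ 2 ∂P)) := by
    -- This is `1 - c² - q² = (1 - c) (2 - (1 - c)) - q²`, divided by `s²`.
    have h1 : ∀ n, z n / s n ^ 2 = (1 - c (s n)) / s n ^ 2 *
        (2 - (1 - c (s n)) / s n ^ 2 * s n ^ 2) - (q (s n) / s n) ^ 2 := by
      intro n
      have := hs0 n
      rw [hz]
      dsimp only
      rw [hcq]
      field_simp
      ring
    simp_rw [h1]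
    have h2 := (hlc.mul ((hlc.mul hs2).const_sub 2)).sub (hlq.pow 2)
    convert h2 using 2
    ring
  have hz0 : Tendsto z atTop (𝓝 0) := by
    have h1 := hlz.mul hs2
    rw [mul_zero] at h1
    refine h1.congr fun n => ?_
    have := hs0 n
    field_simp
  -- With `z = 1 - exp (-2M)` one has `z ≤ 2M ≤ z / (1 - z)`, and both bounds have the same limit
  -- after division by `s²`.
  have hup : Tendsto (fun n => z n / s n ^ 2 / (1 - z n)) atTop (𝓝 (∫ ω, Z ω ^ 2 ∂P)) := by
    have := hlz.div (hz0.const_sub 1) (by norm_num)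
    rw [sub_zero, div_one] at this
    exact this
  refine tendsto_of_tendsto_of_tendsto_of_le_of_le hlz hup (fun n => ?_) (fun n => ?_)
  · have hsn : 0 < s n ^ 2 := by have := hs0 n; positivity
    have := Real.add_one_le_exp (-(2 * M (s n)))
    simp only [hz]
    gcongr
    linarith
  · have hsn : 0 < s n ^ 2 := by have := hs0 n; positivity
    simp only [hz, sub_sub_cancel]
    rw [div_right_comm]
    gcongr
    rw [le_div_iff₀ (Real.exp_pos _)]
    have h1 := Real.add_one_le_exp (2 * M (s n))
    have h2 : Real.exp (2 * M (s n)) * Real.exp (-(2 * M (s n))) = 1 := by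
      rw [← Real.exp_add]; simp
    nlinarith [Real.exp_pos (-(2 * M (s n)))]

/-- The variance `b + ∫ x² W(dx)` of the infinitely divisible law. -/
def levyVar (b : ℝ) (W : Measure ℝ) : ℝ≥0∞ :=
  ENNReal.ofReal b + ∫⁻ x, ENNReal.ofReal (x ^ 2) ∂W

theorem ofReal_rho_mul (hW : IsLevyMeasure W) (hb : 0 ≤ b) {s : ℝ} (hs : s ≠ 0) (x : ℝ) :
    ENNReal.ofReal (2 / s ^ 2 * rho b W (s * x)) = ENNReal.ofReal (b * x ^ 2) +
      ∫⁻ y, ENNReal.ofReal (2 * ((1 - Real.cos (s * (x * y))) / s ^ 2)) ∂W := by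
  rw [ENNReal.ofReal_mul (by positivity), ofReal_rho hW hb, mul_add,
    ← ENNReal.ofReal_mul (by positivity), ← lintegral_const_mul _ (by fun_prop)]
  congr 1
  · congr 1; field_simp
  · refine lintegral_congr fun y => ?_
    rw [← ENNReal.ofReal_mul (by positivity)]
    congr 1
    rw [mul_assoc]; ring

theorem ofReal_rho_mul_le (hW : IsLevyMeasure W) (hb : 0 ≤ b) {s : ℝ} (hs : s ≠ 0) (x : ℝ) :
    ENNReal.ofReal (2 / s ^ 2 * rho b W (s * x)) ≤ levyVar b W * ENNReal.ofReal (x ^ 2) := by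
  rw [ofReal_rho_mul hW hb hs, levyVar, add_mul, ENNReal.ofReal_mul hb,
    ← lintegral_mul_const _ (by fun_prop)]
  gcongr with y
  rw [← ENNReal.ofReal_mul (sq_nonneg _)]
  refine ENNReal.ofReal_le_ofReal ?_
  have h1 := one_sub_cos_le (s * (x * y))
  rw [mul_div_assoc', div_le_iff₀ (by positivity)]
  nlinarith

/-- Fatou over `W`. With `ofReal_rho_mul_le` this identifies the limit in `[0, ∞]` without assuming
that `W` has a second moment, whose finiteness is a conclusion. -/
theorem levyVar_mul_le_liminf (hW : IsLevyMeasure W) (hb : 0 ≤ b) {s : ℕ → ℝ}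
    (hs : Tendsto s atTop (𝓝 0)) (hs0 : ∀ n, s n ≠ 0) (x : ℝ) :
    levyVar b W * ENNReal.ofReal (x ^ 2) ≤
      liminf (fun n => ENNReal.ofReal (2 / s n ^ 2 * rho b W (s n * x))) atTop := by
  have h1 : ∫⁻ y, ENNReal.ofReal (y ^ 2 * x ^ 2) ∂W ≤ liminf (fun n =>
      ∫⁻ y, ENNReal.ofReal (2 * ((1 - Real.cos (s n * (x * y))) / s n ^ 2)) ∂W) atTop := by
    refine le_trans (lintegral_mono fun y => ?_) (lintegral_liminf_le fun n => by fun_prop)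
    have := ENNReal.tendsto_ofReal ((tendsto_one_sub_cos_div (x * y) hs hs0).const_mul 2)
    rw [this.liminf_eq]
    exact ENNReal.ofReal_le_ofReal (le_of_eq (by ring))
  have h2 : levyVar b W * ENNReal.ofReal (x ^ 2) =
      ENNReal.ofReal (b * x ^ 2) + ∫⁻ y, ENNReal.ofReal (y ^ 2 * x ^ 2) ∂W := by
    rw [levyVar, add_mul, ENNReal.ofReal_mul hb, ← lintegral_mul_const _ (by fun_prop)]
    simp_rw [ENNReal.ofReal_mul (sq_nonneg _)]
  rw [h2]
  simp_rw [ofReal_rho_mul hW hb (hs0 _)]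
  rw [liminf_const_add atTop _ _ (by isBoundedDefault) (by isBoundedDefault)]
  gcongr

/-- The isometry of the stochastic integral. -/
theorem ofReal_second_moment [IsProbabilityMeasure P] (hW : IsLevyMeasure W) (hb : 0 ≤ b)
    {Z : Ω → ℝ} (hZ : MemLp Z 2 P) (hZ0 : ∫ ω, Z ω ∂P = 0) {G : T → ℝ} (hG : Measurable G)
    (h : ∀ s : ℝ, ∫⁻ x, ENNReal.ofReal (rho b W (s * G x)) ∂μ < ∞ ∧
      ‖∫ ω, Complex.exp (Complex.I * s * (Z ω : ℂ)) ∂P‖ =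
      Real.exp (-(∫⁻ x, ENNReal.ofReal (rho b W (s * G x)) ∂μ).toReal)) :
    ENNReal.ofReal (∫ ω, Z ω ^ 2 ∂P) = levyVar b W * ∫⁻ x, ENNReal.ofReal (G x ^ 2) ∂μ := by
  set s : ℕ → ℝ := fun n => 1 / ((n : ℝ) + 1) with hsdef
  have hs : Tendsto s atTop (𝓝 0) := tendsto_one_div_add_atTop_nhds_zero_nat
  have hs0 : ∀ n, s n ≠ 0 := fun n => by simp only [hsdef]; positivity
  have h1 := ENNReal.tendsto_ofReal (tendsto_of_norm_charFun hZ hZ0 (fun s => (h s).2) hs hs0)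
  have hr := (continuous_rho hW b).measurable
  have h2 : ∀ n, ENNReal.ofReal (2 * (∫⁻ x, ENNReal.ofReal (rho b W (s n * G x)) ∂μ).toReal /
      s n ^ 2) = ∫⁻ x, ENNReal.ofReal (2 / s n ^ 2 * rho b W (s n * G x)) ∂μ := by
    intro n
    rw [mul_div_right_comm, ENNReal.ofReal_mul (by positivity),
      ENNReal.ofReal_toReal (h (s n)).1.ne, ← lintegral_const_mul _ (by fun_prop)]
    refine lintegral_congr fun x => ?_
    rw [← ENNReal.ofReal_mul (by positivity)]
  simp only [h2] at h1
  refine le_antisymm ?_ ?_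
  · refine le_of_tendsto' h1 fun n => ?_
    rw [← lintegral_const_mul _ (by fun_prop)]
    exact lintegral_mono fun x => ofReal_rho_mul_le hW hb (hs0 n) _
  · rw [← h1.liminf_eq, ← lintegral_const_mul _ (by fun_prop)]
    exact (lintegral_mono fun x => levyVar_mul_le_liminf hW hb hs hs0 (G x)).trans
      (lintegral_liminf_le fun n => by fun_prop)

end Limit

/-! ### Covariances of supCAR fields -/

section Field

variable {Ω : Type*} [MeasurableSpace Ω] {P : Measure Ω} {d : ℕ}
  {b : ℝ} {W : Measure ℝ} {π : Measure (Set.Ioi (0 : ℝ))} {S : Set (Set (Param d))}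
  {Λ : Set (Param d) → Ω → ℝ} {X : EuclideanSpace ℝ (Fin d) → Ω → ℝ}

theorem WellDefinedConditions.nonneg (h : WellDefinedConditions d b W π) : 0 ≤ b := by
  rcases h with h | h
  exacts [h.1.le, h.1.ge]

theorem measurable_kernel (t : EuclideanSpace ℝ (Fin d)) : Measurable (kernel t) := by
  unfold kernel
  fun_prop

theorem IsSupCARField.second_moment_add [IsProbabilityMeasure P] (hW : IsLevyMeasure W)
    (hb : 0 ≤ b) (hX : IsSupCARField P S Λ b W π X) (hmom : ∀ t, MemLp (X t) 2 P)
    (hmean : ∀ t, ∫ ω, X t ω ∂P = 0) (s t : EuclideanSpace ℝ (Fin d)) :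
    ENNReal.ofReal (∫ ω, (X s ω + X t ω) ^ 2 ∂P) =
      levyVar b W * ∫⁻ p, ENNReal.ofReal ((kernel s p + kernel t p) ^ 2) ∂(π.prod volume) := by
  obtain ⟨φ, hφ, -, hφX⟩ := hX.integral s
  obtain ⟨ψ, hψ, -, hψX⟩ := hX.integral t
  -- A subsequence of a subsequence makes both approximations converge almost surely, so their sum
  -- is a limit of simple pairs along one common sequence.
  obtain ⟨ns, hns, hns'⟩ := hφX.exists_seq_tendsto_ae
  obtain ⟨ms, hms, hms'⟩ := (show TendstoInMeasure P
    (fun n => (ψ (ns n)).integral Λ Set.univ) atTop (X t) from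
      fun ε hε => (hψX ε hε).comp hns.tendsto_atTop).exists_seq_tendsto_ae
  refine ofReal_second_moment hW hb ((hmom s).add (hmom t)) ?_
    ((measurable_kernel s).add (measurable_kernel t)) fun u =>
    norm_charFun_limit hW hb hX.scattered (fun n =>
      (isSimplePair_ringSimple (φ (ns (ms n)))).add (isSimplePair_ringSimple (ψ (ns (ms n)))))
      ?_ ?_ u
  · simp only [Pi.add_apply]
    rw [integral_add ((hmom s).integrable (by norm_num)) ((hmom t).integrable (by norm_num)),
      hmean, hmean, add_zero]
  · filter_upwards [hns', hms'] with ω h1 h2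
    exact (h1.comp hms.tendsto_atTop).add h2
  · filter_upwards [hφ, hψ] with x h1 h2
    exact (h1.comp (hns.comp hms).tendsto_atTop).add (h2.comp (hns.comp hms).tendsto_atTop)

theorem IsSupCARField.second_moment [IsProbabilityMeasure P] (hW : IsLevyMeasure W)
    (hb : 0 ≤ b) (hX : IsSupCARField P S Λ b W π X) (hmom : ∀ t, MemLp (X t) 2 P)
    (hmean : ∀ t, ∫ ω, X t ω ∂P = 0) (t : EuclideanSpace ℝ (Fin d)) :
    ENNReal.ofReal (∫ ω, X t ω ^ 2 ∂P) =
      levyVar b W * ∫⁻ p, ENNReal.ofReal (kernel t p ^ 2) ∂(π.prod volume) := by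
  obtain ⟨φ, hφ, -, hφX⟩ := hX.integral t
  obtain ⟨ns, hns, hns'⟩ := hφX.exists_seq_tendsto_ae
  refine ofReal_second_moment hW hb (hmom t) (hmean t) (measurable_kernel t) fun u =>
    norm_charFun_limit hW hb hX.scattered (fun n => isSimplePair_ringSimple (φ (ns n))) hns' ?_ u
  filter_upwards [hφ] with x h1
  exact h1.comp hns.tendsto_atTop

theorem kernel_neg (t : EuclideanSpace ℝ (Fin d)) (p : Param d) : kernel t p < 0 := by
  have : 0 < (p.1 : ℝ) := p.1.2
  unfold kernel
  rw [neg_mul]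
  exact neg_neg_of_pos (by positivity)

/-- The finite second moment of `X 0` is `levyVar` times an integral that is nonzero because the
kernel never vanishes. -/
theorem IsSupCARField.levyVar_lt_top [IsProbabilityMeasure P] [IsProbabilityMeasure π]
    (hW : IsLevyMeasure W)
    (hb : 0 ≤ b) (hX : IsSupCARField P S Λ b W π X) (hmom : ∀ t, MemLp (X t) 2 P)
    (hmean : ∀ t, ∫ ω, X t ω ∂P = 0) : levyVar b W < ∞ := by
  have h := hX.second_moment hW hb hmom hmean 0
  have h0 : ∫⁻ p, ENNReal.ofReal (kernel (0 : EuclideanSpace ℝ (Fin d)) p ^ 2) ∂(π.prod volume) ≠ 0 := by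
    have hm := measurable_kernel (0 : EuclideanSpace ℝ (Fin d))
    rw [Ne, lintegral_eq_zero_iff (by fun_prop)]
    intro h1
    have h2 : ∀ᵐ p ∂(π.prod (volume : Measure (EuclideanSpace ℝ (Fin d)))), False := by
      filter_upwards [h1] with p hp
      have h3 := (kernel_neg 0 p).ne
      simp only [Pi.zero_apply, ENNReal.ofReal_eq_zero] at hp
      have : 0 < kernel 0 p ^ 2 := by positivity
      linarith
    rw [eventually_false_iff_eq_bot, ae_eq_bot] at h2
    have h4 : (π.prod (volume : Measure (EuclideanSpace ℝ (Fin d)))) (Set.univ ×ˢ Set.univ) = 0 := by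
      rw [h2]; simp
    rw [Measure.prod_prod, measure_univ, one_mul] at h4
    exact isOpen_univ.measure_ne_zero _ Set.univ_nonempty h4
  by_contra hc
  rw [not_lt, top_le_iff] at hc
  rw [hc, ENNReal.top_mul h0] at h
  exact ENNReal.ofReal_ne_top h

/-- Polarisation of the isometry. The kernels have the same sign, so the cross term also makes sense
as a Lebesgue integral. -/
theorem IsSupCARField.covariance_eq [IsProbabilityMeasure P] (hW : IsLevyMeasure W)
    (hb : 0 ≤ b) (hX : IsSupCARField P S Λ b W π X) (hmom : ∀ t, MemLp (X t) 2 P)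
    (hmean : ∀ t, ∫ ω, X t ω ∂P = 0) (s t : EuclideanSpace ℝ (Fin d)) :
    covariance (X s) (X t) P = (levyVar b W *
      ∫⁻ p, ENNReal.ofReal (kernel s p * kernel t p) ∂(π.prod volume)).toReal := by
  have hst := hX.second_moment_add hW hb hmom hmean s t
  have hs := hX.second_moment hW hb hmom hmean s
  have ht := hX.second_moment hW hb hmom hmean t
  have hks := measurable_kernel s
  have hkt := measurable_kernel t
  have hpos : ∀ p : Param d, 0 ≤ kernel s p * kernel t p := fun p =>
    (mul_pos_of_neg_of_neg (kernel_neg s p) (kernel_neg t p)).le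
  have h1 : ∫⁻ p, ENNReal.ofReal ((kernel s p + kernel t p) ^ 2) ∂(π.prod volume) =
      ∫⁻ p, ENNReal.ofReal (kernel s p ^ 2) ∂(π.prod volume) +
      ∫⁻ p, ENNReal.ofReal (kernel t p ^ 2) ∂(π.prod volume) +
      2 * ∫⁻ p, ENNReal.ofReal (kernel s p * kernel t p) ∂(π.prod volume) := by
    rw [← lintegral_const_mul _ (by fun_prop), ← lintegral_add_left (by fun_prop),
      ← lintegral_add_left (by fun_prop)]
    refine lintegral_congr fun p => ?_
    rw [← ENNReal.ofReal_ofNat, ← ENNReal.ofReal_mul (by norm_num),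
      ← ENNReal.ofReal_add (by positivity) (by positivity),
      ← ENNReal.ofReal_add (by positivity) (mul_nonneg (by norm_num) (hpos p))]
    congr 1; ring
  rw [h1, mul_add, mul_add, ← hs, ← ht] at hst
  have hst' := congrArg ENNReal.toReal hst
  -- The cross term is finite because the left side of `hst` is an `ENNReal.ofReal`.
  have hfin : levyVar b W * (2 * ∫⁻ p, ENNReal.ofReal (kernel s p * kernel t p) ∂(π.prod volume))
      ≠ ∞ := fun h => by
    rw [h] at hst
    simp at hst
  rw [ENNReal.toReal_add (by simp) hfin, ENNReal.toReal_add (by simp) (by simp),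
    ENNReal.toReal_ofReal (by positivity), ENNReal.toReal_ofReal (by positivity),
    ENNReal.toReal_ofReal (by positivity), mul_left_comm, ENNReal.toReal_mul] at hst'
  have h2 : ∫ ω, (X s ω + X t ω) ^ 2 ∂P = ∫ ω, X s ω ^ 2 ∂P + ∫ ω, X t ω ^ 2 ∂P +
      2 * ∫ ω, X s ω * X t ω ∂P := by
    have hm : Integrable (fun ω => X s ω * X t ω) P := (hmom s).integrable_mul (hmom t)
    rw [← integral_const_mul, ← integral_add (hmom s).integrable_sq (hmom t).integrable_sq,
      ← integral_add (f := fun ω => X s ω ^ 2 + X t ω ^ 2)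
        ((hmom s).integrable_sq.add (hmom t).integrable_sq) (hm.const_mul 2)]
    refine integral_congr_ae (ae_of_all _ fun ω => ?_)
    ring
  rw [covariance_eq_sub (hmom s) (hmom t), hmean, hmean, mul_zero, sub_zero]
  rw [h2] at hst'
  simp only [ENNReal.toReal_ofNat] at hst'
  simp only [Pi.mul_apply]
  linarith

end Field

/-! ### Smoothness of the cumulant function -/

section Cumulant

variable {b : ℝ} {W : Measure ℝ}

theorem integrable_sq_of_levyVar (h : levyVar b W < ∞) : Integrable (fun x : ℝ => x ^ 2) W := by
  refine ⟨by fun_prop, ?_⟩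
  rw [hasFiniteIntegral_iff_ofReal (ae_of_all _ fun x => by positivity)]
  exact (ENNReal.add_lt_top.1 h).2

theorem toReal_levyVar (hb : 0 ≤ b) (h : levyVar b W < ∞) :
    (levyVar b W).toReal = b + ∫ x, x ^ 2 ∂W := by
  rw [levyVar, ENNReal.toReal_add (by simp) (ENNReal.add_lt_top.1 h).2.ne,
    ENNReal.toReal_ofReal hb, integral_eq_lintegral_of_nonneg_ae
      (ae_of_all _ fun x => by positivity) (by fun_prop)]

theorem abs_sub_tau_le (x : ℝ) : |x - tau x| ≤ x ^ 2 := by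
  unfold tau
  split_ifs with h
  · simp [sq_nonneg]
  · push Not at h
    rcases lt_or_ge x 0 with h0 | h0
    · rw [Real.sign_of_neg h0, abs_of_neg (by rw [abs_of_neg h0] at h; linarith)]
      nlinarith [sq_nonneg (x + 1), abs_of_neg h0]
    · rw [abs_of_nonneg h0] at h
      rw [Real.sign_of_pos (by linarith), abs_of_pos (by linarith)]
      nlinarith

theorem norm_exp_I_mul_mul (s x : ℝ) : ‖Complex.exp (Complex.I * s * x)‖ = 1 := by
  rw [← Complex.norm_exp_ofReal_mul_I (s * x)]; congr 2; push_cast; ring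

theorem norm_exp_I_sub_one_le (s x : ℝ) :
    ‖Complex.exp (Complex.I * s * x) - 1‖ ≤ |s| * |x| := by
  have := Real.norm_exp_I_mul_ofReal_sub_one_le (x := s * x)
  rw [Real.norm_eq_abs, abs_mul] at this
  rwa [Complex.ofReal_mul, ← mul_assoc] at this

/-- Split off `i (x - τ(x))`: both pieces are of order `x²`, so the second moment of `W` suffices
for differentiating under the integral. -/
theorem norm_deriv_integrand_le (s x : ℝ) :
    ‖Complex.I * x * Complex.exp (Complex.I * s * x) - Complex.I * (tau x : ℂ)‖
      ≤ (|s| + 1) * x ^ 2 := by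
  have h : Complex.I * x * Complex.exp (Complex.I * s * x) - Complex.I * (tau x : ℂ) =
      Complex.I * x * (Complex.exp (Complex.I * s * x) - 1) +
        Complex.I * ((x - tau x : ℝ) : ℂ) := by
    push_cast; ring
  rw [h]
  refine (norm_add_le _ _).trans ?_
  simp only [norm_mul, Complex.norm_I, one_mul, Complex.norm_real, Real.norm_eq_abs]
  have h1 := mul_le_mul_of_nonneg_left (norm_exp_I_sub_one_le s x) (abs_nonneg x)
  have h2 := abs_sub_tau_le x
  have h3 : |x| * (|s| * |x|) = |s| * x ^ 2 := by rw [← sq_abs x]; ring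
  linarith

theorem hasDerivAt_exp_I_mul (s x : ℝ) :
    HasDerivAt (fun u : ℝ => Complex.exp (Complex.I * u * x))
      (Complex.I * x * Complex.exp (Complex.I * s * x)) s := by
  have h1 : HasDerivAt (fun u : ℝ => Complex.I * (u : ℂ) * x) (Complex.I * x) s := by
    simpa using ((Complex.ofRealCLM.hasDerivAt (x := s)).const_mul Complex.I).mul_const (x : ℂ)
  have := h1.cexp
  rwa [mul_comm] at this

theorem hasDerivAt_cumulant (hW : IsLevyMeasure W) (h : levyVar b W < ∞) (s : ℝ) :
    HasDerivAt (cumulant b W) (-(b : ℂ) * s +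
      ∫ x : ℝ, (Complex.I * x * Complex.exp (Complex.I * s * x) - Complex.I * (tau x : ℂ)) ∂W)
      s := by
  unfold cumulant
  refine HasDerivAt.add ?_ ?_
  · have := ((Complex.ofRealCLM.hasDerivAt (x := s)).pow 2).const_mul (-((b : ℂ) / 2))
    refine this.congr_deriv ?_
    simp only [Complex.ofRealCLM_apply, Nat.cast_ofNat, Complex.ofReal_one]
    ring
  · refine (hasDerivAt_integral_of_dominated_loc_of_deriv_le
      (F := fun (u : ℝ) (x : ℝ) => Complex.exp (Complex.I * u * x) - 1 - Complex.I * u * (tau x : ℂ))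
      (F' := fun (u : ℝ) (x : ℝ) =>
        Complex.I * x * Complex.exp (Complex.I * u * x) - Complex.I * (tau x : ℂ))
      (bound := fun x => (|s| + 1 + 1) * x ^ 2) (Metric.ball_mem_nhds s one_pos)
      (Eventually.of_forall fun u => (measurable_cumulant_integrand u).aestronglyMeasurable)
      (integrable_cumulant_integrand hW s) ?_ (ae_of_all _ fun x u hu => ?_)
      ((integrable_sq_of_levyVar h).const_mul _) (ae_of_all _ fun x u _ => ?_)).2
    · have := measurable_tau
      exact Measurable.aestronglyMeasurable (by fun_prop)
    · refine (norm_deriv_integrand_le u x).trans ?_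
      have h1 : |u| ≤ |s| + 1 := by
        have h2 : |u - s| < 1 := hu
        have h3 := abs_add_le (u - s) s
        rw [sub_add_cancel] at h3
        linarith
      gcongr
    · have h1 : HasDerivAt (fun u : ℝ => Complex.I * (u : ℂ) * (tau x : ℂ))
          (Complex.I * (tau x : ℂ)) u := by
        simpa using
          ((Complex.ofRealCLM.hasDerivAt (x := u)).const_mul Complex.I).mul_const (tau x : ℂ)
      exact ((hasDerivAt_exp_I_mul u x).sub_const 1).sub h1

theorem hasDerivAt_deriv_cumulant (h : levyVar b W < ∞) (s : ℝ) :
    HasDerivAt (fun s : ℝ => -(b : ℂ) * s +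
      ∫ x : ℝ, (Complex.I * x * Complex.exp (Complex.I * s * x) - Complex.I * (tau x : ℂ)) ∂W)
      (-(b : ℂ) + ∫ x : ℝ, (-((x : ℂ) ^ 2) * Complex.exp (Complex.I * s * x)) ∂W) s := by
  have hm := measurable_tau
  refine HasDerivAt.add ?_ ?_
  · simpa using (Complex.ofRealCLM.hasDerivAt (x := s)).const_mul (-(b : ℂ))
  · refine (hasDerivAt_integral_of_dominated_loc_of_deriv_le
      (F := fun (u : ℝ) (x : ℝ) =>
        Complex.I * x * Complex.exp (Complex.I * u * x) - Complex.I * (tau x : ℂ))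
      (F' := fun (u : ℝ) (x : ℝ) => -((x : ℂ) ^ 2) * Complex.exp (Complex.I * u * x))
      (bound := fun x => x ^ 2) (Metric.ball_mem_nhds s one_pos)
      (Eventually.of_forall fun u => Measurable.aestronglyMeasurable (by fun_prop))
      (((integrable_sq_of_levyVar h).const_mul (|s| + 1)).mono'
        (Measurable.aestronglyMeasurable (by fun_prop))
        (ae_of_all _ fun x => norm_deriv_integrand_le s x))
      (Measurable.aestronglyMeasurable (by fun_prop)) (ae_of_all _ fun x u _ => ?_)
      (integrable_sq_of_levyVar h) (ae_of_all _ fun x u _ => ?_)).2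
    · rw [norm_mul, norm_exp_I_mul_mul, mul_one, norm_neg, norm_pow, Complex.norm_real,
        Real.norm_eq_abs, sq_abs]
    · have := ((hasDerivAt_exp_I_mul u x).const_mul (Complex.I * x)).sub_const
        (Complex.I * (tau x : ℂ))
      convert this using 1
      rw [← mul_assoc, show Complex.I * (x : ℂ) * (Complex.I * x) =
        (Complex.I * Complex.I) * (x : ℂ) ^ 2 by ring, Complex.I_mul_I]
      ring

theorem deriv_deriv_cumulant (hW : IsLevyMeasure W) (h : levyVar b W < ∞) :
    deriv (deriv (cumulant b W)) = fun s : ℝ =>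
      (-(b : ℂ) + ∫ x : ℝ, (-((x : ℂ) ^ 2) * Complex.exp (Complex.I * s * x)) ∂W) := by
  have h1 : deriv (cumulant b W) = fun s : ℝ => -(b : ℂ) * s +
      ∫ x : ℝ, (Complex.I * x * Complex.exp (Complex.I * s * x) - Complex.I * (tau x : ℂ)) ∂W :=
    funext fun s => (hasDerivAt_cumulant hW h s).deriv
  rw [h1]
  exact funext fun s => (hasDerivAt_deriv_cumulant h s).deriv

theorem contDiff_cumulant (hW : IsLevyMeasure W) (h : levyVar b W < ∞) :
    ContDiff ℝ 2 (cumulant b W) := by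
  have h1 : deriv (cumulant b W) = fun s : ℝ => -(b : ℂ) * s +
      ∫ x : ℝ, (Complex.I * x * Complex.exp (Complex.I * s * x) - Complex.I * (tau x : ℂ)) ∂W :=
    funext fun s => (hasDerivAt_cumulant hW h s).deriv
  rw [show (2 : WithTop ℕ∞) = 1 + 1 by norm_num, contDiff_succ_iff_deriv]
  refine ⟨fun s => (hasDerivAt_cumulant hW h s).differentiableAt, by simp, ?_⟩
  rw [contDiff_one_iff_deriv]
  refine ⟨fun s => ?_, ?_⟩
  · rw [h1]; exact (hasDerivAt_deriv_cumulant h s).differentiableAt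
  · rw [deriv_deriv_cumulant hW h]
    refine continuous_const.add (continuous_of_dominated (bound := fun x => x ^ 2)
      (fun s => Measurable.aestronglyMeasurable (by fun_prop))
      (fun s => ae_of_all _ fun x => ?_) (integrable_sq_of_levyVar h)
      (ae_of_all _ fun x => by fun_prop))
    rw [norm_mul, norm_exp_I_mul_mul, mul_one, norm_neg, norm_pow, Complex.norm_real,
        Real.norm_eq_abs, sq_abs]

theorem deriv_deriv_cumulant_zero (hW : IsLevyMeasure W) (hb : 0 ≤ b) (h : levyVar b W < ∞) :
    deriv (deriv (cumulant b W)) 0 = ((-(levyVar b W).toReal : ℝ) : ℂ) := by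
  rw [deriv_deriv_cumulant hW h, toReal_levyVar hb h]
  simp only [Complex.ofReal_zero, mul_zero, zero_mul, Complex.exp_zero, mul_one]
  rw [integral_neg]
  simp_rw [← Complex.ofReal_pow]
  rw [integral_complex_ofReal]
  push_cast
  ring

theorem levyVar_pos (hW : IsLevyMeasure W) (h : 0 < b ∨ W ≠ 0) : 0 < levyVar b W := by
  rw [levyVar, add_pos_iff]
  rcases h with h | h
  · exact Or.inl (ENNReal.ofReal_pos.2 h)
  · refine Or.inr (pos_iff_ne_zero.2 fun h0 => h ?_)
    rw [lintegral_eq_zero_iff (by fun_prop)] at h0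
    have h1 : ∀ᵐ x ∂W, x ∈ ({0} : Set ℝ) := by
      filter_upwards [h0] with x hx
      simp only [Pi.zero_apply, ENNReal.ofReal_eq_zero] at hx
      have : x ^ 2 = 0 := le_antisymm hx (sq_nonneg x)
      simpa using this
    rw [← Measure.measure_univ_eq_zero]
    have h2 : W ({0} : Set ℝ)ᶜ = 0 := h1
    rw [← Set.union_compl_self ({0} : Set ℝ)]
    exact measure_union_null hW.zero_singleton h2

end Cumulant

/-! ### Slowly varying functions -/

section SlowlyVarying

/-- The uniform convergence theorem, in additive form. -/
theorem uniform_of_tendsto_sub {h : ℝ → ℝ} (hm : Measurable h)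
    (hlim : ∀ u : ℝ, Tendsto (fun x => h (x + u) - h x) atTop (𝓝 0)) {ε : ℝ} (hε : 0 < ε) :
    ∃ x₀ : ℝ, ∀ x, x₀ ≤ x → ∀ u ∈ Set.Icc (0 : ℝ) 1, |h (x + u) - h x| ≤ ε := by
  -- Truncation at `1` permits dominated convergence, so that the pointwise limits imply convergence
  -- of the averages over `[0, 2]`.
  set D : ℝ → ℝ → ℝ := fun x u => min 1 |h (x + u) - h x| with hD
  have hDm : ∀ x, Measurable (D x) := fun x => by simp only [hD]; fun_prop
  have hD0 : ∀ x u, 0 ≤ D x u := fun x u => by positivity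
  have hDi : ∀ x a c, IntervalIntegrable (D x) volume a c := fun x a c =>
    (intervalIntegrable_const (c := (1 : ℝ))).mono_fun (hDm x).aestronglyMeasurable
      (ae_of_all _ fun u => by
        dsimp only
        rw [Real.norm_of_nonneg (hD0 x u)]; simp [hD])
  have hφ : Tendsto (fun x => ∫ u in (0 : ℝ)..2, D x u) atTop (𝓝 0) := by
    have h0 : (0 : ℝ) = ∫ _ in (0 : ℝ)..2, (0 : ℝ) := by simp
    conv => rhs; rw [h0]
    refine intervalIntegral.tendsto_integral_filter_of_dominated_convergence (fun _ => 1)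
      (Eventually.of_forall fun x => (hDm x).aestronglyMeasurable)
      (Eventually.of_forall fun x => ae_of_all _ fun u _ => ?_) intervalIntegrable_const
      (ae_of_all _ fun u _ => ?_)
    · rw [Real.norm_of_nonneg (hD0 x u)]; simp [hD]
    · have := (tendsto_const_nhds (x := (1 : ℝ))).min (hlim u).abs
      simpa [hD] using this
  -- Two averages below `η` add up to less than `min ε (1/2)`: small enough for the claim and for
  -- the truncation in `D` to be inactive.
  set η := min ε (1 / 2) / 2 with hη
  have hηp : 0 < η := by positivity
  obtain ⟨x₀, hx₀⟩ := eventually_atTop.1 (hφ.eventually (gt_mem_nhds hηp))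
  refine ⟨x₀, fun x hx u hu => ?_⟩
  -- For every `v ∈ [1, 2]`, compare `h (x + u)` and `h x` through `h (x + v)`, then average over
  -- `v`. Since `u ∈ [0, 1]`, both `v` and `v - u` stay in `[0, 2]`.
  have key : D x u ≤ (∫ v in (0 : ℝ)..2, D x v) + ∫ v in (0 : ℝ)..2, D (x + u) v := by
    have h1 : D x u = ∫ _ in (1 : ℝ)..2, D x u := by simp; norm_num
    have h2 : ∫ _ in (1 : ℝ)..2, D x u ≤ ∫ v in (1 : ℝ)..2, (D x v + D (x + u) (v - u)) := by
      refine intervalIntegral.integral_mono_on one_le_two intervalIntegrable_const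
        ((hDi x 1 2).add ?_) fun v _ => ?_
      · refine (intervalIntegrable_const (c := (1 : ℝ))).mono_fun
          ((hDm (x + u)).comp (measurable_id.sub_const u)).aestronglyMeasurable
          (ae_of_all _ fun v => ?_)
        dsimp only [Function.comp_apply]
        rw [Real.norm_of_nonneg (hD0 _ _)]; simp [hD]
      · simp only [hD]
        rw [show x + u + (v - u) = x + v by ring]
        have h3 : |h (x + u) - h x| ≤ |h (x + v) - h x| + |h (x + v) - h (x + u)| := by
          have := abs_sub_le (h (x + u)) (h (x + v)) (h x)
          rw [abs_sub_comm (h (x + u)) (h (x + v))] at this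
          linarith
        rcases le_total 1 |h (x + v) - h x| with h4 | h4
        · rw [min_eq_left h4]
          exact (min_le_left _ _).trans (le_add_of_nonneg_right (by positivity))
        · rw [min_eq_right h4]
          rcases le_total 1 |h (x + v) - h (x + u)| with h5 | h5
          · rw [min_eq_left h5]
            exact (min_le_left _ _).trans (le_add_of_nonneg_left (by positivity))
          · rw [min_eq_right h5]
            exact (min_le_right _ _).trans h3
    rw [h1]
    refine h2.trans ?_
    have h6 : IntervalIntegrable (fun v => D (x + u) (v - u)) volume 1 2 := by
      have := (hDi (x + u) (1 - u) (2 - u)).comp_sub_right u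
      simpa using this
    rw [intervalIntegral.integral_add (hDi x 1 2) h6,
      intervalIntegral.integral_comp_sub_right (fun v => D (x + u) v) u]
    refine add_le_add ?_ ?_
    · exact intervalIntegral.integral_mono_interval zero_le_one one_le_two le_rfl
        (ae_of_all _ fun v => hD0 x v) (hDi _ _ _)
    · exact intervalIntegral.integral_mono_interval (by linarith [hu.2]) (by linarith)
        (by linarith [hu.1]) (ae_of_all _ fun v => hD0 _ v) (hDi _ _ _)
  have h7 := hx₀ x hx
  have h8 := hx₀ (x + u) (by linarith [hu.1])
  have h9 : D x u < min ε (1 / 2) := by rw [hη] at h7 h8; linarith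
  simp only [hD] at h9
  rcases le_total 1 |h (x + u) - h x| with h4 | h4
  · rw [min_eq_left h4] at h9
    have := h9.trans_le (min_le_right _ _)
    norm_num at this
  · rw [min_eq_right h4] at h9
    exact (h9.trans_le (min_le_left _ _)).le

/-- Chain `⌈y⌉₊ ≤ y + 1` steps of length at most `1`. -/
theorem abs_sub_le_of_uniform {h : ℝ → ℝ} {x₀ δ : ℝ} (hδ : 0 ≤ δ)
    (hu : ∀ x, x₀ ≤ x → ∀ u ∈ Set.Icc (0 : ℝ) 1, |h (x + u) - h x| ≤ δ) {x y : ℝ} (hx : x₀ ≤ x)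
    (hy : 0 ≤ y) : |h (x + y) - h x| ≤ δ * (y + 1) := by
  have key : ∀ n : ℕ, ∀ x y : ℝ, x₀ ≤ x → 0 ≤ y → y ≤ n → |h (x + y) - h x| ≤ δ * n := by
    intro n
    induction n with
    | zero =>
      intro x y _ h0 h1
      have : y = 0 := le_antisymm (by simpa using h1) h0
      simp [this]
    | succ n ih =>
      intro x y hx h0 h1
      push_cast at h1 ⊢
      rcases le_total y 1 with h2 | h2
      · refine (hu x hx y ⟨h0, h2⟩).trans ?_
        nlinarith [mul_nonneg hδ (Nat.cast_nonneg (α := ℝ) n)]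
      · have h3 := ih (x + 1) (y - 1) (by linarith) (by linarith) (by linarith)
        have h4 := hu x hx 1 ⟨zero_le_one, le_rfl⟩
        rw [show x + 1 + (y - 1) = x + y by ring] at h3
        have h5 := abs_sub_le (h (x + y)) (h (x + 1)) (h x)
        linarith
  refine (key ⌈y⌉₊ x y hx hy (Nat.le_ceil y)).trans ?_
  exact mul_le_mul_of_nonneg_left (Nat.ceil_lt_add_one hy).le hδ

variable {L : ℝ → ℝ}

/-- Potter's bounds. -/
theorem potter_bound (hLm : Measurable L) (hLpos : ∀ x, 0 < x → 0 < L x)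
    (hL : ∀ c : ℝ, 0 < c → Tendsto (fun x => L (c * x) / L x) atTop (𝓝 1)) {δ : ℝ}
    (hδ : 0 < δ) :
    ∃ A : ℝ, 1 ≤ A ∧ ∀ x y, A ≤ x → A ≤ y →
      L y / L x ≤ Real.exp δ * ((y / x) ^ δ + (y / x) ^ (-δ)) := by
  set h : ℝ → ℝ := fun x => Real.log (L (Real.exp x)) with hh
  have hm : Measurable h := by simp only [hh]; fun_prop
  have hpos : ∀ x, 0 < L (Real.exp x) := fun x => hLpos _ (Real.exp_pos x)
  have hlim : ∀ u : ℝ, Tendsto (fun x => h (x + u) - h x) atTop (𝓝 0) := by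
    intro u
    have h1 := (Real.continuousAt_log one_ne_zero).tendsto.comp
      ((hL (Real.exp u) (Real.exp_pos u)).comp Real.tendsto_exp_atTop)
    rw [Real.log_one] at h1
    refine h1.congr fun x => ?_
    simp only [Function.comp_apply, hh]
    rw [Real.log_div (hLpos _ (by positivity)).ne' (hpos x).ne', ← Real.exp_add, add_comm]
  obtain ⟨x₀, hx₀⟩ := uniform_of_tendsto_sub hm hlim hδ
  refine ⟨max 1 (Real.exp x₀), le_max_left _ _, fun x y hx hy => ?_⟩
  have hx0 : 0 < x := by linarith [le_max_left 1 (Real.exp x₀)]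
  have hy0 : 0 < y := by linarith [le_max_left 1 (Real.exp x₀)]
  have hx1 : x₀ ≤ Real.log x := (Real.le_log_iff_exp_le hx0).2 ((le_max_right _ _).trans hx)
  have hy1 : x₀ ≤ Real.log y := (Real.le_log_iff_exp_le hy0).2 ((le_max_right _ _).trans hy)
  have key : h (Real.log y) - h (Real.log x) ≤ δ * (|Real.log y - Real.log x| + 1) := by
    rcases le_total (Real.log x) (Real.log y) with h1 | h1
    · have := abs_sub_le_of_uniform hδ.le hx₀ hx1 (sub_nonneg.2 h1)
      rw [add_sub_cancel] at this
      rw [abs_of_nonneg (sub_nonneg.2 h1)]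
      exact (le_abs_self _).trans this
    · have := abs_sub_le_of_uniform hδ.le hx₀ hy1 (sub_nonneg.2 h1)
      rw [add_sub_cancel, abs_sub_comm] at this
      rw [abs_sub_comm, abs_of_nonneg (sub_nonneg.2 h1)]
      exact (le_abs_self _).trans this
  have h2 : L y / L x = Real.exp (h (Real.log y) - h (Real.log x)) := by
    simp only [hh, Real.exp_log hx0, Real.exp_log hy0]
    rw [← Real.log_div (hLpos y hy0).ne' (hLpos x hx0).ne',
      Real.exp_log (div_pos (hLpos y hy0) (hLpos x hx0))]
  have hyx : 0 < y / x := div_pos hy0 hx0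
  rw [h2]
  refine (Real.exp_le_exp.2 key).trans ?_
  rw [mul_add, mul_one, add_comm, Real.exp_add]
  refine mul_le_mul_of_nonneg_left ?_ (Real.exp_pos _).le
  rw [← Real.log_div hy0.ne' hx0.ne']
  -- `exp (δ |log q|)` is one of `q^δ` and `q^(-δ)`, hence at most their sum.
  rcases abs_cases (Real.log (y / x)) with ⟨h3, _⟩ | ⟨h3, _⟩
  · rw [h3, Real.rpow_def_of_pos hyx, mul_comm]
    exact le_add_of_nonneg_right (by positivity)
  · rw [h3, Real.rpow_def_of_pos hyx (-δ), mul_comm, neg_mul, mul_neg]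
    exact le_add_of_nonneg_left (by positivity)

/-- Potter's bound with numerator frozen at `L A`, read as a lower bound for `L x`. -/
theorem exists_mul_rpow_neg_le (hLm : Measurable L) (hLpos : ∀ x, 0 < x → 0 < L x)
    (hL : ∀ c : ℝ, 0 < c → Tendsto (fun x => L (c * x) / L x) atTop (𝓝 1)) {δ : ℝ}
    (hδ : 0 < δ) :
    ∃ c : ℝ, 0 < c ∧ ∀ᶠ x in atTop, c * x ^ (-δ) ≤ L x := by
  obtain ⟨A, hA, hp⟩ := potter_bound hLm hLpos hL hδ
  have hA0 : 0 < A := by linarith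
  refine ⟨L A / (Real.exp δ * 2) * A ^ δ, by have := hLpos A hA0; positivity, ?_⟩
  filter_upwards [eventually_ge_atTop A] with x hx
  have hx0 : 0 < x := by linarith
  have h1 := hp x A hx le_rfl
  have hLx := hLpos x hx0
  have h2 : (A / x) ^ δ ≤ (A / x) ^ (-δ) := by
    refine Real.rpow_le_rpow_of_exponent_ge (by positivity) ((div_le_one hx0).2 hx) (by linarith)
  have h3 : L A / L x ≤ Real.exp δ * 2 * (A / x) ^ (-δ) := by
    refine h1.trans ?_
    rw [mul_assoc]
    gcongr
    linarith
  rw [div_le_iff₀ hLx] at h3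
  have h4 : (A / x) ^ (-δ) = A ^ (-δ) * x ^ δ := by
    rw [Real.div_rpow hA0.le hx0.le, Real.rpow_neg hx0.le, div_inv_eq_mul]
  rw [h4] at h3
  have h5 : A ^ (-δ) * A ^ δ = 1 := by rw [← Real.rpow_add hA0]; simp
  have h6 : x ^ (-δ) * x ^ δ = 1 := by rw [← Real.rpow_add hx0]; simp
  calc L A / (Real.exp δ * 2) * A ^ δ * x ^ (-δ)
      ≤ (Real.exp δ * 2 * (A ^ (-δ) * x ^ δ) * L x) / (Real.exp δ * 2) * A ^ δ * x ^ (-δ) := by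
        gcongr
    _ = (A ^ (-δ) * A ^ δ) * (x ^ (-δ) * x ^ δ) * L x := by field_simp
    _ = L x := by rw [h5, h6]; ring

theorem tendsto_mul_rpow_atTop (hLm : Measurable L) (hLpos : ∀ x, 0 < x → 0 < L x)
    (hL : ∀ c : ℝ, 0 < c → Tendsto (fun x => L (c * x) / L x) atTop (𝓝 1)) {ε : ℝ}
    (hε : 0 < ε) : Tendsto (fun x => L x * x ^ ε) atTop atTop := by
  obtain ⟨c, hc, h⟩ := exists_mul_rpow_neg_le hLm hLpos hL (half_pos hε)
  refine tendsto_atTop_mono' _ ?_ ((tendsto_rpow_atTop (half_pos hε)).const_mul_atTop hc)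
  filter_upwards [h, eventually_gt_atTop 0] with x hx hx0
  calc c * x ^ (ε / 2) = c * x ^ (-(ε / 2)) * x ^ ε := by
        rw [mul_assoc, ← Real.rpow_add hx0]; ring_nf
    _ ≤ L x * x ^ ε := by gcongr

/-- The exponent `γ < η` controls the integrand on `(0, 1]`, and `β > η` controls it on `(1, ∞)`. -/
theorem integrableOn_rpow_mul {h : ℝ → ℝ} {C γ β η : ℝ} (hm : Measurable h)
    (h0 : ∀ v, 0 < v → 0 ≤ h v) (hγ : ∀ v, 0 < v → h v ≤ C * v ^ (-γ))
    (hβ : ∀ v, 0 < v → h v ≤ C * v ^ (-β)) (h1 : γ < η) (h2 : η < β) :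
    IntegrableOn (fun v => v ^ (η - 1) * h v) (Set.Ioi 0) := by
  rw [← Set.Ioc_union_Ioi_eq_Ioi zero_le_one]
  refine IntegrableOn.union ?_ ?_
  · have h3 : IntegrableOn (fun v : ℝ => C * v ^ (η - 1 - γ)) (Set.Ioc 0 1) :=
      ((intervalIntegrable_iff_integrableOn_Ioc_of_le zero_le_one).1
        (intervalIntegral.intervalIntegrable_rpow' (by linarith))).const_mul C
    refine h3.mono' (Measurable.aestronglyMeasurable (by fun_prop)) ?_
    filter_upwards [ae_restrict_mem measurableSet_Ioc] with v hv
    have hv0 : 0 < v := hv.1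
    rw [Real.norm_of_nonneg (mul_nonneg (by positivity) (h0 v hv0)), sub_eq_add_neg (η - 1) γ,
      Real.rpow_add hv0, mul_left_comm]
    exact mul_le_mul_of_nonneg_left (hγ v hv0) (by positivity)
  · have h3 : IntegrableOn (fun v : ℝ => C * v ^ (η - 1 - β)) (Set.Ioi 1) :=
      (integrableOn_Ioi_rpow_of_lt (by linarith) zero_lt_one).const_mul C
    refine h3.mono' (Measurable.aestronglyMeasurable (by fun_prop)) ?_
    filter_upwards [ae_restrict_mem measurableSet_Ioi] with v hv
    have hv0 : 0 < v := zero_lt_one.trans hv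
    rw [Real.norm_of_nonneg (mul_nonneg (by positivity) (h0 v hv0)), sub_eq_add_neg (η - 1) β,
      Real.rpow_add hv0, mul_left_comm]
    exact mul_le_mul_of_nonneg_left (hβ v hv0) (by positivity)

/-- An Abelian theorem for Mellin convolutions with a regularly varying density. -/
theorem tendsto_mellin_convolution (hLm : Measurable L) (hLpos : ∀ x, 0 < x → 0 < L x)
    (hL : ∀ c : ℝ, 0 < c → Tendsto (fun x => L (c * x) / L x) atTop (𝓝 1))
    {h : ℝ → ℝ} {C α β γ : ℝ} (hm : Measurable h)
    (h0 : ∀ v, 0 < v → 0 ≤ h v) (hγ : ∀ v, 0 < v → h v ≤ C * v ^ (-γ))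
    (hβ : ∀ v, 0 < v → h v ≤ C * v ^ (-β)) (hα : 0 < α) (hγα : γ < α)
    (hαβ : α < β) (hint : IntegrableOn (fun v => L (1 / v) * v ^ (α - 1)) (Set.Ioi 0)) :
    Tendsto (fun R => (∫ v in Set.Ioi (0 : ℝ), L (1 / v) * v ^ (α - 1) * h (v * R)) /
      (L R * R ^ (-α))) atTop (𝓝 (∫ v in Set.Ioi (0 : ℝ), v ^ (α - 1) * h v)) := by
  -- The Potter loss `v^(±δ)` must keep the exponents `α ± δ` strictly between `γ` and `β`.
  set δ := min (α - γ) (β - α) / 2 with hδdef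
  have hδ : 0 < δ := by
    have : 0 < min (α - γ) (β - α) := lt_min (by linarith) (by linarith)
    linarith
  have hδ1 : δ < α - γ := by
    have := min_le_left (α - γ) (β - α); linarith
  have hδ2 : δ < β - α := by
    have := min_le_right (α - γ) (β - α); linarith
  have hC : 0 ≤ C := by
    have h1 := (h0 1 one_pos).trans (hγ 1 one_pos)
    simpa using h1
  obtain ⟨A, hA, hp⟩ := potter_bound hLm hLpos hL hδ
  have hA0 : 0 < A := by linarith
  -- The main part in the rescaled variable, cut off so that `R / v ≥ A`, where Potter's bound
  -- applies and supplies the majorant `B`.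
  set F : ℝ → ℝ → ℝ := fun R v =>
    (Set.Ioc 0 (R / A)).indicator (fun v => L (R / v) / L R * (v ^ (α - 1) * h v)) v with hF
  set B : ℝ → ℝ := fun v =>
    Real.exp δ * (v ^ (α - δ - 1) * h v + v ^ (α + δ - 1) * h v) with hB
  have hBi : IntegrableOn B (Set.Ioi 0) :=
    ((integrableOn_rpow_mul hm h0 hγ hβ (by linarith) (by linarith)).add
      (integrableOn_rpow_mul hm h0 hγ hβ (by linarith) (by linarith))).const_mul _
  have hFm : ∀ R, Measurable (F R) := fun R =>
    Measurable.indicator (by fun_prop) measurableSet_Ioc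
  have hFB : ∀ R, A ≤ R → ∀ v, 0 < v → ‖F R v‖ ≤ B v := by
    intro R hR v hv
    have hR0 : 0 < R := by linarith
    have hhv := h0 v hv
    have hBnn : 0 ≤ B v := by simp only [hB]; positivity
    by_cases hvR : v ∈ Set.Ioc 0 (R / A)
    · have h1 : A ≤ R / v := by
        rw [le_div_iff₀ hv]
        have := hvR.2
        rw [le_div_iff₀ hA0] at this
        linarith
      have h2 := hp R (R / v) hR h1
      have h3 : R / v / R = v⁻¹ := by field_simp
      rw [h3, Real.rpow_neg (by positivity), Real.inv_rpow hv.le, inv_inv] at h2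
      have h4 : 0 < L (R / v) / L R := div_pos (hLpos _ (by positivity)) (hLpos _ hR0)
      simp only [hF, Set.indicator_of_mem hvR]
      rw [Real.norm_of_nonneg (by positivity)]
      calc L (R / v) / L R * (v ^ (α - 1) * h v)
          ≤ Real.exp δ * ((v ^ δ)⁻¹ + v ^ δ) * (v ^ (α - 1) * h v) := by gcongr
        _ = B v := by
          simp only [hB]
          rw [show α - δ - 1 = α - 1 - δ by ring, show α + δ - 1 = α - 1 + δ by ring,
            Real.rpow_sub hv (α - 1), Real.rpow_add hv (α - 1)]
          ring
    · simp only [hF, Set.indicator_of_notMem hvR]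
      simpa using hBnn
  have hFi : ∀ R, A ≤ R → IntegrableOn (F R) (Set.Ioi 0) := fun R hR =>
    Integrable.mono' hBi (hFm R).aestronglyMeasurable
      ((ae_restrict_mem measurableSet_Ioi).mono fun v hv => hFB R hR v hv)
  have hlimF : Tendsto (fun R => ∫ v in Set.Ioi (0 : ℝ), F R v) atTop
      (𝓝 (∫ v in Set.Ioi (0 : ℝ), v ^ (α - 1) * h v)) := by
    refine tendsto_integral_filter_of_dominated_convergence B
      (Eventually.of_forall fun R => (hFm R).aestronglyMeasurable) ?_ hBi ?_
    · filter_upwards [eventually_ge_atTop A] with R hR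
      exact (ae_restrict_mem measurableSet_Ioi).mono fun v hv => hFB R hR v hv
    · filter_upwards [ae_restrict_mem measurableSet_Ioi] with v hv
      have hv0 : 0 < v := hv
      have h1 := (hL v⁻¹ (inv_pos.2 hv0)).mul_const (v ^ (α - 1) * h v)
      rw [one_mul] at h1
      refine h1.congr' ?_
      filter_upwards [eventually_ge_atTop (v * A)] with R hR
      have : v ∈ Set.Ioc 0 (R / A) := ⟨hv0, (le_div_iff₀ hA0).2 hR⟩
      simp only [hF, Set.indicator_of_mem this]
      rw [inv_mul_eq_div]
  -- The remainder `v > 1 / A`, where `L (1 / v)` is outside the asymptotic range. Here only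
  -- integrability of the density and the decay `h (v R) ≤ C (R / A)^(-β)` are used.
  set G : ℝ → ℝ → ℝ := fun R v =>
    (Set.Ioi (1 / A)).indicator (fun v => L (1 / v) * v ^ (α - 1) * h (v * R)) v with hG
  have hGb : ∀ R, A ≤ R → ∀ v, 0 < v →
      ‖G R v‖ ≤ C * (R / A) ^ (-β) * (L (1 / v) * v ^ (α - 1)) := by
    intro R hR v hv
    have hR0 : 0 < R := by linarith
    have hLv := hLpos (1 / v) (by positivity)
    by_cases hvA : v ∈ Set.Ioi (1 / A)
    · simp only [hG, Set.indicator_of_mem hvA]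
      have h1 := h0 (v * R) (by positivity)
      rw [Real.norm_of_nonneg (by positivity), mul_comm]
      gcongr
      refine (hβ (v * R) (by positivity)).trans ?_
      gcongr 1
      refine Real.rpow_le_rpow_of_nonpos (by positivity) ?_ ?_
      · have : 1 / A < v := hvA
        rw [div_eq_mul_one_div, mul_comm]
        gcongr
      · linarith
    · simp only [hG, Set.indicator_of_notMem hvA]
      simp only [norm_zero]
      positivity
  have hGm : ∀ R, Measurable (G R) := fun R =>
    Measurable.indicator (by fun_prop) measurableSet_Ioi
  have hGi : ∀ R, A ≤ R → IntegrableOn (G R) (Set.Ioi 0) := fun R hR =>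
    Integrable.mono' (hint.const_mul _) (hGm R).aestronglyMeasurable
      ((ae_restrict_mem measurableSet_Ioi).mono fun v hv => hGb R hR v hv)
  set I := ∫ v in Set.Ioi (0 : ℝ), L (1 / v) * v ^ (α - 1) with hI
  have hsplit : ∀ R, A ≤ R → ∫ v in Set.Ioi (0 : ℝ), L (1 / v) * v ^ (α - 1) * h (v * R) =
      L R * R ^ (-α) * (∫ v in Set.Ioi (0 : ℝ), F R v) + ∫ v in Set.Ioi (0 : ℝ), G R v := by
    intro R hR
    have hR0 : 0 < R := by linarith
    have hLR := hLpos R hR0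
    have h1 : ∀ v ∈ Set.Ioi (0 : ℝ), L (1 / v) * v ^ (α - 1) * h (v * R) =
        L R * R ^ (-(α - 1)) * F R (v * R) + G R v := by
      intro v hv
      have hv0 : 0 < v := hv
      by_cases hvA : v ≤ 1 / A
      · have h2 : v * R ∈ Set.Ioc 0 (R / A) :=
          ⟨by positivity, by rw [div_eq_mul_one_div, mul_comm]; gcongr⟩
        have h3 : v ∉ Set.Ioi (1 / A) := by simpa using hvA
        simp only [hF, hG, Set.indicator_of_mem h2, Set.indicator_of_notMem h3, add_zero]
        have h4 : R / (v * R) = 1 / v := by field_simp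
        have h5 : R ^ (-(α - 1)) * R ^ (α - 1) = 1 := by rw [← Real.rpow_add hR0]; simp
        rw [h4, Real.mul_rpow hv0.le hR0.le]
        calc _ = (R ^ (-(α - 1)) * R ^ (α - 1)) * (L (1 / v) * v ^ (α - 1) * h (v * R)) := by
              rw [h5, one_mul]
          _ = _ := by field_simp
      · have h2 : v * R ∉ Set.Ioc 0 (R / A) := by
          intro h3
          refine hvA ?_
          have h4 := h3.2
          rw [div_eq_mul_one_div, mul_comm R] at h4
          exact le_of_mul_le_mul_right h4 hR0
        have h3 : v ∈ Set.Ioi (1 / A) := not_le.1 hvA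
        simp only [hF, hG, Set.indicator_of_notMem h2, Set.indicator_of_mem h3, mul_zero, zero_add]
    have h6 : IntegrableOn (fun v => F R (v * R)) (Set.Ioi 0) := by
      have := (integrableOn_Ioi_comp_mul_right_iff (F R) 0 hR0).2 (by simpa using hFi R hR)
      exact this
    rw [setIntegral_congr_fun measurableSet_Ioi h1,
      integral_add (h6.const_mul _) (hGi R hR), integral_const_mul,
      integral_comp_mul_right_Ioi (F R) 0 hR0, zero_mul, smul_eq_mul]
    congr 1
    have h7 : R ^ (-α) = R ^ (-(α - 1)) * R⁻¹ := by
      rw [← Real.rpow_neg_one, ← Real.rpow_add hR0]; ring_nf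
    rw [h7]; ring
  -- The tail is `O (R^(-β))` while `L R * R^(-α)` is at least a multiple of `R^(-α-δ)`; `δ < β - α`
  -- makes the quotient vanish.
  have htail : Tendsto (fun R => (∫ v in Set.Ioi (0 : ℝ), G R v) / (L R * R ^ (-α))) atTop
      (𝓝 0) := by
    obtain ⟨c, hc, hcL⟩ := exists_mul_rpow_neg_le hLm hLpos hL hδ
    have hI0 : 0 ≤ I := setIntegral_nonneg measurableSet_Ioi fun v hv => by
      have hv0 : 0 < v := hv
      have := hLpos (1 / v) (by positivity)
      positivity
    have h1 : Tendsto (fun R : ℝ => C * A ^ β * I / c * R ^ (-(β - α - δ))) atTop (𝓝 0) := by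
      have := (tendsto_rpow_neg_atTop (y := β - α - δ) (by linarith)).const_mul
        (C * A ^ β * I / c)
      rwa [mul_zero] at this
    refine squeeze_zero_norm' ?_ h1
    filter_upwards [hcL, eventually_ge_atTop A] with R hcR hR
    have hR0 : 0 < R := by linarith
    have hLR := hLpos R hR0
    have h2 : ‖∫ v in Set.Ioi (0 : ℝ), G R v‖ ≤ C * (R / A) ^ (-β) * I := by
      rw [hI, ← integral_const_mul]
      exact norm_integral_le_of_norm_le (hint.const_mul _)
        ((ae_restrict_mem measurableSet_Ioi).mono fun v hv => hGb R hR v hv)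
    rw [norm_div, Real.norm_of_nonneg (show 0 ≤ L R * R ^ (-α) by positivity),
      div_le_iff₀ (by positivity)]
    refine h2.trans ?_
    calc C * (R / A) ^ (-β) * I = C * A ^ β * I / c * R ^ (-(β - α - δ)) *
          (c * R ^ (-δ) * R ^ (-α)) := by
          have h3 : R ^ (-(β - α - δ)) * (R ^ (-δ) * R ^ (-α)) = R ^ (-β) := by
            rw [← Real.rpow_add hR0, ← Real.rpow_add hR0]; ring_nf
          rw [Real.div_rpow hR0.le hA0.le, Real.rpow_neg hA0.le, div_inv_eq_mul, ← h3]
          field_simp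
      _ ≤ _ := by gcongr
  have hsum := hlimF.add htail
  rw [add_zero] at hsum
  refine hsum.congr' ?_
  filter_upwards [eventually_ge_atTop A] with R hR
  have hR0 : 0 < R := by linarith
  have hLR := hLpos R hR0
  rw [hsplit R hR, add_div, mul_div_cancel_left₀]
  positivity

end SlowlyVarying

/-! ### Bessel functions and subordination -/

section Bessel

theorem integrableOn_rpow_mul_exp {ν p q : ℝ} (hν : 0 < ν) (hp : 0 < p) (hq : 0 ≤ q) :
    IntegrableOn (fun a : ℝ => a ^ (ν - 1) * Real.exp (-(p * a) - q / a)) (Set.Ioi 0) := by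
  have h := integrableOn_rpow_mul_exp_neg_mul_rpow (s := ν - 1) (p := 1) (b := p) (by linarith)
    zero_lt_one hp
  refine h.mono' (Measurable.aestronglyMeasurable (by fun_prop)) ?_
  filter_upwards [ae_restrict_mem measurableSet_Ioi] with a ha
  have ha0 : 0 < a := ha
  rw [Real.norm_of_nonneg (by positivity), Real.rpow_one]
  gcongr
  have : 0 ≤ q / a := by positivity
  linarith

theorem image_const_mul_exp {c : ℝ} (hc : 0 < c) :
    (fun s => c * Real.exp s) '' Set.univ = Set.Ioi 0 := by
  ext y
  simp only [Set.image_univ, Set.mem_range, Set.mem_Ioi]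
  constructor
  · rintro ⟨s, rfl⟩; positivity
  · intro hy
    exact ⟨Real.log (y / c), by rw [Real.exp_log (by positivity)]; field_simp⟩

/-- The substitution `a = (r / (2v)) exp s` symmetrises the exponent to `-v r cosh s`. Folding `s`
and `-s` together turns `exp (ν s)` into `2 cosh (ν s)`. -/
theorem integral_rpow_mul_exp_eq_besselK {ν v r : ℝ} (hν : 0 < ν) (hv : 0 < v) (hr : 0 < r) :
    ∫ a in Set.Ioi (0 : ℝ), a ^ (ν - 1) * Real.exp (-(v ^ 2 * a) - r ^ 2 / 4 / a) =
      2 * (r / (2 * v)) ^ ν * besselK ν (v * r) := by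
  set c := r / (2 * v) with hc
  have hc0 : 0 < c := by positivity
  have hder : ∀ s ∈ (Set.univ : Set ℝ), HasDerivWithinAt (fun s => c * Real.exp s)
      (c * Real.exp s) Set.univ s := fun s _ =>
    ((Real.hasDerivAt_exp s).const_mul c).hasDerivWithinAt
  have hinj : Set.InjOn (fun s => c * Real.exp s) Set.univ := fun x _ y _ h =>
    Real.exp_injective (mul_left_cancel₀ hc0.ne' h)
  set g : ℝ → ℝ := fun a => a ^ (ν - 1) * Real.exp (-(v ^ 2 * a) - r ^ 2 / 4 / a) with hg
  have hgi : IntegrableOn g (Set.Ioi 0) :=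
    integrableOn_rpow_mul_exp hν (by positivity) (by positivity)
  set φ : ℝ → ℝ := fun s => c ^ ν * (Real.exp (-(v * r) * Real.cosh s) * Real.exp (ν * s)) with hφ
  have hsub : ∀ s, |c * Real.exp s| • g (c * Real.exp s) = φ s := by
    intro s
    have h1 : -(v ^ 2 * (c * Real.exp s)) - r ^ 2 / 4 / (c * Real.exp s) =
        -(v * r) * Real.cosh s := by
      rw [Real.cosh_eq, Real.exp_neg, hc]; field_simp; ring
    simp only [hg, hφ, smul_eq_mul]
    rw [abs_of_pos (by positivity), h1, Real.mul_rpow hc0.le (Real.exp_pos s).le, ← Real.exp_mul,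
      Real.rpow_sub_one hc0.ne']
    have h2 : Real.exp (ν * s) = Real.exp s * Real.exp (s * (ν - 1)) := by
      rw [← Real.exp_add]; ring_nf
    rw [h2]; field_simp
  have hφi : Integrable φ := by
    rw [← image_const_mul_exp hc0, integrableOn_image_iff_integrableOn_abs_deriv_smul
      MeasurableSet.univ hder hinj] at hgi
    simpa only [hsub, integrableOn_univ] using hgi
  have h3 : ∫ a in Set.Ioi (0 : ℝ), g a = ∫ s, φ s := by
    rw [← image_const_mul_exp hc0, integral_image_eq_integral_abs_deriv_smul
      MeasurableSet.univ hder hinj]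
    simp only [hsub, setIntegral_univ]
  have h4 : ∫ s in Set.Iic (0 : ℝ), φ s = ∫ s in Set.Ioi (0 : ℝ), φ (-s) := by
    rw [integral_comp_neg_Ioi, neg_zero]
  have h5 : IntegrableOn (fun s => φ (-s)) (Set.Ioi 0) := hφi.comp_neg.integrableOn
  rw [h3, ← integral_add_compl measurableSet_Iic hφi (s := Set.Iic 0), Set.compl_Iic, h4,
    ← integral_add h5 hφi.integrableOn, besselK, ← integral_const_mul]
  refine integral_congr_ae (ae_of_all _ fun s => ?_)
  simp only [hφ]
  rw [Real.cosh_neg, Real.cosh_eq (ν * s), mul_neg]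
  ring

theorem image_sinh_half : (fun s => Real.sinh (s / 2)) '' Set.Ioi 0 = Set.Ioi 0 := by
  ext y
  simp only [Set.mem_image, Set.mem_Ioi]
  constructor
  · rintro ⟨s, hs, rfl⟩
    exact Real.sinh_pos_iff.2 (by positivity)
  · intro hy
    refine ⟨2 * Real.arsinh y, by have := Real.arsinh_pos_iff.2 hy; positivity, ?_⟩
    rw [mul_div_cancel_left₀ _ two_ne_zero, Real.sinh_arsinh]

/-- Since `cosh s = 1 + 2 sinh² (s/2)`, substituting `y = sinh (s/2)` leaves a Gaussian integral. -/
theorem besselK_half (x : ℝ) :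
    besselK (1 / 2) x = √(Real.pi / (2 * x)) * Real.exp (-x) := by
  have hder : ∀ s ∈ Set.Ioi (0 : ℝ), HasDerivWithinAt (fun s => Real.sinh (s / 2))
      (Real.cosh (s / 2) * (1 / 2)) (Set.Ioi 0) s := fun s _ =>
    (HasDerivAt.sinh ((hasDerivAt_id s).div_const 2)).hasDerivWithinAt
  have hinj : Set.InjOn (fun s => Real.sinh (s / 2)) (Set.Ioi 0) := fun a _ b _ h => by
    have := Real.sinh_injective h
    linarith
  have h1 := integral_image_eq_integral_abs_deriv_smul measurableSet_Ioi hder hinj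
    (fun y => Real.exp (-(2 * x) * y ^ 2))
  rw [image_sinh_half, integral_gaussian_Ioi] at h1
  have h2 : besselK (1 / 2) x = 2 * Real.exp (-x) * (√(Real.pi / (2 * x)) / 2) := by
    rw [h1, besselK, ← integral_const_mul]
    refine integral_congr_ae (ae_of_all _ fun s => ?_)
    have h3 : Real.cosh s = 1 + 2 * Real.sinh (s / 2) ^ 2 := by
      have h4 := Real.cosh_two_mul (s / 2)
      rw [mul_div_cancel₀ _ two_ne_zero, Real.cosh_sq] at h4
      rw [h4]; ring
    have h5 : Real.exp (-x * Real.cosh s) =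
        Real.exp (-x) * Real.exp (-(2 * x) * Real.sinh (s / 2) ^ 2) := by
      rw [← Real.exp_add, h3]; ring_nf
    dsimp only
    rw [smul_eq_mul, abs_of_pos (by have := Real.cosh_pos (s / 2); positivity), h5,
      one_div_mul_eq_div]
    ring
  rw [h2]; ring

/-- For `r > 0` this is the Bessel formula at order `1/2`. At `r = 0` that substitution degenerates
and a Gamma integral takes its place. -/
theorem integral_subordination {v r : ℝ} (hv : 0 < v) (hr : 0 ≤ r) :
    ∫ a in Set.Ioi (0 : ℝ), a ^ ((1 / 2 : ℝ) - 1) * Real.exp (-(v ^ 2 * a) - r ^ 2 / 4 / a) =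
      √Real.pi / v * Real.exp (-(v * r)) := by
  rcases hr.eq_or_lt with rfl | hr
  · have := Real.integral_rpow_mul_exp_neg_mul_Ioi (a := 1 / 2) (r := v ^ 2) (by norm_num)
      (by positivity)
    simp only [ne_eq, OfNat.ofNat_ne_zero, not_false_eq_true, zero_pow, zero_div, sub_zero,
      mul_zero, neg_zero, Real.exp_zero, mul_one]
    rw [this, Real.Gamma_one_half_eq, ← Real.sqrt_eq_rpow, one_div, Real.sqrt_inv,
      Real.sqrt_sq hv.le]
    ring
  · rw [integral_rpow_mul_exp_eq_besselK (by norm_num) hv hr, besselK_half,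
      ← Real.sqrt_eq_rpow, ← mul_assoc, mul_assoc 2, ← Real.sqrt_mul (by positivity)]
    have h1 : r / (2 * v) * (Real.pi / (2 * (v * r))) = Real.pi / (2 * v) ^ 2 := by
      field_simp
    rw [h1, Real.sqrt_div Real.pi_pos.le, Real.sqrt_sq (by positivity)]
    field_simp

/-- The exponential function as a mixture of Gaussian functions. -/
theorem lintegral_subordination {v r : ℝ} (hv : 0 < v) (hr : 0 ≤ r) :
    ∫⁻ a in Set.Ioi (0 : ℝ), ENNReal.ofReal (v / √Real.pi * (a ^ ((1 / 2 : ℝ) - 1) *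
      Real.exp (-(v ^ 2 * a) - r ^ 2 / 4 / a))) = ENNReal.ofReal (Real.exp (-(v * r))) := by
  rw [← ofReal_integral_eq_lintegral_ofReal
    ((integrableOn_rpow_mul_exp (by norm_num) (by positivity) (by positivity)).const_mul _),
    integral_const_mul, integral_subordination hv hr]
  · congr 1
    have : √Real.pi ≠ 0 := (Real.sqrt_pos.2 Real.pi_pos).ne'
    field_simp
  · filter_upwards [ae_restrict_mem measurableSet_Ioi] with a ha
    have ha0 : 0 < a := ha
    positivity

variable {d : ℕ}

/-- Complete the square around the weighted mean `m` of `s` and `t`. -/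
theorem lintegral_gaussian_mul_gaussian {p q : ℝ} (hp : 0 < p) (hq : 0 < q)
    (s t : EuclideanSpace ℝ (Fin d)) :
    ∫⁻ u, ENNReal.ofReal (Real.exp (-(p * ‖s - u‖ ^ 2)) * Real.exp (-(q * ‖t - u‖ ^ 2))) =
      ENNReal.ofReal ((Real.pi / (p + q)) ^ ((d : ℝ) / 2) *
        Real.exp (-(p * q / (p + q) * ‖s - t‖ ^ 2))) := by
  set m : EuclideanSpace ℝ (Fin d) := (p / (p + q)) • s + (q / (p + q)) • t with hm
  have hsq : ∀ u : EuclideanSpace ℝ (Fin d), p * ‖s - u‖ ^ 2 + q * ‖t - u‖ ^ 2 =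
      (p + q) * ‖u - m‖ ^ 2 + p * q / (p + q) * ‖s - t‖ ^ 2 := by
    intro u
    simp only [← real_inner_self_eq_norm_sq, hm, inner_sub_left, inner_sub_right, inner_add_left,
      inner_add_right, real_inner_smul_left, real_inner_smul_right]
    rw [real_inner_comm u s, real_inner_comm u t, real_inner_comm t s]
    field_simp
    ring
  have h1 : ∀ u : EuclideanSpace ℝ (Fin d),
      Real.exp (-(p * ‖s - u‖ ^ 2)) * Real.exp (-(q * ‖t - u‖ ^ 2)) =
      Real.exp (-(p * q / (p + q) * ‖s - t‖ ^ 2)) * Real.exp (-(p + q) * ‖u - m‖ ^ 2) := by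
    intro u
    rw [← Real.exp_add, ← Real.exp_add]
    congr 1
    linarith [hsq u]
  have h2 := GaussianFourier.integral_rexp_neg_mul_sq_norm (V := EuclideanSpace ℝ (Fin d))
    (add_pos hp hq)
  rw [finrank_euclideanSpace_fin] at h2
  -- A non-integrable function has integral `0` by default, whereas the known value is positive.
  have hi : Integrable fun u : EuclideanSpace ℝ (Fin d) => Real.exp (-(p + q) * ‖u‖ ^ 2) := by
    by_contra hc
    rw [integral_undef hc] at h2
    have : 0 < (Real.pi / (p + q)) ^ ((d : ℝ) / 2) := by positivity
    linarith
  simp_rw [h1]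
  rw [← ofReal_integral_eq_lintegral_ofReal ((hi.comp_sub_right m).const_mul _)
    (ae_of_all _ fun u => by positivity), integral_const_mul,
    integral_sub_right_eq_self (fun u => Real.exp (-(p + q) * ‖u‖ ^ 2)) m, h2, mul_comm]

/-- Rescale to the unit interval and use that the beta density has mass one. -/
theorem lintegral_beta {q A : ℝ} (hq : 0 < q) (hA : 0 < A) :
    ∫⁻ a in Set.Ioo 0 A, ENNReal.ofReal ((a * (A - a)) ^ (q - 1)) =
      ENNReal.ofReal (A ^ (2 * q - 1) * beta q q) := by
  have h1 := lintegral_betaPDF_eq_one hq hq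
  rw [lintegral_betaPDF] at h1
  have hb := beta_pos hq hq
  have himg : (fun x => A * x) '' Set.Ioo 0 1 = Set.Ioo 0 A := by
    rw [Set.image_mul_left_Ioo hA]; simp
  rw [← himg, lintegral_image_eq_lintegral_abs_deriv_mul (f' := fun _ => A) measurableSet_Ioo
    (fun x _ => by simpa using ((hasDerivAt_id x).const_mul A).hasDerivWithinAt)
    (fun x _ y _ h => mul_left_cancel₀ hA.ne' h)]
  rw [← mul_one (ENNReal.ofReal (A ^ (2 * q - 1) * beta q q)), ← h1,
    ← lintegral_const_mul _ (by fun_prop)]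
  refine setLIntegral_congr_fun measurableSet_Ioo fun x hx => ?_
  have hx0 : 0 < x := hx.1
  have hx1 : 0 < 1 - x := sub_pos.2 hx.2
  rw [← ENNReal.ofReal_mul (abs_nonneg _), ← ENNReal.ofReal_mul (by positivity), abs_of_pos hA]
  congr 1
  rw [show A * x * (A - A * x) = A ^ (2 : ℝ) * (x * (1 - x)) by
      rw [Real.rpow_two]; ring, Real.mul_rpow (by positivity) (by positivity),
    Real.mul_rpow hx0.le hx1.le, ← Real.rpow_mul hA.le,
    show 2 * q - 1 = 1 + 2 * (q - 1) by ring, Real.rpow_add hA, Real.rpow_one]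
  field_simp

end Bessel

/-! ### The convolution of two exponential kernels -/

section Convolution

variable {d : ℕ}

/-- Additive convolution on the half line, as an integral over triangles. -/
theorem lintegral_Ioi_Ioi_add {Φ : ℝ → ℝ → ℝ≥0∞} (hΦ : Measurable (Function.uncurry Φ)) :
    ∫⁻ a in Set.Ioi (0 : ℝ), ∫⁻ a' in Set.Ioi (0 : ℝ), Φ a (a + a') =
      ∫⁻ A in Set.Ioi (0 : ℝ), ∫⁻ a in Set.Ioo 0 A, Φ a A := by
  have h1 : ∀ a : ℝ, ∫⁻ a' in Set.Ioi (0 : ℝ), Φ a (a + a') =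
      ∫⁻ A, (Set.Ioi a).indicator (Φ a) A := by
    intro a
    rw [← lintegral_indicator measurableSet_Ioi,
      ← lintegral_add_left_eq_self (fun A => (Set.Ioi a).indicator (Φ a) A) a]
    refine lintegral_congr fun a' => ?_
    by_cases h : 0 < a' <;> simp [h, Set.indicator]
  have hset : MeasurableSet {p : ℝ × ℝ | 0 < p.1 ∧ p.1 < p.2} :=
    (measurableSet_lt measurable_const measurable_fst).inter
      (measurableSet_lt measurable_fst measurable_snd)
  have h2 : ∀ a A : ℝ, (Set.Ioi (0 : ℝ)).indicator
      (fun a => (Set.Ioi a).indicator (Φ a) A) a =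
      {p : ℝ × ℝ | 0 < p.1 ∧ p.1 < p.2}.indicator (Function.uncurry Φ) (a, A) := by
    intro a A
    by_cases ha : 0 < a <;> by_cases hA : a < A <;> simp [ha, hA, Set.indicator]
  simp_rw [h1]
  rw [← lintegral_indicator measurableSet_Ioi, ← lintegral_indicator measurableSet_Ioi]
  have h3 : ∀ a : ℝ, (Set.Ioi (0 : ℝ)).indicator
      (fun a => ∫⁻ A, (Set.Ioi a).indicator (Φ a) A) a =
      ∫⁻ A, {p : ℝ × ℝ | 0 < p.1 ∧ p.1 < p.2}.indicator (Function.uncurry Φ) (a, A) := by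
    intro a
    simp_rw [← h2]
    by_cases ha : 0 < a <;> simp [ha, Set.indicator]
  simp_rw [h3]
  rw [lintegral_lintegral_swap (f := fun a A =>
    {p : ℝ × ℝ | 0 < p.1 ∧ p.1 < p.2}.indicator (Function.uncurry Φ) (a, A))
    (hΦ.indicator hset).aemeasurable]
  refine lintegral_congr fun A => ?_
  by_cases hA : 0 < A
  · rw [Set.indicator_of_mem (show A ∈ Set.Ioi (0 : ℝ) from hA),
      ← lintegral_indicator measurableSet_Ioo]
    refine lintegral_congr fun a => ?_
    by_cases h : 0 < a ∧ a < A <;> simp [h, Set.indicator]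
  · rw [Set.indicator_of_notMem (show A ∉ Set.Ioi (0 : ℝ) from hA)]
    have : ∀ a : ℝ, ¬ (0 < a ∧ a < A) := fun a h => hA (h.1.trans h.2)
    simp [this, Set.indicator]

/-- The convolution of two Gaussian functions which occurs in the subordination formula. -/
theorem lintegral_mixture_mul_mixture {v a a' : ℝ} (hv : 0 < v) (ha : 0 < a) (ha' : 0 < a')
    (s t : EuclideanSpace ℝ (Fin d)) :
    ∫⁻ u, ENNReal.ofReal (v / √Real.pi * (a ^ ((1 / 2 : ℝ) - 1) *
        Real.exp (-(v ^ 2 * a) - ‖s - u‖ ^ 2 / 4 / a))) *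
      ENNReal.ofReal (v / √Real.pi * (a' ^ ((1 / 2 : ℝ) - 1) *
        Real.exp (-(v ^ 2 * a') - ‖t - u‖ ^ 2 / 4 / a'))) =
    ENNReal.ofReal (v ^ 2 / Real.pi * (4 * Real.pi) ^ ((d : ℝ) / 2) *
      ((a + a') ^ (-((d : ℝ) / 2)) *
        Real.exp (-(v ^ 2 * (a + a')) - ‖s - t‖ ^ 2 / 4 / (a + a')))) *
      ENNReal.ofReal ((a * (a + a' - a)) ^ (((d : ℝ) + 1) / 2 - 1)) := by
  have hgauss := lintegral_gaussian_mul_gaussian (p := 1 / (4 * a)) (q := 1 / (4 * a'))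
    (by positivity) (by positivity) s t
  have h1 : ∀ u : EuclideanSpace ℝ (Fin d), ENNReal.ofReal (v / √Real.pi *
        (a ^ ((1 / 2 : ℝ) - 1) * Real.exp (-(v ^ 2 * a) - ‖s - u‖ ^ 2 / 4 / a))) *
      ENNReal.ofReal (v / √Real.pi * (a' ^ ((1 / 2 : ℝ) - 1) *
        Real.exp (-(v ^ 2 * a') - ‖t - u‖ ^ 2 / 4 / a'))) =
      ENNReal.ofReal (v ^ 2 / Real.pi * (a * a') ^ ((1 / 2 : ℝ) - 1) *
        Real.exp (-(v ^ 2 * (a + a')))) *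
      ENNReal.ofReal (Real.exp (-(1 / (4 * a) * ‖s - u‖ ^ 2)) *
        Real.exp (-(1 / (4 * a') * ‖t - u‖ ^ 2))) := by
    intro u
    rw [← ENNReal.ofReal_mul (by positivity), ← ENNReal.ofReal_mul (by positivity)]
    congr 1
    rw [Real.mul_rpow ha.le ha'.le]
    have h2 : Real.exp (-(v ^ 2 * a) - ‖s - u‖ ^ 2 / 4 / a) *
        Real.exp (-(v ^ 2 * a') - ‖t - u‖ ^ 2 / 4 / a') = Real.exp (-(v ^ 2 * (a + a'))) *
        (Real.exp (-(1 / (4 * a) * ‖s - u‖ ^ 2)) *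
        Real.exp (-(1 / (4 * a') * ‖t - u‖ ^ 2))) := by
      rw [← Real.exp_add, ← Real.exp_add, ← Real.exp_add]
      congr 1
      field_simp
      ring
    have h3 : v / √Real.pi * (v / √Real.pi) = v ^ 2 / Real.pi := by
      rw [div_mul_div_comm, Real.mul_self_sqrt Real.pi_pos.le, sq]
    calc _ = (v / √Real.pi * (v / √Real.pi)) *
          (a ^ ((1 / 2 : ℝ) - 1) * a' ^ ((1 / 2 : ℝ) - 1)) *
          (Real.exp (-(v ^ 2 * a) - ‖s - u‖ ^ 2 / 4 / a) *
            Real.exp (-(v ^ 2 * a') - ‖t - u‖ ^ 2 / 4 / a')) := by ring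
      _ = _ := by rw [h2, h3]; ring
  simp_rw [h1]
  rw [lintegral_const_mul _ (by fun_prop), hgauss, add_sub_cancel_left,
    ← ENNReal.ofReal_mul (by positivity), ← ENNReal.ofReal_mul (by positivity)]
  congr 1
  have h4 : Real.pi / (1 / (4 * a) + 1 / (4 * a')) = 4 * Real.pi * ((a * a') * (a + a')⁻¹) := by
    field_simp
    ring
  have h5 : 1 / (4 * a) * (1 / (4 * a')) / (1 / (4 * a) + 1 / (4 * a')) * ‖s - t‖ ^ 2 =
      ‖s - t‖ ^ 2 / 4 / (a + a') := by
    field_simp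
    ring
  rw [h4, h5, Real.mul_rpow (x := 4 * Real.pi) (by positivity) (by positivity),
    Real.mul_rpow (x := a * a') (y := (a + a')⁻¹) (by positivity) (by positivity), Real.inv_rpow (by positivity),
    ← Real.rpow_neg (by positivity), sub_eq_add_neg (-(v ^ 2 * (a + a'))), Real.exp_add,
    show ((d : ℝ) + 1) / 2 - 1 = ((1 / 2 : ℝ) - 1) + d / 2 by ring,
    Real.rpow_add (show 0 < a * a' by positivity)]
  ring

/-- Write both exponentials as Gaussian mixtures. Integrating over `u` leaves a Gaussian in `s - t`
depending on `a` and `a'` through `A = a + a'`, and the remaining weight `(a (A - a))^((d+1)/2 - 1)`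
integrates to a beta function. -/
theorem lintegral_exp_mul_exp {v : ℝ} (hv : 0 < v) (s t : EuclideanSpace ℝ (Fin d)) :
    ∫⁻ u, ENNReal.ofReal (Real.exp (-(v * ‖s - u‖)) * Real.exp (-(v * ‖t - u‖))) =
      ENNReal.ofReal (v ^ 2 / Real.pi * (4 * Real.pi) ^ ((d : ℝ) / 2) *
        beta (((d : ℝ) + 1) / 2) (((d : ℝ) + 1) / 2)) *
      ∫⁻ A in Set.Ioi (0 : ℝ), ENNReal.ofReal (A ^ ((d : ℝ) / 2) *
        Real.exp (-(v ^ 2 * A) - ‖s - t‖ ^ 2 / 4 / A)) := by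
  set w : ℝ → ℝ → ℝ≥0∞ := fun r a => ENNReal.ofReal (v / √Real.pi * (a ^ ((1 / 2 : ℝ) - 1) *
        Real.exp (-(v ^ 2 * a) - r ^ 2 / 4 / a))) with hw
  have hwm : Measurable (Function.uncurry w) := by
    simp only [hw]; fun_prop
  have hwm1 : ∀ r, Measurable (w r) := fun r => hwm.comp measurable_prodMk_left
  have h1 : ∀ u, ENNReal.ofReal (Real.exp (-(v * ‖s - u‖)) * Real.exp (-(v * ‖t - u‖))) =
      ∫⁻ a in Set.Ioi (0 : ℝ), ∫⁻ a' in Set.Ioi (0 : ℝ), w ‖s - u‖ a * w ‖t - u‖ a' := by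
    intro u
    rw [ENNReal.ofReal_mul (by positivity), ← lintegral_subordination hv (norm_nonneg (s - u)),
      ← lintegral_subordination hv (norm_nonneg (t - u)),
      ← lintegral_mul_const _ (hwm1 _)]
    refine lintegral_congr fun a => ?_
    rw [← lintegral_const_mul _ (hwm1 _)]
  simp_rw [h1]
  have hm3 : Measurable fun p : (EuclideanSpace ℝ (Fin d) × ℝ) × ℝ =>
      w ‖s - p.1.1‖ p.1.2 * w ‖t - p.1.1‖ p.2 := by
    simp only [hw]; fun_prop
  rw [lintegral_lintegral_swap (Measurable.aemeasurable (hm3.lintegral_prod_right'))]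
  have h2 : ∀ a : ℝ, ∫⁻ u : EuclideanSpace ℝ (Fin d), ∫⁻ a' in Set.Ioi (0 : ℝ),
      w ‖s - u‖ a * w ‖t - u‖ a' = ∫⁻ a' in Set.Ioi (0 : ℝ), ∫⁻ u : EuclideanSpace ℝ (Fin d),
      w ‖s - u‖ a * w ‖t - u‖ a' := by
    intro a
    rw [lintegral_lintegral_swap]
    refine Measurable.aemeasurable ?_
    simp only [hw, Function.uncurry_def]; fun_prop
  simp_rw [h2]
  set E : ℝ → ℝ≥0∞ := fun A => ENNReal.ofReal (v ^ 2 / Real.pi * (4 * Real.pi) ^ ((d : ℝ) / 2) *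
      (A ^ (-((d : ℝ) / 2)) * Real.exp (-(v ^ 2 * A) - ‖s - t‖ ^ 2 / 4 / A))) with hE
  have hEm : Measurable E := by simp only [hE]; fun_prop
  have h3 : ∫⁻ a in Set.Ioi (0 : ℝ), ∫⁻ a' in Set.Ioi (0 : ℝ), ∫⁻ u : EuclideanSpace ℝ (Fin d),
      w ‖s - u‖ a * w ‖t - u‖ a' = ∫⁻ a in Set.Ioi (0 : ℝ), ∫⁻ a' in Set.Ioi (0 : ℝ),
      E (a + a') * ENNReal.ofReal ((a * (a + a' - a)) ^ (((d : ℝ) + 1) / 2 - 1)) :=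
    setLIntegral_congr_fun measurableSet_Ioi fun a ha =>
      setLIntegral_congr_fun measurableSet_Ioi fun a' ha' => lintegral_mixture_mul_mixture hv ha ha' s t
  rw [h3, lintegral_Ioi_Ioi_add
    (Φ := fun a A => E A * ENNReal.ofReal ((a * (A - a)) ^ (((d : ℝ) + 1) / 2 - 1)))
    (by simp only [Function.uncurry_def]; fun_prop), ← lintegral_const_mul _ (by fun_prop)]
  refine setLIntegral_congr_fun measurableSet_Ioi fun A hA => ?_
  have hA0 : 0 < A := hA
  have hb := beta_pos (α := ((d : ℝ) + 1) / 2) (β := ((d : ℝ) + 1) / 2) (by positivity)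
    (by positivity)
  rw [lintegral_const_mul _ (by fun_prop), lintegral_beta (by positivity) hA0,
    ← ENNReal.ofReal_mul (by positivity), ← ENNReal.ofReal_mul (by positivity)]
  congr 1
  have h4 : A ^ ((d : ℝ) / 2) = A ^ (-((d : ℝ) / 2)) * A ^ (2 * (((d : ℝ) + 1) / 2) - 1) := by
    rw [← Real.rpow_add hA0]; congr 1; ring
  rw [h4]; ring

/-- The integral representation of the covariance function for a fixed rate `v`. -/
theorem lintegral_kernel_mul_kernel (v : Set.Ioi (0 : ℝ)) (s t : EuclideanSpace ℝ (Fin d)) :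
    ∫⁻ u, ENNReal.ofReal (kernel s (v, u) * kernel t (v, u)) =
      ENNReal.ofReal ((4 * Real.pi) ^ ((d : ℝ) / 2) / (4 * Real.pi) *
        beta (((d : ℝ) + 1) / 2) (((d : ℝ) + 1) / 2)) *
      ∫⁻ A in Set.Ioi (0 : ℝ), ENNReal.ofReal (A ^ ((d : ℝ) / 2) *
        Real.exp (-((v : ℝ) ^ 2 * A) - ‖s - t‖ ^ 2 / 4 / A)) := by
  have hv : 0 < (v : ℝ) := v.2
  have hb := beta_pos (α := ((d : ℝ) + 1) / 2) (β := ((d : ℝ) + 1) / 2) (by positivity)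
    (by positivity)
  have h1 : ∀ u : EuclideanSpace ℝ (Fin d), ENNReal.ofReal (kernel s (v, u) * kernel t (v, u)) =
      ENNReal.ofReal (1 / (4 * (v : ℝ) ^ 2)) *
      ENNReal.ofReal (Real.exp (-((v : ℝ) * ‖s - u‖)) * Real.exp (-((v : ℝ) * ‖t - u‖))) := by
    intro u
    rw [← ENNReal.ofReal_mul (by positivity)]
    congr 1
    simp only [kernel, neg_mul]
    field_simp
    norm_num
  simp_rw [h1]
  rw [lintegral_const_mul _ (by fun_prop), lintegral_exp_mul_exp hv, ← mul_assoc,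
    ← ENNReal.ofReal_mul (by positivity)]
  congr 2
  field_simp

end Convolution

/-! ### Bounds for the Bessel function -/

section BesselBound

theorem setIntegral_Ioi_pos {f : ℝ → ℝ} (hi : IntegrableOn f (Set.Ioi 0))
    (hpos : ∀ v, 0 < v → 0 < f v) : 0 < ∫ v in Set.Ioi (0 : ℝ), f v := by
  rw [setIntegral_pos_iff_support_of_nonneg_ae
    ((ae_restrict_mem measurableSet_Ioi).mono fun v hv => (hpos v hv).le) hi]
  have : Set.Ioi (0 : ℝ) ⊆ Function.support f ∩ Set.Ioi 0 := fun v hv =>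
    ⟨(hpos v hv).ne', hv⟩
  refine lt_of_lt_of_le ?_ (measure_mono this)
  simp

/-- Combine `cosh s ≥ exp s / 2` with `exp y ≥ (y / m)^m`. -/
theorem besselK_integrand_le {ν m x s : ℝ} (hν : 0 < ν) (hm : ν < m) (hx : 0 < x) (hs : 0 < s) :
    ‖Real.exp (-x * Real.cosh s) * Real.cosh (ν * s)‖ ≤
      (2 * m) ^ m * x ^ (-m) * Real.exp (-(m - ν) * s) := by
  have hm0 : 0 < m := hν.trans hm
  have hc := Real.cosh_pos s
  have hc2 := Real.cosh_pos (ν * s)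
  have h1 : Real.cosh (ν * s) ≤ Real.exp (ν * s) := by
    rw [Real.cosh_eq]
    have : Real.exp (-(ν * s)) ≤ Real.exp (ν * s) := Real.exp_le_exp.2 (by nlinarith)
    linarith
  have h2 : Real.exp s / 2 ≤ Real.cosh s := by
    rw [Real.cosh_eq]
    have := Real.exp_pos (-s)
    linarith
  have h3 : (x * Real.exp s / (2 * m)) ^ m ≤ Real.exp (x * Real.cosh s) := by
    calc (x * Real.exp s / (2 * m)) ^ m ≤ (Real.exp (x * Real.cosh s / m)) ^ m := by
          gcongr
          have h4 := Real.add_one_le_exp (x * Real.cosh s / m)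
          have h5 : x * Real.exp s / (2 * m) ≤ x * Real.cosh s / m := by
            rw [show x * Real.exp s / (2 * m) = x * (Real.exp s / 2) / m by field_simp]
            gcongr
          linarith
      _ = Real.exp (x * Real.cosh s) := by
          rw [← Real.exp_mul]; congr 1; field_simp
  have h6 : Real.exp (-x * Real.cosh s) ≤ (2 * m) ^ m * x ^ (-m) * Real.exp (-(m * s)) := by
    rw [neg_mul, Real.exp_neg, inv_le_comm₀ (Real.exp_pos _) (by positivity)]
    refine le_of_eq_of_le ?_ h3
    rw [Real.div_rpow (by positivity) (by positivity), Real.mul_rpow hx.le (Real.exp_pos _).le,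
      ← Real.exp_mul, Real.rpow_neg hx.le, Real.exp_neg, mul_comm s m]
    field_simp
  rw [Real.norm_of_nonneg (by positivity)]
  calc _ ≤ (2 * m) ^ m * x ^ (-m) * Real.exp (-(m * s)) * Real.exp (ν * s) := by gcongr
    _ = _ := by rw [mul_assoc, ← Real.exp_add]; ring_nf

theorem integrableOn_besselK {ν x : ℝ} (hν : 0 < ν) (hx : 0 < x) :
    IntegrableOn (fun s => Real.exp (-x * Real.cosh s) * Real.cosh (ν * s)) (Set.Ioi 0) := by
  refine Integrable.mono' (g := fun s => (2 * (ν + 1)) ^ (ν + 1) * x ^ (-(ν + 1)) *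
    Real.exp (-(ν + 1 - ν) * s)) ?_ (by fun_prop)
    ((ae_restrict_mem measurableSet_Ioi).mono fun s hs =>
      besselK_integrand_le hν (lt_add_one ν) hx hs)
  exact (exp_neg_integrableOn_Ioi 0 (by linarith)).const_mul _

theorem besselK_pos {ν x : ℝ} (hν : 0 < ν) (hx : 0 < x) : 0 < besselK ν x :=
  setIntegral_Ioi_pos (integrableOn_besselK hν hx) fun s _ => by
    have := Real.cosh_pos (ν * s)
    positivity

/-- As `m > ν` is free, different choices serve near the origin and at infinity. -/
theorem besselK_le {ν m : ℝ} (hν : 0 < ν) (hm : ν < m) :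
    ∃ C : ℝ, 0 ≤ C ∧ ∀ x, 0 < x → besselK ν x ≤ C * x ^ (-m) := by
  have hi : IntegrableOn (fun s => Real.exp (-(m - ν) * s)) (Set.Ioi 0) :=
    exp_neg_integrableOn_Ioi 0 (by linarith)
  have hm0 : 0 < m := hν.trans hm
  refine ⟨(2 * m) ^ m * ∫ s in Set.Ioi (0 : ℝ), Real.exp (-(m - ν) * s),
    mul_nonneg (by positivity) (integral_nonneg fun s => (Real.exp_pos _).le), fun x hx => ?_⟩
  have h1 := norm_integral_le_of_norm_le (hi.const_mul ((2 * m) ^ m * x ^ (-m)))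
    ((ae_restrict_mem measurableSet_Ioi).mono fun s hs => besselK_integrand_le hν hm hx hs)
  rw [integral_const_mul] at h1
  refine ((le_abs_self _).trans h1).trans (le_of_eq ?_)
  ring

theorem measurable_besselK (ν : ℝ) : Measurable (besselK ν) := by
  unfold besselK
  refine (StronglyMeasurable.integral_prod_right (f := fun x s : ℝ =>
    Real.exp (-x * Real.cosh s) * Real.cosh (ν * s)) ?_).measurable
  exact Continuous.stronglyMeasurable (by fun_prop)

end BesselBound

/-! ### Constants -/

section Constants

/-- Legendre's duplication formula shows that the two parity cases in `c1` are the same expression.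
-/
theorem c1_sq {d : ℕ} (hd : 1 ≤ d) :
    c1 d ^ 2 = (2 : ℝ) ^ ((d : ℝ) - 2) * Real.Gamma (((d : ℝ) + 1) / 2) ^ 2 / Real.pi := by
  have hd0 : (0 : ℝ) < d := by exact_mod_cast hd
  have h2 : ((2 : ℝ) ^ ((d : ℝ) / 2 - 1)) ^ 2 = (2 : ℝ) ^ ((d : ℝ) - 2) := by
    rw [← Real.rpow_mul_natCast two_pos.le]; congr 1; push_cast; ring
  have key : c1 d = -(2 : ℝ) ^ ((d : ℝ) / 2 - 1) * Real.Gamma (((d : ℝ) + 1) / 2) / √Real.pi := by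
    unfold c1
    split_ifs with h
    · rfl
    · have h3 := Real.Gamma_mul_Gamma_add_half ((d : ℝ) / 2)
      rw [show (d : ℝ) / 2 + 1 / 2 = ((d : ℝ) + 1) / 2 by ring, mul_div_cancel₀ _ two_ne_zero] at h3
      have hG : 0 < Real.Gamma ((d : ℝ) / 2) := Real.Gamma_pos_of_pos (by positivity)
      have hpi : 0 < √Real.pi := Real.sqrt_pos.2 Real.pi_pos
      rw [div_eq_div_iff hG.ne' hpi.ne']
      have h4 : (2 : ℝ) ^ ((d : ℝ) / 2 - 1) * (2 : ℝ) ^ (1 - (d : ℝ)) = 2 ^ (-((d : ℝ) / 2)) := by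
        rw [← Real.rpow_add two_pos]; congr 1; ring
      calc _ = -((2 : ℝ) ^ (-((d : ℝ) / 2)) * Real.Gamma d * √Real.pi) := by ring
        _ = -((2 : ℝ) ^ ((d : ℝ) / 2 - 1) * (Real.Gamma d * 2 ^ (1 - (d : ℝ)) * √Real.pi)) := by
          rw [← h4]; ring
        _ = _ := by rw [← h3]; ring
  rw [key, div_pow, Real.sq_sqrt Real.pi_pos.le, mul_pow, neg_sq, h2]

/-- The constant in the representation of the covariance function. -/
def kernelConst (d : ℕ) : ℝ :=
  (4 * Real.pi) ^ ((d : ℝ) / 2) / (4 * Real.pi) * beta (((d : ℝ) + 1) / 2) (((d : ℝ) + 1) / 2)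

theorem kernelConst_pos (d : ℕ) : 0 < kernelConst d := by
  have hb := beta_pos (α := ((d : ℝ) + 1) / 2) (β := ((d : ℝ) + 1) / 2) (by positivity)
    (by positivity)
  unfold kernelConst
  positivity

theorem kernelConst_mul_Gamma {d : ℕ} (hd : 1 ≤ d) :
    kernelConst d * Real.Gamma ((d : ℝ) + 1) = c1 d ^ 2 * Real.pi ^ ((d : ℝ) / 2) := by
  have hG : 0 < Real.Gamma ((d : ℝ) + 1) := Real.Gamma_pos_of_pos (by positivity)
  have h4 : (4 : ℝ) ^ ((d : ℝ) / 2) = 2 ^ ((d : ℝ) - 2) * 4 := by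
    rw [show (4 : ℝ) = 2 ^ (2 : ℝ) by norm_num, ← Real.rpow_mul two_pos.le,
      ← Real.rpow_add two_pos]
    congr 1; ring
  rw [c1_sq hd, kernelConst, beta, Real.mul_rpow (by norm_num) Real.pi_pos.le, h4,
    show ((d : ℝ) + 1) / 2 + ((d : ℝ) + 1) / 2 = d + 1 by ring]
  field_simp

theorem kernelConst_mul_rpow {d : ℕ} (hd : 1 ≤ d) :
    kernelConst d * 2 ^ (-((d : ℝ) / 2)) = c2 d := by
  have hG : 0 < Real.Gamma ((d : ℝ) + 1) := Real.Gamma_pos_of_pos (by positivity)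
  have h := kernelConst_mul_Gamma hd
  rw [c2, Real.div_rpow Real.pi_pos.le two_pos.le, Real.rpow_neg two_pos.le]
  have : kernelConst d = c1 d ^ 2 * Real.pi ^ ((d : ℝ) / 2) / Real.Gamma ((d : ℝ) + 1) := by
    rw [← h]; field_simp
  rw [this]; field_simp

theorem c1_ne_zero {d : ℕ} (hd : 1 ≤ d) : c1 d ≠ 0 := by
  have h := kernelConst_mul_Gamma hd
  have hG : 0 < Real.Gamma ((d : ℝ) + 1) := Real.Gamma_pos_of_pos (by positivity)
  have := mul_pos (kernelConst_pos d) hG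
  intro h0
  rw [h, h0] at this
  simp at this

end Constants

/-! ### Representation of the covariance function -/

section Covariance

variable {Ω : Type*} [MeasurableSpace Ω] {P : Measure Ω} {d : ℕ}
  {b : ℝ} {W : Measure ℝ} {π : Measure (Set.Ioi (0 : ℝ))} {S : Set (Set (Param d))}
  {Λ : Set (Param d) → Ω → ℝ} {X : EuclideanSpace ℝ (Fin d) → Ω → ℝ}

theorem lintegral_kernel_prod (s t : EuclideanSpace ℝ (Fin d)) :
    ∫⁻ p, ENNReal.ofReal (kernel s p * kernel t p) ∂(π.prod volume) =
      ENNReal.ofReal (kernelConst d) * ∫⁻ v, (∫⁻ A in Set.Ioi (0 : ℝ),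
        ENNReal.ofReal (A ^ ((d : ℝ) / 2) *
          Real.exp (-((v : ℝ) ^ 2 * A) - ‖s - t‖ ^ 2 / 4 / A))) ∂π := by
  have hs := measurable_kernel s
  have ht := measurable_kernel t
  rw [lintegral_prod _ (by fun_prop)]
  simp_rw [lintegral_kernel_mul_kernel]
  rw [lintegral_const_mul]
  · rfl
  · refine Measurable.lintegral_prod_right' (f := fun p : Set.Ioi (0 : ℝ) × ℝ =>
      ENNReal.ofReal (p.2 ^ ((d : ℝ) / 2) *
          Real.exp (-((p.1 : ℝ) ^ 2 * p.2) - ‖s - t‖ ^ 2 / 4 / p.2))) ?_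
    fun_prop

theorem IsSupCARField.covariance_eq_lintegral [IsProbabilityMeasure P] (hW : IsLevyMeasure W)
    (hb : 0 ≤ b) (hX : IsSupCARField P S Λ b W π X) (hmom : ∀ t, MemLp (X t) 2 P)
    (hmean : ∀ t, ∫ ω, X t ω ∂P = 0) (s t : EuclideanSpace ℝ (Fin d)) :
    covariance (X s) (X t) P = (levyVar b W).toReal * (kernelConst d *
      (∫⁻ v, (∫⁻ A in Set.Ioi (0 : ℝ), ENNReal.ofReal (A ^ ((d : ℝ) / 2) *
          Real.exp (-((v : ℝ) ^ 2 * A) - ‖s - t‖ ^ 2 / 4 / A))) ∂π).toReal) := by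
  rw [hX.covariance_eq hW hb hmom hmean, lintegral_kernel_prod, ENNReal.toReal_mul,
    ENNReal.toReal_mul, ENNReal.toReal_ofReal (kernelConst_pos d).le]

/-- If this integral were infinite, a positive variance factor would make the second moment of `X 0`
infinite. -/
theorem IsSupCARField.lintegral_lt_top [IsProbabilityMeasure P] (hW : IsLevyMeasure W)
    (hb : 0 ≤ b) (hX : IsSupCARField P S Λ b W π X) (hmom : ∀ t, MemLp (X t) 2 P)
    (hmean : ∀ t, ∫ ω, X t ω ∂P = 0) (h0 : 0 < levyVar b W) :
    ∫⁻ v, (∫⁻ A in Set.Ioi (0 : ℝ), ENNReal.ofReal (A ^ ((d : ℝ) / 2) *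
          Real.exp (-((v : ℝ) ^ 2 * A)))) ∂π < ∞ := by
  have h1 := hX.second_moment hW hb hmom hmean 0
  simp_rw [sq (kernel _ _)] at h1
  rw [lintegral_kernel_prod] at h1
  simp only [sub_self, norm_zero, ne_eq, OfNat.ofNat_ne_zero, not_false_eq_true, zero_pow,
    zero_div, sub_zero] at h1
  rw [lt_top_iff_ne_top]
  intro htop
  rw [htop, ENNReal.mul_top (ENNReal.ofReal_pos.2 (kernelConst_pos d)).ne',
    ENNReal.mul_top h0.ne'] at h1
  exact ENNReal.ofReal_ne_top h1

theorem lintegral_eq_besselK {v R : ℝ} (hv : 0 < v) (hR : 0 < R) :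
    ∫⁻ A in Set.Ioi (0 : ℝ), ENNReal.ofReal (A ^ ((d : ℝ) / 2) *
      Real.exp (-(v ^ 2 * A) - R ^ 2 / 4 / A)) =
    ENNReal.ofReal (2 ^ (-((d : ℝ) / 2)) * R ^ ((d : ℝ) + 2) *
      ((v * R) ^ (-((d : ℝ) / 2 + 1)) * besselK ((d : ℝ) / 2 + 1) (v * R))) := by
  have hi := integrableOn_rpow_mul_exp (ν := (d : ℝ) / 2 + 1) (p := v ^ 2) (q := R ^ 2 / 4)
    (by positivity) (by positivity) (by positivity)
  have h := integral_rpow_mul_exp_eq_besselK (ν := (d : ℝ) / 2 + 1) (by positivity) hv hR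
  simp only [add_sub_cancel_right] at hi h
  rw [← ofReal_integral_eq_lintegral_ofReal hi
    ((ae_restrict_mem measurableSet_Ioi).mono fun A hA => by
      have : 0 < A := hA
      simp only [Pi.zero_apply]
      positivity), h]
  congr 1
  rw [← mul_assoc]
  congr 1
  have h2 : (2 : ℝ) ^ ((d : ℝ) / 2 + 1) = 2 ^ ((d : ℝ) / 2) * 2 := by
    rw [Real.rpow_add two_pos, Real.rpow_one]
  have h3 : R ^ ((d : ℝ) + 2) = R ^ ((d : ℝ) / 2 + 1) * R ^ ((d : ℝ) / 2 + 1) := by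
    rw [← Real.rpow_add hR]; ring_nf
  rw [Real.div_rpow hR.le (by positivity), Real.mul_rpow two_pos.le hv.le,
    Real.rpow_neg (by positivity : 0 ≤ v * R), Real.mul_rpow hv.le hR.le, h3,
    Real.rpow_neg two_pos.le, h2]
  field_simp

end Covariance

/-! ### Regularly varying densities -/

section Density

/-- Slow variation constrains `l` on `(0, ∞)` only, so `l` itself may fail to be measurable on `ℝ`.
-/
theorem IsSlowlyVarying.exists_measurable_extension {l : ℝ → ℝ} (hl : IsSlowlyVarying l) :
    ∃ L : ℝ → ℝ, Measurable L ∧ ∀ x, 0 < x → L x = l x := by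
  classical
  refine ⟨fun x => if h : x ∈ Set.Ioi (0 : ℝ) then l x else 0, ?_, fun x hx => ?_⟩
  · exact Measurable.dite (f := fun x : Set.Ioi (0 : ℝ) => l x) (g := fun _ => 0) hl.measurable
      measurable_const measurableSet_Ioi
  · simp [hx]

variable {π : Measure (Set.Ioi (0 : ℝ))} {L l : ℝ → ℝ} {α : ℝ}

theorem lintegral_withDensity_comap (hLm : Measurable L) (hLl : ∀ x, 0 < x → L x = l x)
    (hπ : π = (Measure.comap Subtype.val volume).withDensity
      (fun v : Set.Ioi (0 : ℝ) => ENNReal.ofReal (l (1 / (v : ℝ)) * (v : ℝ) ^ (α - 1))))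
    {g : ℝ → ℝ≥0∞} (hg : Measurable g) :
    ∫⁻ v, g (v : ℝ) ∂π =
      ∫⁻ v in Set.Ioi (0 : ℝ), ENNReal.ofReal (L (1 / v) * v ^ (α - 1)) * g v := by
  have h1 : (fun v : Set.Ioi (0 : ℝ) => ENNReal.ofReal (l (1 / (v : ℝ)) * (v : ℝ) ^ (α - 1))) =
      fun v : Set.Ioi (0 : ℝ) => ENNReal.ofReal (L (1 / (v : ℝ)) * (v : ℝ) ^ (α - 1)) := by
    funext v
    rw [hLl _ (one_div_pos.2 v.2)]
  rw [hπ, h1, lintegral_withDensity_eq_lintegral_mul _ (by fun_prop) (by fun_prop)]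
  exact lintegral_subtype_comap measurableSet_Ioi
    (fun v => ENNReal.ofReal (L (1 / v) * v ^ (α - 1)) * g v)

theorem integrableOn_density [IsProbabilityMeasure π] (hLm : Measurable L)
    (hLpos : ∀ x, 0 < x → 0 < L x) (hLl : ∀ x, 0 < x → L x = l x)
    (hπ : π = (Measure.comap Subtype.val volume).withDensity
      (fun v : Set.Ioi (0 : ℝ) => ENNReal.ofReal (l (1 / (v : ℝ)) * (v : ℝ) ^ (α - 1)))) :
    IntegrableOn (fun v => L (1 / v) * v ^ (α - 1)) (Set.Ioi 0) := by
  refine ⟨by fun_prop, ?_⟩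
  rw [hasFiniteIntegral_iff_ofReal ((ae_restrict_mem measurableSet_Ioi).mono fun v hv => by
    have hv0 : 0 < v := hv
    have := hLpos (1 / v) (by positivity)
    simp only [Pi.zero_apply]
    positivity)]
  have := lintegral_withDensity_comap hLm hLl hπ (g := fun _ => 1) measurable_const
  simp only [mul_one, lintegral_one, measure_univ] at this
  rw [← this]
  exact ENNReal.one_lt_top

/-- The Abelian theorem for a measure with a regularly varying density. -/
theorem tendsto_lintegral_scaled [IsProbabilityMeasure π] (hLm : Measurable L)
    (hLpos : ∀ x, 0 < x → 0 < L x)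
    (hL : ∀ c : ℝ, 0 < c → Tendsto (fun x => L (c * x) / L x) atTop (𝓝 1))
    (hLl : ∀ x, 0 < x → L x = l x)
    (hπ : π = (Measure.comap Subtype.val volume).withDensity
      (fun v : Set.Ioi (0 : ℝ) => ENNReal.ofReal (l (1 / (v : ℝ)) * (v : ℝ) ^ (α - 1))))
    {h : ℝ → ℝ} {C β γ : ℝ} (hm : Measurable h)
    (h0 : ∀ v, 0 < v → 0 ≤ h v) (hγ : ∀ v, 0 < v → h v ≤ C * v ^ (-γ))
    (hβ : ∀ v, 0 < v → h v ≤ C * v ^ (-β)) (hα : 0 < α) (hγα : γ < α) (hαβ : α < β) :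
    Tendsto (fun R => (∫⁻ v, ENNReal.ofReal (h (v * R)) ∂π).toReal / (L R * R ^ (-α))) atTop
      (𝓝 (∫ v in Set.Ioi (0 : ℝ), v ^ (α - 1) * h v)) := by
  refine (tendsto_mellin_convolution hLm hLpos hL hm h0 hγ hβ hα hγα hαβ
    (integrableOn_density hLm hLpos hLl hπ)).congr' ?_
  filter_upwards [eventually_gt_atTop 0] with R hR
  congr 1
  rw [lintegral_withDensity_comap hLm hLl hπ (g := fun v => ENNReal.ofReal (h (v * R)))
    (by fun_prop), integral_eq_lintegral_of_nonneg_ae _ (by fun_prop)]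
  · congr 1
    refine setLIntegral_congr_fun measurableSet_Ioi fun v hv => ?_
    have hv0 : 0 < v := hv
    have := hLpos (1 / v) (by positivity)
    rw [ENNReal.ofReal_mul (by positivity)]
  · refine (ae_restrict_mem measurableSet_Ioi).mono fun v hv => ?_
    have hv0 : 0 < v := hv
    have := hLpos (1 / v) (by positivity)
    have := h0 (v * R) (by positivity)
    simp only [Pi.zero_apply]
    positivity

end Density

/-! ### Asymptotics of the covariance function -/

section CovarianceAsymptotics

variable {Ω : Type*} [MeasurableSpace Ω] {P : Measure Ω} {d : ℕ}
  {b : ℝ} {W : Measure ℝ} {π : Measure (Set.Ioi (0 : ℝ))} {S : Set (Set (Param d))}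
  {Λ : Set (Param d) → Ω → ℝ} {X : EuclideanSpace ℝ (Fin d) → Ω → ℝ} {L l : ℝ → ℝ} {α : ℝ}

/-- The bounds `K_ν ≤ C x^(-m)` with `m = α/2` and `m = α` give `γ = ν + α/2` and `β = ν + α`. Both
`m > ν` and `γ < α` rest on `2ν < α`, which for `ν = d/2 + 1` reads `α > d + 2`. -/
theorem exists_bessel_bound {ν α : ℝ} (hν : 0 < ν) (hα : 2 * ν < α) :
    ∃ C γ β : ℝ, γ < α ∧ α < β ∧ ∀ v : ℝ, 0 < v →
      v ^ (-ν) * besselK ν v ≤ C * v ^ (-γ) ∧ v ^ (-ν) * besselK ν v ≤ C * v ^ (-β) := by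
  obtain ⟨C₁, hC₁, h₁⟩ := besselK_le hν (m := α / 2) (by linarith)
  obtain ⟨C₂, hC₂, h₂⟩ := besselK_le hν (m := α) (by linarith)
  refine ⟨max C₁ C₂, ν + α / 2, ν + α, by linarith, by linarith, fun v hv => ⟨?_, ?_⟩⟩
  · rw [neg_add, Real.rpow_add hv, mul_left_comm]
    refine mul_le_mul_of_nonneg_left ((h₁ v hv).trans ?_) (by positivity)
    gcongr
    exact le_max_left _ _
  · rw [neg_add, Real.rpow_add hv, mul_left_comm]
    refine mul_le_mul_of_nonneg_left ((h₂ v hv).trans ?_) (by positivity)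
    gcongr
    exact le_max_right _ _

theorem besselK_mellin_eq (d : ℕ) (α : ℝ) :
    ∫ v in Set.Ioi (0 : ℝ), v ^ (α - (d : ℝ) / 2 - 2) * besselK ((d : ℝ) / 2 + 1) v =
      ∫ v in Set.Ioi (0 : ℝ), v ^ (α - 1) *
        (v ^ (-((d : ℝ) / 2 + 1)) * besselK ((d : ℝ) / 2 + 1) v) := by
  refine setIntegral_congr_fun measurableSet_Ioi fun v hv => ?_
  have hv0 : 0 < v := hv
  rw [← mul_assoc, ← Real.rpow_add hv0]
  congr 2
  ring

theorem besselK_mellin_pos (hα : (d : ℝ) + 2 < α) :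
    0 < ∫ v in Set.Ioi (0 : ℝ), v ^ (α - 1) *
        (v ^ (-((d : ℝ) / 2 + 1)) * besselK ((d : ℝ) / 2 + 1) v) := by
  have hν : 0 < (d : ℝ) / 2 + 1 := by positivity
  obtain ⟨C, γ, β, hγ, hβ, hC⟩ := exists_bessel_bound (α := α) hν (by linarith)
  have hm := measurable_besselK ((d : ℝ) / 2 + 1)
  refine setIntegral_Ioi_pos (integrableOn_rpow_mul (by fun_prop) (fun v hv => ?_)
    (fun v hv => (hC v hv).1) (fun v hv => (hC v hv).2) hγ hβ) fun v hv => ?_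
  · have := besselK_pos hν hv
    positivity
  · have := besselK_pos hν hv
    positivity

theorem IsSupCARField.covariance_eq_norm [IsProbabilityMeasure P] (hW : IsLevyMeasure W)
    (hb : 0 ≤ b) (hX : IsSupCARField P S Λ b W π X) (hmom : ∀ t, MemLp (X t) 2 P)
    (hmean : ∀ t, ∫ ω, X t ω ∂P = 0) (hd : 1 ≤ d) {s t : EuclideanSpace ℝ (Fin d)}
    (hst : s ≠ t) :
    covariance (X s) (X t) P = (levyVar b W).toReal * c2 d * ‖s - t‖ ^ ((d : ℝ) + 2) *
      (∫⁻ v, ENNReal.ofReal (((v : ℝ) * ‖s - t‖) ^ (-((d : ℝ) / 2 + 1)) *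
        besselK ((d : ℝ) / 2 + 1) ((v : ℝ) * ‖s - t‖)) ∂π).toReal := by
  have hR : 0 < ‖s - t‖ := norm_pos_iff.2 (sub_ne_zero.2 hst)
  rw [hX.covariance_eq_lintegral hW hb hmom hmean]
  have h1 : ∀ v : Set.Ioi (0 : ℝ), ∫⁻ A in Set.Ioi (0 : ℝ), ENNReal.ofReal (A ^ ((d : ℝ) / 2) *
      Real.exp (-((v : ℝ) ^ 2 * A) - ‖s - t‖ ^ 2 / 4 / A)) =
      ENNReal.ofReal (2 ^ (-((d : ℝ) / 2)) * ‖s - t‖ ^ ((d : ℝ) + 2)) *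
      ENNReal.ofReal (((v : ℝ) * ‖s - t‖) ^ (-((d : ℝ) / 2 + 1)) *
        besselK ((d : ℝ) / 2 + 1) ((v : ℝ) * ‖s - t‖)) := by
    intro v
    rw [lintegral_eq_besselK v.2 hR, ENNReal.ofReal_mul (by positivity)]
  have hm := measurable_besselK ((d : ℝ) / 2 + 1)
  simp_rw [h1]
  rw [lintegral_const_mul _ (by fun_prop), ENNReal.toReal_mul,
    ENNReal.toReal_ofReal (by positivity), ← kernelConst_mul_rpow hd]
  ring

theorem IsSupCARField.covFun_isEquivalent [IsProbabilityMeasure P] [IsProbabilityMeasure π]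
    (hW : IsLevyMeasure W)
    (hb : 0 ≤ b) (hX : IsSupCARField P S Λ b W π X) (hmom : ∀ t, MemLp (X t) 2 P)
    (hmean : ∀ t, ∫ ω, X t ω ∂P = 0) (hd : 1 ≤ d) (hα : (d : ℝ) + 2 < α)
    (hLm : Measurable L) (hLpos : ∀ x, 0 < x → 0 < L x)
    (hL : ∀ c : ℝ, 0 < c → Tendsto (fun x => L (c * x) / L x) atTop (𝓝 1))
    (hLl : ∀ x, 0 < x → L x = l x)
    (hπ : π = (Measure.comap Subtype.val volume).withDensity
      (fun v : Set.Ioi (0 : ℝ) => ENNReal.ofReal (l (1 / (v : ℝ)) * (v : ℝ) ^ (α - 1)))) :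
    covFun P X ~[comap norm atTop]
      (fun t => c3 d α (-(levyVar b W).toReal) * (l ‖t‖ / ‖t‖ ^ (α - d - 2))) := by
  have hν : 0 < (d : ℝ) / 2 + 1 := by positivity
  have hm := measurable_besselK ((d : ℝ) / 2 + 1)
  set I := ∫ v in Set.Ioi (0 : ℝ), v ^ (α - 1) *
        (v ^ (-((d : ℝ) / 2 + 1)) * besselK ((d : ℝ) / 2 + 1) v) with hI
  have hI0 : 0 < I := besselK_mellin_pos hα
  obtain ⟨C, γ, β, hγ, hβ, hC⟩ := exists_bessel_bound (α := α) hν (by linarith)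
  have hlim := tendsto_lintegral_scaled hLm hLpos hL hLl hπ
    (h := fun v => v ^ (-((d : ℝ) / 2 + 1)) * besselK ((d : ℝ) / 2 + 1) v)
    (by fun_prop) (fun v hv => by have := besselK_pos hν hv; positivity)
    (fun v hv => (hC v hv).1) (fun v hv => (hC v hv).2) (by linarith [d.cast_nonneg (α := ℝ)]) hγ hβ
  rw [← hI] at hlim
  have hc3 : c3 d α (-(levyVar b W).toReal) = (levyVar b W).toReal * c2 d * I := by
    rw [c3, besselK_mellin_eq, hI]; ring
  have hpos : ∀ᶠ t : EuclideanSpace ℝ (Fin d) in comap norm atTop, 0 < ‖t‖ :=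
    tendsto_comap.eventually (eventually_gt_atTop 0)
  -- With zero variance both sides vanish identically, and the quotient criterion used below is not
  -- available.
  rcases eq_or_ne (levyVar b W).toReal 0 with h0 | h0
  · have h1 : covFun P X = fun _ => 0 := by
      funext t
      rw [covFun, hX.covariance_eq_lintegral hW hb hmom hmean, h0, zero_mul]
    rw [hc3, h1, h0]
    simp only [zero_mul]
    exact IsEquivalent.refl
  have hc2 : c2 d ≠ 0 := by
    rw [← kernelConst_mul_rpow hd]
    have := kernelConst_pos d
    positivity
  refine isEquivalent_of_tendsto_one ?_
  have h2 := (hlim.comp (tendsto_comap (f := (norm : EuclideanSpace ℝ (Fin d) → ℝ)))).div_const I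
  rw [div_self hI0.ne'] at h2
  refine h2.congr' ?_
  filter_upwards [hpos] with t ht
  have hL0 := hLpos _ ht
  have h3 : ‖t‖ ^ (α - d - 2) = ‖t‖ ^ α / ‖t‖ ^ ((d : ℝ) + 2) := by
    rw [← Real.rpow_sub ht]; ring_nf
  have h4 : (0 : EuclideanSpace ℝ (Fin d)) ≠ t := fun h => by simp [← h] at ht
  simp only [Function.comp_apply, Pi.div_apply]
  rw [covFun, hX.covariance_eq_norm hW hb hmom hmean hd h4, zero_sub, norm_neg, hc3, h3,
    ← hLl _ ht, Real.rpow_neg ht.le]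
  have h5 : 0 < ‖t‖ ^ α := by positivity
  have h6 : 0 < ‖t‖ ^ ((d : ℝ) + 2) := by positivity
  generalize (levyVar b W).toReal = σ at h0 ⊢
  generalize ENNReal.toReal _ = J
  field_simp

theorem IsSupCARField.covariance_add_eq [IsProbabilityMeasure P] (hW : IsLevyMeasure W)
    (hb : 0 ≤ b) (hX : IsSupCARField P S Λ b W π X) (hmom : ∀ t, MemLp (X t) 2 P)
    (hmean : ∀ t, ∫ ω, X t ω ∂P = 0) (s t : EuclideanSpace ℝ (Fin d)) :
    covariance (X s) (X (s + t)) P = covFun P X t := by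
  rw [covFun, hX.covariance_eq_lintegral hW hb hmom hmean,
    hX.covariance_eq_lintegral hW hb hmom hmean]
  simp

end CovarianceAsymptotics

/-! ### The spectral density -/

section Spectral

variable {Ω : Type*} [MeasurableSpace Ω] {P : Measure Ω} {d : ℕ}
  {b : ℝ} {W : Measure ℝ} {π : Measure (Set.Ioi (0 : ℝ))} {S : Set (Set (Param d))}
  {Λ : Set (Param d) → Ω → ℝ} {X : EuclideanSpace ℝ (Fin d) → Ω → ℝ} {L l : ℝ → ℝ} {α : ℝ}

/-- The spectral density of a supCAR field with variance parameter `σ`. -/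
def spectralDensity (d : ℕ) (σ : ℝ) (π : Measure (Set.Ioi (0 : ℝ)))
    (w : EuclideanSpace ℝ (Fin d)) : ℝ :=
  σ * c1 d ^ 2 * ∫ v : Set.Ioi (0 : ℝ), (((v : ℝ) ^ 2 + ‖w‖ ^ 2) ^ (d + 1))⁻¹ ∂π

theorem spectralDensity_nonneg {σ : ℝ} (hσ : 0 ≤ σ) (w : EuclideanSpace ℝ (Fin d)) :
    0 ≤ spectralDensity d σ π w :=
  mul_nonneg (by positivity) (integral_nonneg fun v => by positivity)

/-- Near `w₀ ≠ 0` the integrand is bounded uniformly in `v`, because `‖w‖ > ‖w₀‖ / 2`. -/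
theorem continuousOn_spectralDensity [IsProbabilityMeasure π] (σ : ℝ) :
    ContinuousOn (spectralDensity d σ π) {0}ᶜ := by
  intro w₀ hw₀
  have hw : 0 < ‖w₀‖ := norm_pos_iff.2 hw₀
  refine ContinuousAt.continuousWithinAt (continuousAt_const.mul ?_)
  refine continuousAt_of_dominated (bound := fun _ => (((‖w₀‖ / 2) ^ 2) ^ (d + 1))⁻¹)
    (Eventually.of_forall fun w => Measurable.aestronglyMeasurable (by fun_prop)) ?_
    (integrable_const _) (ae_of_all _ fun v => ?_)
  · filter_upwards [continuous_norm.continuousAt.eventually (lt_mem_nhds (half_lt_self hw))]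
      with w hw'
    refine ae_of_all _ fun v => ?_
    rw [Real.norm_of_nonneg (by positivity)]
    gcongr
    nlinarith [sq_nonneg (v : ℝ)]
  · have hv : 0 < (v : ℝ) := v.2
    exact ContinuousAt.inv₀ (by fun_prop) (by positivity)

theorem integral_rpow_mul_exp_sum (d : ℕ) {c : ℝ} (hc : 0 < c) :
    ∫⁻ A in Set.Ioi (0 : ℝ), ENNReal.ofReal (A ^ (d : ℝ) * Real.exp (-(c * A))) =
      ENNReal.ofReal (Real.Gamma ((d : ℝ) + 1) * (c ^ (d + 1))⁻¹) := by
  have h := Real.integral_rpow_mul_exp_neg_mul_Ioi (a := (d : ℝ) + 1) (by positivity) hc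
  have hi := integrableOn_rpow_mul_exp (ν := (d : ℝ) + 1) (q := 0) (by positivity) hc le_rfl
  simp only [add_sub_cancel_right, zero_div, sub_zero] at h hi
  rw [← ofReal_integral_eq_lintegral_ofReal hi
    ((ae_restrict_mem measurableSet_Ioi).mono fun A hA => by
      have : 0 < A := hA
      simp only [Pi.zero_apply]
      positivity), h]
  congr 1
  rw [one_div, Real.inv_rpow hc.le, mul_comm, ← Nat.cast_add_one, Real.rpow_natCast]

theorem integral_gaussian_fourier {A : ℝ} (hA : 0 < A) (x : EuclideanSpace ℝ (Fin d)) :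
    ∫ w : EuclideanSpace ℝ (Fin d), Complex.exp (Complex.I * ((inner ℝ w x : ℝ) : ℂ)) *
      ((Real.exp (-(A * ‖w‖ ^ 2)) : ℝ) : ℂ) =
      (((Real.pi / A) ^ ((d : ℝ) / 2) * Real.exp (-(‖x‖ ^ 2 / 4 / A)) : ℝ) : ℂ) := by
  have h := GaussianFourier.integral_cexp_neg_mul_sq_norm_add (V := EuclideanSpace ℝ (Fin d))
    (b := (A : ℂ)) (by simpa using hA) Complex.I x
  rw [finrank_euclideanSpace_fin] at h
  calc _ = ∫ w : EuclideanSpace ℝ (Fin d),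
        Complex.exp (-(A : ℂ) * (‖w‖ : ℂ) ^ 2 + Complex.I * ((inner ℝ x w : ℝ) : ℂ)) := by
        refine integral_congr_ae (ae_of_all _ fun w => ?_)
        dsimp only
        rw [Complex.ofReal_exp, ← Complex.exp_add, real_inner_comm]
        congr 1
        push_cast
        ring
    _ = _ := by
        rw [h, Complex.ofReal_mul, Complex.ofReal_cpow (by positivity), Complex.ofReal_exp]
        push_cast
        rw [Complex.I_sq]
        congr 2
        field_simp

theorem lintegral_gaussian {A : ℝ} (hA : 0 < A) :
    ∫⁻ w : EuclideanSpace ℝ (Fin d), ENNReal.ofReal (Real.exp (-(A * ‖w‖ ^ 2))) =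
      ENNReal.ofReal ((Real.pi / A) ^ ((d : ℝ) / 2)) := by
  have h := GaussianFourier.integral_rexp_neg_mul_sq_norm (V := EuclideanSpace ℝ (Fin d)) hA
  rw [finrank_euclideanSpace_fin] at h
  have hi : Integrable fun u : EuclideanSpace ℝ (Fin d) => Real.exp (-A * ‖u‖ ^ 2) := by
    by_contra hc
    rw [integral_undef hc] at h
    have : 0 < (Real.pi / A) ^ ((d : ℝ) / 2) := by positivity
    linarith
  rw [← h, ofReal_integral_eq_lintegral_ofReal hi (ae_of_all _ fun u => (Real.exp_pos _).le)]
  simp only [neg_mul]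

/-- The function `A ^ d * exp (-A (v² + ‖w‖²))` which is integrated in the proof of the spectral
representation. -/
def spectralIntegrand (p : (Set.Ioi (0 : ℝ) × ℝ) × EuclideanSpace ℝ (Fin d)) : ℝ :=
  p.1.2 ^ (d : ℝ) * Real.exp (-(((p.1.1 : ℝ) ^ 2 + ‖p.2‖ ^ 2) * p.1.2))

theorem spectralIntegrand_eq (v : Set.Ioi (0 : ℝ)) (A : ℝ) (w : EuclideanSpace ℝ (Fin d)) :
    spectralIntegrand ((v, A), w) =
      A ^ (d : ℝ) * Real.exp (-((v : ℝ) ^ 2 * A)) * Real.exp (-(A * ‖w‖ ^ 2)) := by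
  rw [spectralIntegrand, mul_assoc, ← Real.exp_add]
  ring_nf

theorem measurable_spectralIntegrand : Measurable (spectralIntegrand (d := d)) := by
  unfold spectralIntegrand; fun_prop

theorem rpow_mul_pi_div_rpow {A : ℝ} (hA : 0 < A) (d : ℕ) :
    A ^ (d : ℝ) * (Real.pi / A) ^ ((d : ℝ) / 2) = Real.pi ^ ((d : ℝ) / 2) * A ^ ((d : ℝ) / 2) := by
  have h1 : A ^ (d : ℝ) = A ^ ((d : ℝ) / 2) * A ^ ((d : ℝ) / 2) := by
    rw [← Real.rpow_add hA]; ring_nf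
  rw [Real.div_rpow Real.pi_pos.le hA.le, h1]
  field_simp

theorem ae_snd_pos [SFinite π] :
    ∀ᵐ q ∂(π.prod (volume.restrict (Set.Ioi (0 : ℝ)))), 0 < q.2 :=
  Measure.quasiMeasurePreserving_snd.ae (ae_restrict_mem measurableSet_Ioi)

/-- Integrating over `w` first leaves a multiple of the finite integral `hfin`. -/
theorem integrable_spectralIntegrand [IsProbabilityMeasure π]
    (hfin : ∫⁻ v, (∫⁻ A in Set.Ioi (0 : ℝ), ENNReal.ofReal (A ^ ((d : ℝ) / 2) *
          Real.exp (-((v : ℝ) ^ 2 * A)))) ∂π < ∞) :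
    Integrable (spectralIntegrand (d := d))
      ((π.prod (volume.restrict (Set.Ioi (0 : ℝ)))).prod volume) := by
  have hm := measurable_spectralIntegrand (d := d)
  refine ⟨hm.aestronglyMeasurable, ?_⟩
  have hnn : 0 ≤ᵐ[(π.prod (volume.restrict (Set.Ioi (0 : ℝ)))).prod
      (volume : Measure (EuclideanSpace ℝ (Fin d)))] spectralIntegrand (d := d) := by
    filter_upwards [Measure.quasiMeasurePreserving_fst.ae (ae_snd_pos (π := π))] with p hp
    simp only [Pi.zero_apply, spectralIntegrand]
    positivity
  rw [hasFiniteIntegral_iff_ofReal hnn, lintegral_prod _ (by fun_prop)]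
  have h1 : ∀ᵐ q ∂(π.prod (volume.restrict (Set.Ioi (0 : ℝ)))),
      ∫⁻ w : EuclideanSpace ℝ (Fin d), ENNReal.ofReal (spectralIntegrand (q, w)) =
      ENNReal.ofReal (Real.pi ^ ((d : ℝ) / 2)) *
        ENNReal.ofReal (q.2 ^ ((d : ℝ) / 2) * Real.exp (-((q.1 : ℝ) ^ 2 * q.2))) := by
    filter_upwards [ae_snd_pos] with q hq
    obtain ⟨v, A⟩ := q
    have hA : 0 < A := hq
    simp_rw [spectralIntegrand_eq, ENNReal.ofReal_mul
      (show 0 ≤ A ^ (d : ℝ) * Real.exp (-((v : ℝ) ^ 2 * A)) by positivity)]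
    rw [lintegral_const_mul _ (by fun_prop), lintegral_gaussian hA,
      ← ENNReal.ofReal_mul (by positivity), ← ENNReal.ofReal_mul (by positivity)]
    congr 1
    rw [mul_right_comm, rpow_mul_pi_div_rpow hA]
    ring
  rw [lintegral_congr_ae h1, lintegral_const_mul _ (by fun_prop), lintegral_prod _ (by fun_prop)]
  exact ENNReal.mul_lt_top ENNReal.ofReal_lt_top hfin

theorem integral_spectralIntegrand_left [IsProbabilityMeasure π] {w : EuclideanSpace ℝ (Fin d)} :
    ∫ q, spectralIntegrand (q, w) ∂(π.prod (volume.restrict (Set.Ioi (0 : ℝ)))) =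
      Real.Gamma ((d : ℝ) + 1) *
        ∫ v : Set.Ioi (0 : ℝ), (((v : ℝ) ^ 2 + ‖w‖ ^ 2) ^ (d + 1))⁻¹ ∂π := by
  have hm := measurable_spectralIntegrand (d := d)
  have hG : 0 < Real.Gamma ((d : ℝ) + 1) := Real.Gamma_pos_of_pos (by positivity)
  have hmw : Measurable fun q => spectralIntegrand (q, w) :=
    hm.comp (measurable_id.prodMk measurable_const)
  rw [integral_eq_lintegral_of_nonneg_ae _ hmw.aestronglyMeasurable,
    lintegral_prod _ (by fun_prop), ← integral_const_mul, integral_eq_lintegral_of_nonneg_ae (ae_of_all _ fun v => by positivity)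
      (by fun_prop)]
  · congr 1
    refine lintegral_congr fun v => ?_
    have hv : 0 < (v : ℝ) := v.2
    have hc : 0 < (v : ℝ) ^ 2 + ‖w‖ ^ 2 := by positivity
    exact integral_rpow_mul_exp_sum d hc
  · filter_upwards [ae_snd_pos] with q hq
    simp only [Pi.zero_apply, spectralIntegrand]
    positivity

theorem integral_spectralIntegrand_fourier {v : Set.Ioi (0 : ℝ)} {A : ℝ} (hA : 0 < A)
    (x : EuclideanSpace ℝ (Fin d)) :
    ∫ w : EuclideanSpace ℝ (Fin d), Complex.exp (Complex.I * ((inner ℝ w x : ℝ) : ℂ)) *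
      (spectralIntegrand ((v, A), w) : ℂ) =
      ((Real.pi ^ ((d : ℝ) / 2) * (A ^ ((d : ℝ) / 2) *
        Real.exp (-((v : ℝ) ^ 2 * A) - ‖x‖ ^ 2 / 4 / A)) : ℝ) : ℂ) := by
  have h1 : ∀ w : EuclideanSpace ℝ (Fin d),
      Complex.exp (Complex.I * ((inner ℝ w x : ℝ) : ℂ)) * (spectralIntegrand ((v, A), w) : ℂ) =
      ((A ^ (d : ℝ) * Real.exp (-((v : ℝ) ^ 2 * A)) : ℝ) : ℂ) *
      (Complex.exp (Complex.I * ((inner ℝ w x : ℝ) : ℂ)) *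
        ((Real.exp (-(A * ‖w‖ ^ 2)) : ℝ) : ℂ)) := by
    intro w
    rw [spectralIntegrand_eq, Complex.ofReal_mul]
    ring
  simp_rw [h1]
  rw [integral_const_mul, integral_gaussian_fourier hA, ← Complex.ofReal_mul]
  congr 1
  rw [sub_eq_add_neg, Real.exp_add, ← mul_assoc (Real.pi ^ _), ← rpow_mul_pi_div_rpow hA]
  ring

/-- The Fourier transform of the mixture of Matérn spectral densities. -/
theorem integral_exp_mul_spectral [IsProbabilityMeasure π]
    (hfin : ∫⁻ v, (∫⁻ A in Set.Ioi (0 : ℝ), ENNReal.ofReal (A ^ ((d : ℝ) / 2) *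
          Real.exp (-((v : ℝ) ^ 2 * A)))) ∂π < ∞) (x : EuclideanSpace ℝ (Fin d)) :
    ∫ w : EuclideanSpace ℝ (Fin d), Complex.exp (Complex.I * ((inner ℝ w x : ℝ) : ℂ)) *
      ((Real.Gamma ((d : ℝ) + 1) *
        ∫ v : Set.Ioi (0 : ℝ), (((v : ℝ) ^ 2 + ‖w‖ ^ 2) ^ (d + 1))⁻¹ ∂π : ℝ) : ℂ) =
      ((Real.pi ^ ((d : ℝ) / 2) * (∫⁻ v, (∫⁻ A in Set.Ioi (0 : ℝ),
        ENNReal.ofReal (A ^ ((d : ℝ) / 2) *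
          Real.exp (-((v : ℝ) ^ 2 * A) - ‖x‖ ^ 2 / 4 / A))) ∂π).toReal : ℝ) : ℂ) := by
  have hm := measurable_spectralIntegrand (d := d)
  have hi := integrable_spectralIntegrand hfin
  have hF : Integrable (fun p : (Set.Ioi (0 : ℝ) × ℝ) × EuclideanSpace ℝ (Fin d) =>
      Complex.exp (Complex.I * ((inner ℝ p.2 x : ℝ) : ℂ)) * (spectralIntegrand p : ℂ))
      ((π.prod (volume.restrict (Set.Ioi (0 : ℝ)))).prod volume) := by
    refine hi.norm.mono' (by fun_prop) (ae_of_all _ fun p => ?_)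
    rw [norm_mul, mul_comm Complex.I, Complex.norm_exp_ofReal_mul_I, one_mul, Complex.norm_real]
  simp_rw [← integral_spectralIntegrand_left, ← integral_complex_ofReal, ← integral_const_mul]
  -- Fubini: integrating over `(v, A)` first gives the spectral density, and over `w` first gives
  -- the covariance mixture.
  rw [← integral_integral_swap (f := fun q w =>
    Complex.exp (Complex.I * ((inner ℝ w x : ℝ) : ℂ)) * (spectralIntegrand (q, w) : ℂ)) hF]
  have h1 : ∀ᵐ q ∂(π.prod (volume.restrict (Set.Ioi (0 : ℝ)))),
      ∫ w : EuclideanSpace ℝ (Fin d), Complex.exp (Complex.I * ((inner ℝ w x : ℝ) : ℂ)) *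
      (spectralIntegrand (q, w) : ℂ) =
      ((Real.pi ^ ((d : ℝ) / 2) * (q.2 ^ ((d : ℝ) / 2) *
        Real.exp (-((q.1 : ℝ) ^ 2 * q.2) - ‖x‖ ^ 2 / 4 / q.2)) : ℝ) : ℂ) := by
    filter_upwards [ae_snd_pos] with q hq
    exact integral_spectralIntegrand_fourier hq x
  rw [integral_congr_ae h1, integral_complex_ofReal, integral_const_mul,
    integral_eq_lintegral_of_nonneg_ae _ (by fun_prop), lintegral_prod _ (by fun_prop)]
  filter_upwards [ae_snd_pos] with q hq
  simp only [Pi.zero_apply]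
  positivity

theorem integrable_spectral [IsProbabilityMeasure π]
    (hfin : ∫⁻ v, (∫⁻ A in Set.Ioi (0 : ℝ), ENNReal.ofReal (A ^ ((d : ℝ) / 2) *
          Real.exp (-((v : ℝ) ^ 2 * A)))) ∂π < ∞) :
    Integrable fun w : EuclideanSpace ℝ (Fin d) =>
      Real.Gamma ((d : ℝ) + 1) *
        ∫ v : Set.Ioi (0 : ℝ), (((v : ℝ) ^ 2 + ‖w‖ ^ 2) ^ (d + 1))⁻¹ ∂π := by
  have hi := (integrable_spectralIntegrand hfin).integral_prod_right
  simpa only [integral_spectralIntegrand_left] using hi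

theorem IsSupCARField.isSpectralDensity [IsProbabilityMeasure P] [IsProbabilityMeasure π]
    (hW : IsLevyMeasure W)
    (hb : 0 ≤ b) (hX : IsSupCARField P S Λ b W π X) (hmom : ∀ t, MemLp (X t) 2 P)
    (hmean : ∀ t, ∫ ω, X t ω ∂P = 0) (hd : 1 ≤ d) :
    IsSpectralDensity P X (spectralDensity d (levyVar b W).toReal π) := by
  have hG : 0 < Real.Gamma ((d : ℝ) + 1) := Real.Gamma_pos_of_pos (by positivity)
  rcases eq_or_ne (levyVar b W) 0 with h0 | h0
  -- Zero variance is treated separately: finiteness of the kernel integral cannot be inferred then,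
  -- but the density is zero.
  · have h1 : spectralDensity d (levyVar b W).toReal π = fun _ => 0 := by
      funext w; simp [spectralDensity, h0]
    rw [h1]
    refine ⟨fun _ => le_rfl, integrable_zero _ _ _, fun s t => ?_⟩
    rw [hX.covariance_eq_lintegral hW hb hmom hmean, h0]
    simp
  have hfin := hX.lintegral_lt_top hW hb hmom hmean (pos_iff_ne_zero.2 h0)
  have h1 : spectralDensity d (levyVar b W).toReal π = fun w =>
      (levyVar b W).toReal * c1 d ^ 2 / Real.Gamma ((d : ℝ) + 1) * (Real.Gamma ((d : ℝ) + 1) *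
        ∫ v : Set.Ioi (0 : ℝ), (((v : ℝ) ^ 2 + ‖w‖ ^ 2) ^ (d + 1))⁻¹ ∂π) := by
    funext w
    rw [spectralDensity]
    field_simp
  refine ⟨spectralDensity_nonneg ENNReal.toReal_nonneg, ?_, fun s t => ?_⟩
  · rw [h1]
    exact (integrable_spectral hfin).const_mul _
  · rw [hX.covariance_eq_lintegral hW hb hmom hmean, h1]
    have h2 := integral_exp_mul_spectral hfin (t - s)
    have h3 : ∀ w : EuclideanSpace ℝ (Fin d),
        Complex.exp (Complex.I * ((inner ℝ w (t - s) : ℝ) : ℂ)) *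
        (((levyVar b W).toReal * c1 d ^ 2 / Real.Gamma ((d : ℝ) + 1) *
          (Real.Gamma ((d : ℝ) + 1) *
          ∫ v : Set.Ioi (0 : ℝ), (((v : ℝ) ^ 2 + ‖w‖ ^ 2) ^ (d + 1))⁻¹ ∂π) : ℝ) : ℂ) =
        (((levyVar b W).toReal * c1 d ^ 2 / Real.Gamma ((d : ℝ) + 1) : ℝ) : ℂ) *
        (Complex.exp (Complex.I * ((inner ℝ w (t - s) : ℝ) : ℂ)) *
        ((Real.Gamma ((d : ℝ) + 1) *
          ∫ v : Set.Ioi (0 : ℝ), (((v : ℝ) ^ 2 + ‖w‖ ^ 2) ^ (d + 1))⁻¹ ∂π : ℝ) : ℂ)) := by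
      intro w
      rw [Complex.ofReal_mul ((levyVar b W).toReal * c1 d ^ 2 / Real.Gamma ((d : ℝ) + 1))]
      ring
    simp_rw [h3]
    rw [integral_const_mul, h2, ← Complex.ofReal_mul, norm_sub_rev s t]
    congr 1
    have h4 : kernelConst d = c1 d ^ 2 * Real.pi ^ ((d : ℝ) / 2) / Real.Gamma ((d : ℝ) + 1) := by
      rw [← kernelConst_mul_Gamma hd]; field_simp
    rw [h4]
    ring

/-- Two spectral densities which are continuous off the origin coincide off the origin. -/
theorem IsSpectralDensity.eqOn {f g : EuclideanSpace ℝ (Fin d) → ℝ} (hf : IsSpectralDensity P X f)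
    (hg : IsSpectralDensity P X g) (hfc : ContinuousOn f {0}ᶜ) (hgc : ContinuousOn g {0}ᶜ) :
    Set.EqOn f g {0}ᶜ := by
  have hfin : ∀ {f : EuclideanSpace ℝ (Fin d) → ℝ}, IsSpectralDensity P X f →
      IsFiniteMeasure (volume.withDensity fun w => ENNReal.ofReal (f w)) := fun hf =>
    isFiniteMeasure_withDensity_ofReal hf.integrable.2
  have hchar : ∀ {f : EuclideanSpace ℝ (Fin d) → ℝ}, IsSpectralDensity P X f →
      ∀ t, charFun (volume.withDensity fun w => ENNReal.ofReal (f w)) t =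
        ((covariance (X 0) (X t) P : ℝ) : ℂ) := by
    intro f hf t
    rw [charFun_apply, integral_withDensity_eq_integral_toReal_smul₀
      hf.integrable.aestronglyMeasurable.aemeasurable.ennreal_ofReal
      (ae_of_all _ fun _ => ENNReal.ofReal_lt_top), hf.cov_eq]
    refine integral_congr_ae (ae_of_all _ fun w => ?_)
    dsimp only
    rw [ENNReal.toReal_ofReal (hf.nonneg w), sub_zero, Complex.real_smul, mul_comm,
      mul_comm Complex.I]
  have := hfin hf
  have := hfin hg
  -- Both densities define finite measures with the covariance as characteristic function, so the
  -- measures agree. Continuity upgrades the resulting almost everywhere equality to equality off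
  -- the origin.
  have h1 : (volume.withDensity fun w => ENNReal.ofReal (f w)) =
      volume.withDensity fun w => ENNReal.ofReal (g w) :=
    Measure.ext_of_charFun (funext fun t => by rw [hchar hf, hchar hg])
  rw [withDensity_eq_iff_of_sigmaFinite
    hf.integrable.aestronglyMeasurable.aemeasurable.ennreal_ofReal
    hg.integrable.aestronglyMeasurable.aemeasurable.ennreal_ofReal] at h1
  refine Measure.eqOn_open_of_ae_eq (μ := volume) (ae_restrict_of_ae ?_) isOpen_compl_singleton
    hfc hgc
  filter_upwards [h1] with w hw
  exact (ENNReal.ofReal_eq_ofReal_iff (hf.nonneg w) (hg.nonneg w)).1 hw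

end Spectral

/-! ### Asymptotics of the spectral density -/

section SpectralAsymptotics

variable {d : ℕ} {π : Measure (Set.Ioi (0 : ℝ))} {L l : ℝ → ℝ} {α : ℝ}

/-- These are the exponents `γ = 0` and `β = 2d + 2` of the Abelian theorem; the latter is where `α
< 2d + 2` enters. -/
theorem inv_one_add_sq_pow_le (d : ℕ) {v : ℝ} (hv : 0 < v) :
    ((1 + v ^ 2) ^ (d + 1))⁻¹ ≤ 1 * v ^ (-(0 : ℝ)) ∧
      ((1 + v ^ 2) ^ (d + 1))⁻¹ ≤ 1 * v ^ (-(2 * (d : ℝ) + 2)) := by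
  constructor
  · rw [neg_zero, Real.rpow_zero, mul_one]
    exact inv_le_one_of_one_le₀ (one_le_pow₀ (by nlinarith [sq_nonneg v]))
  · have h : v ^ (2 * (d : ℝ) + 2) = (v ^ 2) ^ (d + 1) := by
      rw [← pow_mul, ← Real.rpow_natCast]; congr 1; push_cast; ring
    rw [one_mul, Real.rpow_neg hv.le, h]
    gcongr
    linarith

theorem tendsto_inv_norm_nhdsNE :
    Tendsto (fun w : EuclideanSpace ℝ (Fin d) => 1 / ‖w‖) (𝓝[≠] 0) atTop := by
  simp only [one_div]
  exact tendsto_inv_nhdsGT_zero.comp tendsto_norm_nhdsNE_zero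

theorem spectral_mellin_pos (hα : (d : ℝ) + 2 < α) (hα2 : α < 2 * (d : ℝ) + 2) :
    0 < ∫ v in Set.Ioi (0 : ℝ), v ^ (α - 1) * ((1 + v ^ 2) ^ (d + 1))⁻¹ :=
  setIntegral_Ioi_pos (integrableOn_rpow_mul (by fun_prop) (fun v _ => by positivity)
    (fun v hv => (inv_one_add_sq_pow_le d hv).1) (fun v hv => (inv_one_add_sq_pow_le d hv).2)
    (by linarith [d.cast_nonneg (α := ℝ)]) hα2) fun v hv => by positivity

theorem c4_eq (d : ℕ) (α σ : ℝ) : c4 d α (-σ) =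
    σ * c1 d ^ 2 * ∫ v in Set.Ioi (0 : ℝ), v ^ (α - 1) * ((1 + v ^ 2) ^ (d + 1))⁻¹ := by
  simp only [c4, div_eq_mul_inv]
  ring

/-- Pulling out `‖w‖^(-2(d+1))` leaves the profile `(1 + v²)^(-(d+1))` evaluated at `v / ‖w‖`, so
the Abelian theorem applies with `R = 1 / ‖w‖`. -/
theorem spectralDensity_isEquivalent [IsProbabilityMeasure π] (hd : 1 ≤ d)
    (hα : (d : ℝ) + 2 < α) (hα2 : α < 2 * (d : ℝ) + 2)
    (hLm : Measurable L) (hLpos : ∀ x, 0 < x → 0 < L x)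
    (hL : ∀ c : ℝ, 0 < c → Tendsto (fun x => L (c * x) / L x) atTop (𝓝 1))
    (hLl : ∀ x, 0 < x → L x = l x)
    (hπ : π = (Measure.comap Subtype.val volume).withDensity
      (fun v : Set.Ioi (0 : ℝ) => ENNReal.ofReal (l (1 / (v : ℝ)) * (v : ℝ) ^ (α - 1)))) (σ : ℝ) :
    spectralDensity d σ π ~[𝓝[≠] 0]
      (fun w => c4 d α (-σ) * (l (1 / ‖w‖) / ‖w‖ ^ (2 * (d : ℝ) + 2 - α))) := by
  have hlim := tendsto_lintegral_scaled hLm hLpos hL hLl hπ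
    (h := fun v => ((1 + v ^ 2) ^ (d + 1))⁻¹)
    (by fun_prop) (fun v _ => by positivity)
    (fun v hv => (inv_one_add_sq_pow_le d hv).1) (fun v hv => (inv_one_add_sq_pow_le d hv).2)
    (by linarith [d.cast_nonneg (α := ℝ)]) (by linarith [d.cast_nonneg (α := ℝ)]) hα2
  have hI0 := spectral_mellin_pos hα hα2
  rw [c4_eq]
  set I := ∫ v in Set.Ioi (0 : ℝ), v ^ (α - 1) * ((1 + v ^ 2) ^ (d + 1))⁻¹ with hI
  rcases eq_or_ne σ 0 with h0 | h0
  · have h1 : spectralDensity d σ π = fun _ => 0 := by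
      funext w; simp [spectralDensity, h0]
    rw [h1, h0]
    simp only [zero_mul]
    exact IsEquivalent.refl
  have hc1 := c1_ne_zero hd
  refine isEquivalent_of_tendsto_one ?_
  have h2 := (hlim.comp (tendsto_inv_norm_nhdsNE (d := d))).div_const I
  rw [div_self hI0.ne'] at h2
  refine h2.congr' ?_
  filter_upwards [self_mem_nhdsWithin] with w hw
  have hw0 : 0 < ‖w‖ := norm_pos_iff.2 hw
  have hL0 := hLpos (1 / ‖w‖) (by positivity)
  have h3 : ∫ v : Set.Ioi (0 : ℝ), (((v : ℝ) ^ 2 + ‖w‖ ^ 2) ^ (d + 1))⁻¹ ∂π =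
      ((‖w‖ ^ 2) ^ (d + 1))⁻¹ *
      (∫⁻ v : Set.Ioi (0 : ℝ), ENNReal.ofReal ((1 + ((v : ℝ) * (1 / ‖w‖)) ^ 2) ^ (d + 1))⁻¹ ∂π).toReal := by
    rw [← integral_eq_lintegral_of_nonneg_ae (ae_of_all _ fun v => by positivity) (by fun_prop),
      ← integral_const_mul]
    refine integral_congr_ae (ae_of_all _ fun v => ?_)
    dsimp only
    rw [← mul_inv, ← mul_pow]
    congr 2
    field_simp
    ring
  have h4 : ‖w‖ ^ (2 * (d : ℝ) + 2 - α) = (‖w‖ ^ 2) ^ (d + 1) / ‖w‖ ^ α := by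
    rw [Real.rpow_sub hw0, ← pow_mul, ← Real.rpow_natCast]
    congr 2; push_cast; ring
  simp only [Function.comp_apply, Pi.div_apply]
  rw [spectralDensity, h3, h4, ← hLl _ (by positivity), Real.rpow_neg (by positivity),
    Real.div_rpow zero_le_one hw0.le, Real.one_rpow]
  have h5 : 0 < ‖w‖ ^ α := by positivity
  generalize ENNReal.toReal _ = J
  field_simp

theorem tendsto_regularlyVarying_nhdsNE (hLm : Measurable L) (hLpos : ∀ x, 0 < x → 0 < L x)
    (hL : ∀ c : ℝ, 0 < c → Tendsto (fun x => L (c * x) / L x) atTop (𝓝 1))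
    (hLl : ∀ x, 0 < x → L x = l x) {ε : ℝ} (hε : 0 < ε) :
    Tendsto (fun w : EuclideanSpace ℝ (Fin d) => l (1 / ‖w‖) / ‖w‖ ^ ε) (𝓝[≠] 0) atTop := by
  refine ((tendsto_mul_rpow_atTop hLm hLpos hL hε).comp tendsto_inv_norm_nhdsNE).congr' ?_
  filter_upwards [self_mem_nhdsWithin] with w hw
  have hw0 : 0 < ‖w‖ := norm_pos_iff.2 hw
  simp only [Function.comp_apply]
  rw [← hLl _ (by positivity), Real.div_rpow zero_le_one hw0.le, Real.one_rpow]
  ring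

end SpectralAsymptotics

end SupCAR

end

/-! ### The main theorem. -/

theorem proposition3 {Ω : Type*} [MeasurableSpace Ω] (P : Measure Ω) [IsProbabilityMeasure P]
    (d : ℕ) (hd : 1 ≤ d)
    (b : ℝ) (W : Measure ℝ) (hW : SupCAR.IsLevyMeasure W)
    (π : Measure (Set.Ioi (0 : ℝ))) [IsProbabilityMeasure π]
    (S : Set (Set (SupCAR.Param d))) (Λ : Set (SupCAR.Param d) → Ω → ℝ)
    (X : EuclideanSpace ℝ (Fin d) → Ω → ℝ)
    (hX : SupCAR.IsSupCARField P S Λ b W π X)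
    (hcond : SupCAR.WellDefinedConditions d b W π)
    (hmom : ∀ t, MemLp (X t) 2 P) (hmean : ∀ t, ∫ ω, X t ω ∂P = 0)
    (α : ℝ) (hα : (d : ℝ) + 2 < α)
    (l : ℝ → ℝ) (hl : SupCAR.IsSlowlyVarying l) (hlpos : ∀ x, 0 < x → 0 < l x)
    (hlbdd : ∀ C : Set ℝ, C ⊆ Set.Ioi 0 → IsCompact C → BddAbove (l '' C))
    (hπ : π = (Measure.comap Subtype.val volume).withDensity
      (fun v : Set.Ioi (0 : ℝ) => ENNReal.ofReal (l (1 / (v : ℝ)) * (v : ℝ) ^ (α - 1)))) :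
    ∃ κ : ℝ,
      -- `K` is twice continuously differentiable and `κ = K''(0)`
      ContDiff ℝ 2 (SupCAR.cumulant b W) ∧
      deriv (deriv (SupCAR.cumulant b W)) 0 = (κ : ℂ) ∧
      -- the covariance function and its asymptotics
      (∀ s t, covariance (X s) (X (s + t)) P = SupCAR.covFun P X t) ∧
      SupCAR.covFun P X ~[comap norm atTop]
        (fun t => SupCAR.c3 d α κ * (l ‖t‖ / ‖t‖ ^ (α - d - 2))) ∧
      -- the spectral density and its singularity at the origin
      (α < 2 * (d : ℝ) + 2 →
        (∃ f, SupCAR.IsSpectralDensity P X f ∧ ContinuousOn f {0}ᶜ) ∧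
        ∀ f, SupCAR.IsSpectralDensity P X f → ContinuousOn f {0}ᶜ →
          f ~[𝓝[≠] 0]
            (fun w => SupCAR.c4 d α κ * (l (1 / ‖w‖) / ‖w‖ ^ (2 * (d : ℝ) + 2 - α))) ∧
          (0 < b ∨ W ≠ 0 → Tendsto f (𝓝[≠] 0) atTop)) := by
  have hb : 0 ≤ b := hcond.nonneg
  have hfin := hX.levyVar_lt_top hW hb hmom hmean
  obtain ⟨L, hLm, hLl⟩ := hl.exists_measurable_extension
  have hLpos : ∀ x, 0 < x → 0 < L x := fun x hx => (hLl x hx).symm ▸ hlpos x hx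
  have hL : ∀ c : ℝ, 0 < c → Tendsto (fun x => L (c * x) / L x) atTop (𝓝 1) := fun c hc =>
    (hl.tendsto c hc).congr' (by
      filter_upwards [eventually_gt_atTop 0] with x hx
      rw [hLl x hx, hLl (c * x) (mul_pos hc hx)])
  refine ⟨-(SupCAR.levyVar b W).toReal, SupCAR.contDiff_cumulant hW hfin,
    SupCAR.deriv_deriv_cumulant_zero hW hb hfin, hX.covariance_add_eq hW hb hmom hmean,
    hX.covFun_isEquivalent hW hb hmom hmean hd hα hLm hLpos hL hLl hπ, fun hα2 => ?_⟩
  have hspec := hX.isSpectralDensity hW hb hmom hmean hd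
  have hcont := SupCAR.continuousOn_spectralDensity (d := d) (π := π)
    (SupCAR.levyVar b W).toReal
  refine ⟨⟨_, hspec, hcont⟩, fun f hf hfc => ?_⟩
  -- Any admissible `f` agrees with the explicit density off the origin, so it inherits its
  -- asymptotics.
  have heq : SupCAR.spectralDensity d (SupCAR.levyVar b W).toReal π =ᶠ[𝓝[≠] 0] f := by
    filter_upwards [self_mem_nhdsWithin] with w hw
    exact hspec.eqOn hf hcont hfc hw
  have hasymp := (SupCAR.spectralDensity_isEquivalent hd hα hα2 hLm hLpos hL hLl hπ
    (SupCAR.levyVar b W).toReal).congr_left heq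
  refine ⟨hasymp, fun hne => ?_⟩
  have hσ : 0 < (SupCAR.levyVar b W).toReal :=
    ENNReal.toReal_pos (SupCAR.levyVar_pos hW hne).ne' hfin.ne
  refine hasymp.symm.tendsto_atTop ?_
  refine (SupCAR.tendsto_regularlyVarying_nhdsNE hLm hLpos hL hLl (by linarith)).const_mul_atTop ?_
  rw [SupCAR.c4_eq]
  have := SupCAR.spectral_mellin_pos hα hα2
  have := SupCAR.c1_ne_zero hd
  positivity
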